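/- Let $X=\mathbb R$ or $X=\mathbb Z$, let $d\ge 2$ be an integer, and let $X^d$ carry Lebesgue measure ($X=\mathbb R$) or counting measure ($X=\mathbb Z$). Write $x=(x',x_d)\in X^{d-1}\times X$, and let $C_c^\infty(\mathbb Z^m)$ mean the finitely supported functions on $\mathbb Z^m$. Let $k>0$ be real. For $K\in L^\infty(X^d\times X^d)$ put $$Kf(x)=\int_{X^d}K(x,y)f(y)\,dy\quad (f\in C_c^\infty(X^d)),\qquad K^*(x,y)=\overline{K(y,x)},$$ and for $x_d,y_d,z_d\in X$ and $g\in C_c^\infty(X^{d-1})$ put $$S_{x_d}(y_d,z_d)g(y')=\int_{X^{d-1}}\int_{X^{d-1}}\overline{K(x,y)}\,K(x,z)\,g(z')\,dz'\,dx',$$ where this double integral is assumed to converge absolutely for almost every $y'$. Suppose that, with constants $C_2,C_3,C_4>0$, both $K$ and $K^*$ satisfy, for all $x_d,y_d,z_d\in X$, all $g\in C_c^\infty(X^{d-1})$ and all $x,y\in X^d$, $$\|S_{x_d}(y_d,z_d)g\|_{L^2(X^{d-1})}\le C_2^2\|g\|_{L^2(X^{d-1})},\qquad \|S_{x_d}(y_d,z_d)g\|_{L^\infty(X^{d-1})}\le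 C_3^2(1+|y_d-z_d|)^{-k}\|g\|_{L^1(X^{d-1})},$$ $$|K(x,y)|\le C_4(1+|x-y|)^{-k}$$ (for $K^*$, the operators $S_{x_d}(y_d,z_d)$ are formed with $K^*$ in place of $K$). Let $1\le p,q\le\infty$, $\frac1{p^*}=1-\frac1p$ and $\frac1p-\frac1q=\frac1l$. Then there is a constant $L_{p,q,k}>0$, depending only on $p,q,k$, such that, whenever $(p,q)$ lies in one of the three ranges below, $K$ extends from $C_c^\infty(X^d)$ to a bounded operator $L^p(X^d)\to L^q(X^d)$ with $$\|Kf\|_{L^q(X^d)}\le L_{p,q,k}\,C_{p,q,k,l}\,\|f\|_{L^p(X^d)},\qquad f\in L^p(X^d),$$ where $$C_{p,q,k,l}=\begin{cases} C_2^{\frac{2}{p^*}}\,C_3^{\frac2q-\frac2{p^*}}\,C_4^{1-\frac2q}, & 1\le p\le\frac{(k+1)(2k+1)}{k^2+3k+1},\ q>\frac{1+2k}{k},\ \frac{k+1}{k}\cdot\frac1{p^*}\le\frac1q,\\[4pt] C_2^{\frac{2k}{2k+1}\left(1-\frac1l\right)}\,C_3^{\frac{2}{2k+1}\left(1-\frac1l\right)}\,C_4^{\frac{2(k+1)-l}{(2k+1)l}},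 & 1\le l\le k+1,\ \frac{k}{(k+1)q}<\frac1{p^*}<\frac{k+1}{kq},\\[4pt] C_2^{\frac2q}\,C_3^{\frac2{p^*}-\frac2q}\,C_4^{1-\frac2{p^*}}, & 1\le p<\frac{1+2k}{1+k},\ q\ge\frac{(2k+1)(k+1)}{k^2},\ \frac{k+1}{kq}\le\frac1{p^*}. \end{cases}$$ -/

import Mathlib

open MeasureTheory
open scoped ENNReal ContDiff ComplexConjugate

namespace OffDuality

/-- `X^d` with `d = n + 1`, written as pairs `x = (x', x_d)` with `x'` in `X^{d-1}` and `x_d` in `X`.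
For `X = ℝ` its `volume` is the Lebesgue measure, for `X = ℤ` the counting measure. -/
abbrev Pt (X : Type) (n : ℕ) : Type := (Fin n → X) × X

/-- `C_c^∞(E)`, complex valued. -/
def smoothTest (E : Type) [NormedAddCommGroup E] [NormedSpace ℝ E] : Set (E → ℂ) :=
  {g | ContDiff ℝ ∞ g ∧ HasCompactSupport g}

/-- The finitely supported functions: the test functions on `ℤ^m`. -/
def finTest (α : Type) : Set (α → ℂ) :=
  {g | g.support.Finite}

/-- The counting measure on `ℤ`. -/
noncomputable instance instMeasureSpaceInt : MeasureSpace ℤ := ⟨Measure.count⟩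

instance instSigmaFiniteInt : SigmaFinite (volume : Measure ℤ) :=
  inferInstanceAs (SigmaFinite (Measure.count : Measure ℤ))

section

variable {X : Type} [NormedAddCommGroup X] {n : ℕ}

/-- The Euclidean distance `|x - y|` on `X^d`. -/
noncomputable def euclDist (x y : Pt X n) : ℝ :=
  Real.sqrt ((∑ i, ‖x.1 i - y.1 i‖ ^ 2) + ‖x.2 - y.2‖ ^ 2)

/-- The adjoint kernel `K^*(x, y) = conj (K (y, x))`. -/
noncomputable def adjKernel (K : Pt X n → Pt X n → ℂ) : Pt X n → Pt X n → ℂ :=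
  fun x y => conj (K y x)

/-- The pointwise bound `|K(x, y)| ≤ C₄ (1 + |x - y|)^{-k}`. -/
def Decay (k C₄ : ℝ) (K : Pt X n → Pt X n → ℂ) : Prop :=
  ∀ x y, ‖K x y‖ ≤ C₄ * (1 + euclDist x y) ^ (-k)

variable [MeasureSpace X]

/-- `K f (x) = ∫ K(x, y) f(y) dy`. -/
noncomputable def kernelOp (K : Pt X n → Pt X n → ℂ) (f : Pt X n → ℂ) (x : Pt X n) : ℂ :=
  ∫ y, K x y * f y

/-- `S_{s}(t, u) g (y') = ∫ ∫ conj (K((x', s), (y', t))) K((x', s), (z', u)) g(z') dz' dx'`. -/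
noncomputable def fibreS (K : Pt X n → Pt X n → ℂ) (s t u : X) (g : (Fin n → X) → ℂ)
    (y' : Fin n → X) : ℂ :=
  ∫ x' : Fin n → X, ∫ z' : Fin n → X,
    conj (K (x', s) (y', t)) * K (x', s) (z', u) * g z'

/-- The fibrewise `T T^*` hypotheses with constants `C₂`, `C₃`, tested on the functions in `D`:
the double integral defining `S_s(t, u) g` converges absolutely, and `S_s(t, u)` obeys the
`L²` bound and the `L¹ → L^∞` decay bound. -/
structure FibreBounds (D : Set ((Fin n → X) → ℂ)) (k C₂ C₃ : ℝ)
    (K : Pt X n → Pt X n → ℂ) : Prop where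
  converges : ∀ (s t u : X), ∀ g ∈ D, ∀ᵐ y' : Fin n → X,
    Integrable (fun w : (Fin n → X) × (Fin n → X) =>
      conj (K (w.1, s) (y', t)) * K (w.1, s) (w.2, u) * g w.2)
  l2_bound : ∀ (s t u : X), ∀ g ∈ D,
    eLpNorm (fibreS K s t u g) 2 volume ≤ ENNReal.ofReal (C₂ ^ 2) * eLpNorm g 2 volume
  decay_bound : ∀ (s t u : X), ∀ g ∈ D,
    eLpNorm (fibreS K s t u g) ∞ volume
      ≤ ENNReal.ofReal (C₃ ^ 2 * (1 + ‖t - u‖) ^ (-k)) * eLpNorm g 1 volume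

/-- The operator with kernel `K`, given on the test functions in `D` by the integral, extends to a
bounded operator from `L^p(X^d)` to `L^q(X^d)` of norm at most `M`. -/
def BoundedBy (D : Set (Pt X n → ℂ)) (K : Pt X n → Pt X n → ℂ)
    (p q : ℝ≥0∞) [Fact (1 ≤ p)] [Fact (1 ≤ q)] (M : ℝ) : Prop :=
  ∃ T : Lp ℂ p (volume : Measure (Pt X n)) →L[ℂ] Lp ℂ q (volume : Measure (Pt X n)),
    ‖T‖ ≤ M ∧ ∀ f ∈ D, ∃ hf : MemLp f p (volume : Measure (Pt X n)),
      (T (hf.toLp f) : Pt X n → ℂ) =ᵐ[volume] kernelOp K f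

end

/-- `1/p` as a real number, with `1/∞ = 0`. -/
noncomputable def recip (p : ℝ≥0∞) : ℝ := (p⁻¹).toReal

/-- `1/p^* = 1 - 1/p`, where `p^* = p/(p-1)`. -/
noncomputable def recipConj (p : ℝ≥0∞) : ℝ := 1 - recip p

/-- First range of exponents. -/
def Range₁ (k : ℝ) (p q : ℝ≥0∞) : Prop :=
  p ≤ ENNReal.ofReal ((k + 1) * (2 * k + 1) / (k ^ 2 + 3 * k + 1)) ∧
  ENNReal.ofReal ((1 + 2 * k) / k) < q ∧
  (k + 1) / k * recipConj p ≤ recip q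

/-- Second range of exponents. -/
def Range₂ (k l : ℝ) (p q : ℝ≥0∞) : Prop :=
  1 ≤ l ∧ l ≤ k + 1 ∧
  k / (k + 1) * recip q < recipConj p ∧ recipConj p < (k + 1) / k * recip q

/-- Third range of exponents. -/
def Range₃ (k : ℝ) (p q : ℝ≥0∞) : Prop :=
  p < ENNReal.ofReal ((1 + 2 * k) / (1 + k)) ∧
  ENNReal.ofReal ((2 * k + 1) * (k + 1) / k ^ 2) ≤ q ∧
  (k + 1) / k * recip q ≤ recipConj p

open Classical in
/-- The product of powers of the constants, in each of the three ranges (the first and the third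
meet only in `(p, q) = (1, ∞)`, where both products are `C₄`). -/
noncomputable def normConst (k l : ℝ) (p q : ℝ≥0∞) (C₂ C₃ C₄ : ℝ) : ℝ :=
  if Range₁ k p q then
    C₂ ^ (2 * recipConj p) * C₃ ^ (2 * recip q - 2 * recipConj p) * C₄ ^ (1 - 2 * recip q)
  else if Range₂ k l p q then
    C₂ ^ (2 * k / (2 * k + 1) * (1 - 1 / l)) * C₃ ^ (2 / (2 * k + 1) * (1 - 1 / l)) *
      C₄ ^ ((2 * (k + 1) - l) / ((2 * k + 1) * l))
  else
    C₂ ^ (2 * recip q) * C₃ ^ (2 * recipConj p - 2 * recip q) * C₄ ^ (1 - 2 * recipConj p)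

end OffDuality

/-!
Write `a = 1/p^*` and `b = 1/q`. The bound is a `T^* T` argument of Stein–Tomas type on the fibres
`x_d = const`, followed by an interpolation of restricted type bounds which keeps track of the
constants.

Split the kernel dyadically as `K = ∑ K_j`, with `K_j` supported where `2 ^ j ≤ 1 + |x_d - y_d| <
2 ^ (j + 1)`. For fixed `x_d`, write the operator as `∫ A_t φ_t dt`, where `φ_t = φ (·, t)` and
`A_t` has the kernel `K ((·, x_d), (·, t))`. Then `‖∫ A_t φ_t dt‖²` is at most `∬ |⟨φ_t, A_t^* A_u
φ_u⟩| dt du` (`lintegral_sq_le_fibreEnergy`), and the operators `A_t^* A_u` are those of the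
hypothesis. If `φ` is bounded by the indicator function of `E`, the integrand is bounded by the
`L²` hypothesis and by the `L¹ → L^∞` hypothesis; taking the two with the weights `1 - θ` and `θ`
leaves a double integral with the kernel `(1 + |t - u|) ^ (-k θ)`. For `1/(k + 1) ≤ θ ≤ 1` it is
controlled by the Hardy–Littlewood–Sobolev inequality in the last variable
(`exists_hardyLittlewoodSobolev`, `exists_fibreEnergy_le`). Integration over `x_d` costs a factor
`2 ^ (j / 2)` in the `L²` bound for `K_j` (`exists_lintegral_band_sq_le`), which competes with the
trivial bound, of size `2 ^ (-k j)`. The sum over `j` of the minimum of the two is a bound for `∫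
ψ (K φ)` when `φ` and `ψ` are bounded by indicator functions, one for each `θ`
(`exists_restrictedBound`). It belongs to the point with `b = k/(2k + 1)` and `a = (1 - θ) b`.

Restricted type bounds at two points imply the strong type bound between them, with the geometric
mean of the constants (`exists_interpolation`, `exists_strongBound`). In the first range the
second point is the origin `a = b = 0`, where `|∫ ψ (K φ)| ≤ C₄ |E| |F|`, and `θ` is chosen such
that `(a, b)` lies on the ray from the origin through the point belonging to `θ`
(`exists_strongBound_below_ray`). The adjoint kernel satisfies the same hypotheses, and its bound
at `(b, a)` is a bound for `K` at `(a, b)`; this gives the third range (`StrongBound.of_adjoint`).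
In the second range, `(a, b)` lies in the triangle spanned by the origin, the point which belongs
to `θ = 1/(k + 1)`, and its reflection (`exists_strongBound_between_rays`).

By duality and density, the bounds for the bilinear form extend the operator to the Lebesgue
spaces (`exists_continuousLinearMap_of_eLpNorm_le`); here `p < ∞`, which holds in all three
ranges. The space enters only through the growth of balls in the last variable (`LinearGrowth`)
and through the approximation of bounded functions by test functions (`Approximating`), so that
`ℝ` and `ℤ` are treated together (`exists_boundedBy_of_range`). As `K` is only measurable up to a
null set, it is replaced by a measurable version; the hypotheses on its fibres then survive for
almost all values of the last variables, which is enough (`FibredKernel`).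
-/

namespace OffDuality

open Filter Topology

/-! ### Sums over dyadic scales -/

theorem summable_two_rpow_neg_abs {δ : ℝ} (hδ : 0 < δ) :
    Summable fun j : ℤ => (2 : ℝ) ^ (-δ * |(j : ℝ)|) := by
  have h : Summable fun n : ℕ => ((2 : ℝ) ^ (-δ)) ^ n :=
    summable_geometric_of_lt_one (by positivity)
      (Real.rpow_lt_one_of_one_lt_of_neg (by norm_num) (by linarith))
  have h' : ∀ n : ℕ, (2 : ℝ) ^ (-δ * (n : ℝ)) = ((2 : ℝ) ^ (-δ)) ^ n := fun n => by
    rw [Real.rpow_mul (by norm_num), Real.rpow_natCast]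
  refine Summable.of_nat_of_neg (h.congr fun n => ?_) (h.congr fun n => ?_)
  · simp [← h']
  · simp [← h']

/-- Two geometric progressions, one increasing and one decreasing: the sum of their minima is
comparable to the common value at the crossing point, whatever the two prefactors are. -/
theorem exists_sum_min_le {τ Δ : ℝ} (hτ : 0 < τ) (hτ1 : τ < 1) (hΔ : Δ ≠ 0) :
    ∃ C : ℝ, 0 < C ∧ ∀ (S : Finset ℤ) (P Q : ℝ), 0 ≤ P → 0 ≤ Q →
      ∑ j ∈ S, min (P * 2 ^ (-(τ * Δ) * (j : ℝ))) (Q * 2 ^ ((1 - τ) * Δ * (j : ℝ)))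
        ≤ C * (P ^ (1 - τ) * Q ^ τ) := by
  set δ : ℝ := min τ (1 - τ) * |Δ| with hδdef
  have hm : 0 < min τ (1 - τ) := lt_min hτ (by linarith)
  have hδ : 0 < δ := mul_pos hm (abs_pos.2 hΔ)
  have hsum := summable_two_rpow_neg_abs hδ
  have htpos : 0 < ∑' j : ℤ, (2 : ℝ) ^ (-δ * |(j : ℝ)|) :=
    hsum.tsum_pos (fun j => by positivity) 0 (by positivity)
  refine ⟨2 ^ δ * ∑' j : ℤ, (2 : ℝ) ^ (-δ * |(j : ℝ)|), by positivity, ?_⟩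
  intro S P Q hP hQ
  rcases hP.eq_or_lt with rfl | hP
  · refine le_trans (Finset.sum_nonpos fun j _ => ?_) (by positivity)
    exact (min_le_left _ _).trans (by simp)
  rcases hQ.eq_or_lt with rfl | hQ
  · refine le_trans (Finset.sum_nonpos fun j _ => ?_) (by positivity)
    exact (min_le_right _ _).trans (by simp)
  set V : ℝ := P ^ (1 - τ) * Q ^ τ with hV
  have hVpos : 0 < V := by positivity
  -- `x₀` is the real index at which the two progressions cross, with common value `V`
  set x₀ : ℝ := Real.logb 2 (P / Q) / Δ with hx₀
  have h2 : (2 : ℝ) ^ (Δ * x₀) = P / Q := by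
    rw [hx₀, mul_div_cancel₀ _ hΔ, Real.rpow_logb (by norm_num) (by norm_num) (by positivity)]
  have hP' : P = V * 2 ^ (τ * (Δ * x₀)) := by
    rw [mul_comm τ, Real.rpow_mul (by norm_num), h2, hV, Real.div_rpow hP.le hQ.le,
      mul_assoc, mul_div_cancel₀ _ (by positivity), ← Real.rpow_add hP]
    simp
  have hQ' : Q = V * 2 ^ (-(1 - τ) * (Δ * x₀)) := by
    rw [mul_comm (-(1 - τ)), Real.rpow_mul (by norm_num), h2, hV, Real.div_rpow hP.le hQ.le,
      Real.rpow_neg hP.le, Real.rpow_neg hQ.le]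
    have : Q ^ τ * Q ^ (1 - τ) = Q := by rw [← Real.rpow_add hQ]; simp
    field_simp
    rw [this]
  have hterm : ∀ j : ℤ, min (P * 2 ^ (-(τ * Δ) * (j : ℝ))) (Q * 2 ^ ((1 - τ) * Δ * (j : ℝ)))
      ≤ V * (2 ^ δ * 2 ^ (-δ * |((j - ⌊x₀⌋ : ℤ) : ℝ)|)) := by
    intro j
    set y : ℝ := Δ * (j - x₀) with hy
    have e1 : P * 2 ^ (-(τ * Δ) * (j : ℝ)) = V * 2 ^ (-τ * y) := by
      nth_rewrite 1 [hP']
      rw [mul_assoc, ← Real.rpow_add (by norm_num)]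
      congr 2; rw [hy]; ring
    have e2 : Q * 2 ^ ((1 - τ) * Δ * (j : ℝ)) = V * 2 ^ ((1 - τ) * y) := by
      nth_rewrite 1 [hQ']
      rw [mul_assoc, ← Real.rpow_add (by norm_num)]
      congr 2; rw [hy]; ring
    have hfl : |((j - ⌊x₀⌋ : ℤ) : ℝ)| ≤ |(j : ℝ) - x₀| + 1 := by
      have := Int.floor_le x₀
      have := Int.lt_floor_add_one x₀
      push_cast
      rw [abs_le]
      constructor
      · have := neg_abs_le ((j : ℝ) - x₀); linarith
      · have := le_abs_self ((j : ℝ) - x₀); linarith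
    have hmain : min (V * 2 ^ (-τ * y)) (V * 2 ^ ((1 - τ) * y))
        ≤ V * 2 ^ (-(min τ (1 - τ) * |y|)) := by
      rcases le_total 0 y with h | h
      · refine (min_le_left _ _).trans ?_
        gcongr
        · norm_num
        · rw [abs_of_nonneg h]; nlinarith [min_le_left τ (1 - τ)]
      · refine (min_le_right _ _).trans ?_
        gcongr
        · norm_num
        · rw [abs_of_nonpos h]; nlinarith [min_le_right τ (1 - τ)]
    rw [e1, e2]
    refine hmain.trans ?_
    rw [← Real.rpow_add (by norm_num)]
    gcongr
    · norm_num
    · rw [hy, abs_mul, ← mul_assoc, ← hδdef]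
      nlinarith
  calc _ ≤ ∑ j ∈ S, V * (2 ^ δ * 2 ^ (-δ * |((j - ⌊x₀⌋ : ℤ) : ℝ)|)) :=
        Finset.sum_le_sum fun j _ => hterm j
    _ = V * (2 ^ δ * ∑ j ∈ S, (2 : ℝ) ^ (-δ * |((j - ⌊x₀⌋ : ℤ) : ℝ)|)) := by
        rw [Finset.mul_sum, Finset.mul_sum]
    _ ≤ V * (2 ^ δ * ∑' j : ℤ, (2 : ℝ) ^ (-δ * |(j : ℝ)|)) := by
        gcongr
        have hs' : Summable fun j : ℤ => (2 : ℝ) ^ (-δ * |((j - ⌊x₀⌋ : ℤ) : ℝ)|) :=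
          (Equiv.subRight ⌊x₀⌋).summable_iff.2 hsum
        rw [← (Equiv.subRight ⌊x₀⌋).tsum_eq (fun j : ℤ => (2 : ℝ) ^ (-δ * |(j : ℝ)|))]
        exact hs'.sum_le_tsum S (fun j _ => by positivity)
    _ = _ := by ring

theorem sum_two_rpow_le (N : Finset ℤ) :
    ∀ a : ℤ, (∀ n ∈ N, n < a) → ∑ n ∈ N, (2 : ℝ) ^ (n : ℝ) ≤ 2 ^ (a : ℝ) := by
  induction N using Finset.induction_on_max with
  | empty => intro a _; simp; positivity
  | insert b N hb ih =>
    intro a ha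
    rw [Finset.sum_insert (fun h => lt_irrefl _ (hb b h))]
    have h1 := ih b hb
    have h2 : (b : ℝ) + 1 ≤ a := by
      exact_mod_cast ha b (Finset.mem_insert_self _ _)
    calc (2 : ℝ) ^ (b : ℝ) + ∑ n ∈ N, (2 : ℝ) ^ (n : ℝ) ≤ 2 ^ (b : ℝ) + 2 ^ (b : ℝ) := by gcongr
      _ = 2 ^ ((b : ℝ) + 1) := by rw [Real.rpow_add (by norm_num)]; norm_num; ring
      _ ≤ 2 ^ (a : ℝ) := Real.rpow_le_rpow_of_exponent_le (by norm_num) h2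

/-- A lacunary sum is comparable to its largest term, hence its `r`-th power to the sum of the
`r`-th powers. -/
theorem sum_two_rpow_rpow_le (N : Finset ℤ) {r : ℝ} (hr : 0 < r) :
    (∑ n ∈ N, (2 : ℝ) ^ (n : ℝ)) ^ r ≤ 2 ^ r * ∑ n ∈ N, (2 : ℝ) ^ (n * r) := by
  rcases N.eq_empty_or_nonempty with rfl | hN
  · simp [Real.zero_rpow hr.ne']
  have h1 := sum_two_rpow_le N (N.max' hN + 1) (fun n hn => by
    have := N.le_max' n hn; omega)
  calc (∑ n ∈ N, (2 : ℝ) ^ (n : ℝ)) ^ r ≤ ((2 : ℝ) ^ ((N.max' hN + 1 : ℤ) : ℝ)) ^ r := by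
        gcongr
    _ = 2 ^ r * 2 ^ ((N.max' hN : ℝ) * r) := by
        rw [← Real.rpow_mul (by norm_num), ← Real.rpow_add (by norm_num)]; push_cast; ring_nf
    _ ≤ _ := by
        gcongr
        exact Finset.single_le_sum (f := fun n : ℤ => (2 : ℝ) ^ (n * r))
          (fun n _ => by positivity) (N.max'_mem hN)

/-- Schur's test between `ℓ^p` and the dual of `ℓ^r`, for `1/p + 1/r ≥ 1`. -/
theorem sum_mul_le_of_schur {ι κ : Type*} (I : Finset ι) (J : Finset κ) (w : ι → κ → ℝ)
    (F : ι → ℝ) (G : κ → ℝ) {p r C : ℝ} (hw : ∀ i j, 0 ≤ w i j) (hF : ∀ i, 0 ≤ F i)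
    (hG : ∀ j, 0 ≤ G j) (hp : 1 ≤ p) (hr : 1 ≤ r) (hpr : 1 ≤ 1 / p + 1 / r)
    (h1 : ∀ i ∈ I, ∑ j ∈ J, w i j ≤ C) (h2 : p = 1 ∨ ∀ j ∈ J, ∑ i ∈ I, w i j ≤ C) (hC : 0 ≤ C) :
    ∑ i ∈ I, ∑ j ∈ J, F i * G j * w i j
      ≤ 2 * C * ((∑ i ∈ I, F i ^ p) ^ (1 / p) * (∑ j ∈ J, G j ^ r) ^ (1 / r)) := by
  have hp0 : 0 < p := by linarith
  have hr0 : 0 < r := by linarith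
  set X := (∑ i ∈ I, F i ^ p) ^ (1 / p) with hX
  set Y := (∑ j ∈ J, G j ^ r) ^ (1 / r) with hY
  have hSF : 0 ≤ ∑ i ∈ I, F i ^ p := Finset.sum_nonneg fun i _ => Real.rpow_nonneg (hF i) _
  have hSG : 0 ≤ ∑ j ∈ J, G j ^ r := Finset.sum_nonneg fun i _ => Real.rpow_nonneg (hG i) _
  have hX0 : 0 ≤ X := Real.rpow_nonneg hSF _
  have hY0 : 0 ≤ Y := Real.rpow_nonneg hSG _
  have hXp : X ^ p = ∑ i ∈ I, F i ^ p := by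
    rw [hX, ← Real.rpow_mul hSF, one_div_mul_cancel hp0.ne', Real.rpow_one]
  have hYr : Y ^ r = ∑ j ∈ J, G j ^ r := by
    rw [hY, ← Real.rpow_mul hSG, one_div_mul_cancel hr0.ne', Real.rpow_one]
  have hFX : ∀ i ∈ I, F i ≤ X := fun i hi => by
    rw [← Real.rpow_le_rpow_iff (hF i) hX0 hp0, hXp]
    exact Finset.single_le_sum (f := fun i => F i ^ p) (fun i _ => Real.rpow_nonneg (hF i) _) hi
  have hGY : ∀ j ∈ J, G j ≤ Y := fun j hj => by
    rw [← Real.rpow_le_rpow_iff (hG j) hY0 hr0, hYr]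
    exact Finset.single_le_sum (f := fun i => G i ^ r) (fun i _ => Real.rpow_nonneg (hG i) _) hj
  rcases hX0.eq_or_lt with h | hXpos
  · rw [← h]
    refine (Finset.sum_nonpos fun i hi => Finset.sum_nonpos fun j _ => ?_).trans (by simp)
    have : F i = 0 := le_antisymm (h ▸ hFX i hi) (hF i)
    simp [this]
  rcases hY0.eq_or_lt with h | hYpos
  · rw [← h]
    refine (Finset.sum_nonpos fun i _ => Finset.sum_nonpos fun j hj => ?_).trans (by simp)
    have : G j = 0 := le_antisymm (h ▸ hGY j hj) (hG j)
    simp [this]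
  -- after normalisation `F, G ≤ 1`, and then `F G ≤ F ^ p + G ^ r` (`F G ≤ F` if `p = 1`)
  set f : ι → ℝ := fun i => F i / X with hf
  set g : κ → ℝ := fun j => G j / Y with hg
  have hf0 : ∀ i, 0 ≤ f i := fun i => div_nonneg (hF i) hX0
  have hg0 : ∀ i, 0 ≤ g i := fun i => div_nonneg (hG i) hY0
  have hf1 : ∀ i ∈ I, f i ≤ 1 := fun i hi => (div_le_one hXpos).2 (hFX i hi)
  have hg1 : ∀ i ∈ J, g i ≤ 1 := fun i hi => (div_le_one hYpos).2 (hGY i hi)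
  have hfs : ∑ i ∈ I, f i ^ p = 1 := by
    simp_rw [hf, Real.div_rpow (hF _) hX0]
    rw [← Finset.sum_div, ← hXp, div_self (by positivity)]
  have hgs : ∑ i ∈ J, g i ^ r = 1 := by
    simp_rw [hg, Real.div_rpow (hG _) hY0]
    rw [← Finset.sum_div, ← hYr, div_self (by positivity)]
  suffices h : ∑ i ∈ I, ∑ j ∈ J, f i * g j * w i j ≤ 2 * C by
    have e : ∑ i ∈ I, ∑ j ∈ J, F i * G j * w i j
        = (∑ i ∈ I, ∑ j ∈ J, f i * g j * w i j) * (X * Y) := by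
      rw [Finset.sum_mul]
      refine Finset.sum_congr rfl fun i _ => ?_
      rw [Finset.sum_mul]
      refine Finset.sum_congr rfl fun j _ => ?_
      simp only [hf, hg]; field_simp
    rw [e]
    exact mul_le_mul_of_nonneg_right h (by positivity)
  have hfirst : ∑ i ∈ I, ∑ j ∈ J, f i ^ p * w i j ≤ C := by
    calc _ = ∑ i ∈ I, f i ^ p * ∑ j ∈ J, w i j := by simp_rw [Finset.mul_sum]
      _ ≤ ∑ i ∈ I, f i ^ p * C := Finset.sum_le_sum fun i hi =>
          mul_le_mul_of_nonneg_left (h1 i hi) (Real.rpow_nonneg (hf0 i) _)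
      _ = C := by rw [← Finset.sum_mul, hfs, one_mul]
  rcases h2 with rfl | h2
  · refine le_trans (Finset.sum_le_sum fun i hi => Finset.sum_le_sum fun j hj => ?_)
      (hfirst.trans (by linarith))
    rw [Real.rpow_one]
    exact mul_le_mul_of_nonneg_right (mul_le_of_le_one_right (hf0 i) (hg1 j hj)) (hw i j)
  · have hsecond : ∑ i ∈ I, ∑ j ∈ J, g j ^ r * w i j ≤ C := by
      rw [Finset.sum_comm]
      calc _ = ∑ i ∈ J, g i ^ r * ∑ j ∈ I, w j i := by simp_rw [Finset.mul_sum]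
        _ ≤ ∑ i ∈ J, g i ^ r * C := Finset.sum_le_sum fun i hi =>
            mul_le_mul_of_nonneg_left (h2 i hi) (Real.rpow_nonneg (hg0 i) _)
        _ = C := by rw [← Finset.sum_mul, hgs, one_mul]
    have hfg : ∀ i ∈ I, ∀ j ∈ J, f i * g j ≤ f i ^ p + g j ^ r := by
      intro i hi j hj
      rcases hp.eq_or_lt with rfl | hp1
      · rw [Real.rpow_one]
        have := Real.rpow_nonneg (hg0 j) r
        have := mul_le_of_le_one_right (hf0 i) (hg1 j hj)
        linarith
      have hconj : p.HolderConjugate p.conjExponent := Real.HolderConjugate.conjExponent hp1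
      have hle : r ≤ p.conjExponent := by
        have := hconj.inv_add_inv_eq_one
        have h3 : 1 / p.conjExponent ≤ 1 / r := by
          rw [one_div, one_div] at *; linarith
        exact (one_div_le_one_div hconj.symm.pos hr0).1 h3
      have hy := Real.young_inequality_of_nonneg (hf0 i) (hg0 j) hconj
      have ha : f i ^ p / p ≤ f i ^ p := div_le_self (Real.rpow_nonneg (hf0 i) _) hp
      have hb : g j ^ p.conjExponent / p.conjExponent ≤ g j ^ p.conjExponent :=
        div_le_self (Real.rpow_nonneg (hg0 j) _) hconj.symm.lt.le
      have hc : g j ^ p.conjExponent ≤ g j ^ r :=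
        Real.rpow_le_rpow_of_exponent_ge' (hg0 j) (hg1 j hj) hr0.le hle
      linarith
    calc _ ≤ ∑ i ∈ I, ∑ j ∈ J, (f i ^ p * w i j + g j ^ r * w i j) :=
          Finset.sum_le_sum fun i hi => Finset.sum_le_sum fun j hj => by
            rw [← add_mul]; exact mul_le_mul_of_nonneg_right (hfg i hi j hj) (hw i j)
      _ ≤ 2 * C := by simp_rw [Finset.sum_add_distrib]; linarith

/-! ### Sums over pairs of level sets -/

/-- A row of the interaction matrix of two restricted type bounds: `exists_sum_min_le`, where the
prefactors depend on the row `i` but their geometric mean does not. -/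
theorem exists_row_sum_min_le {v₀ v₁ τ : ℝ} (hτ : 0 < τ) (hτ1 : τ < 1) (hv : v₀ ≠ v₁) :
    ∃ C : ℝ, 0 < C ∧ ∀ (u₀ u₁ x y A B : ℝ) (i : ℤ) (S : Finset ℤ),
      x = (1 - τ) * u₀ + τ * u₁ → y = (1 - τ) * v₀ + τ * v₁ → 0 ≤ A → 0 ≤ B →
      ∑ j ∈ S, min (A * 2 ^ (i * (u₀ - x)) * 2 ^ (j * (v₀ - y)))
        (B * 2 ^ (i * (u₁ - x)) * 2 ^ (j * (v₁ - y))) ≤ C * (A ^ (1 - τ) * B ^ τ) := by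
  obtain ⟨C, hC, h⟩ := exists_sum_min_le hτ hτ1 (sub_ne_zero.2 hv.symm)
  refine ⟨C, hC, fun u₀ u₁ x y A B i S hx hy hA hB => ?_⟩
  have h' := h S (A * 2 ^ (i * (u₀ - x))) (B * 2 ^ (i * (u₁ - x))) (by positivity) (by positivity)
  have e : (A * 2 ^ (i * (u₀ - x))) ^ (1 - τ) * (B * 2 ^ (i * (u₁ - x))) ^ τ
      = A ^ (1 - τ) * B ^ τ := by
    rw [Real.mul_rpow hA (by positivity), Real.mul_rpow hB (by positivity),
      ← Real.rpow_mul (by norm_num), ← Real.rpow_mul (by norm_num), mul_mul_mul_comm,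
      ← Real.rpow_add (by norm_num)]
    have : (i : ℝ) * (u₀ - x) * (1 - τ) + i * (u₁ - x) * τ = 0 := by rw [hx]; ring
    rw [this, Real.rpow_zero, mul_one]
  rw [e] at h'
  refine le_trans (le_of_eq (Finset.sum_congr rfl fun j _ => ?_)) h'
  congr 3
  · rw [hy]; ring
  · rw [hy]; ring

/-- The integer `i` with `2 ^ i ≤ x < 2 ^ (i + 1)`, for `x > 0`. -/
noncomputable def dyadicScale (x : ℝ) : ℤ := ⌊Real.logb 2 x⌋

theorem two_rpow_dyadicScale_le {x : ℝ} (hx : 0 < x) : (2 : ℝ) ^ (dyadicScale x : ℝ) ≤ x := by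
  rw [← Real.le_logb_iff_rpow_le (by norm_num) hx]; exact Int.floor_le _

theorem rpow_le_two_mul_dyadicScale {x e : ℝ} (hx : 0 < x) (he : e ∈ Set.Icc (0 : ℝ) 1) :
    x ^ e ≤ 2 * 2 ^ (dyadicScale x * e) := by
  have hupp : x ≤ (2 : ℝ) ^ ((dyadicScale x : ℝ) + 1) := by
    rw [← Real.logb_le_iff_le_rpow (by norm_num) hx]; exact (Int.lt_floor_add_one _).le
  calc x ^ e ≤ ((2 : ℝ) ^ ((dyadicScale x : ℝ) + 1)) ^ e := Real.rpow_le_rpow hx.le hupp he.1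
    _ = 2 ^ e * 2 ^ (dyadicScale x * e) := by
        rw [← Real.rpow_mul (by norm_num), ← Real.rpow_add (by norm_num)]; ring_nf
    _ ≤ 2 * 2 ^ (dyadicScale x * e) := by
        gcongr
        calc (2 : ℝ) ^ e ≤ 2 ^ (1 : ℝ) := Real.rpow_le_rpow_of_exponent_le (by norm_num) he.2
          _ = 2 := by norm_num

/-- The total height of the pieces whose measure is about `2 ^ i`. -/
noncomputable def heightAt (M : Finset ℤ) (μ : ℤ → ℝ) (i : ℤ) : ℝ :=
  ∑ m ∈ M with dyadicScale (μ m) = i, (2 : ℝ) ^ (m : ℝ)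

theorem heightAt_nonneg (M : Finset ℤ) (μ : ℤ → ℝ) (i : ℤ) : 0 ≤ heightAt M μ i :=
  Finset.sum_nonneg fun _ _ => by positivity

/-- Grouping the pieces by the size of their measure does not increase the `ℓ^p` norm by more than
a constant. -/
theorem sum_heightAt_rpow_le {M : Finset ℤ} {μ : ℤ → ℝ} {p : ℝ} (hp : 0 < p)
    (hμ : ∀ m ∈ M, 0 < μ m) (I : Finset ℤ) (hI : ∀ m ∈ M, dyadicScale (μ m) ∈ I) :
    (∑ i ∈ I, (2 ^ (i * (1 / p)) * heightAt M μ i) ^ p) ^ (1 / p)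
      ≤ 2 * (∑ m ∈ M, 2 ^ (m * p) * μ m) ^ (1 / p) := by
  have h1 : ∑ i ∈ I, ((2 : ℝ) ^ (i * (1 / p)) * heightAt M μ i) ^ p
      ≤ 2 ^ p * ∑ m ∈ M, 2 ^ (m * p) * μ m := by
    rw [← Finset.sum_fiberwise_of_maps_to hI, Finset.mul_sum]
    refine Finset.sum_le_sum fun i _ => ?_
    rw [Real.mul_rpow (by positivity) (heightAt_nonneg _ _ _), ← Real.rpow_mul (by norm_num),
      mul_assoc, one_div_mul_cancel hp.ne', mul_one]
    calc _ ≤ (2 : ℝ) ^ (i : ℝ) * (2 ^ p *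
          ∑ m ∈ M with dyadicScale (μ m) = i, (2 : ℝ) ^ (m * p)) := by
          gcongr; exact sum_two_rpow_rpow_le _ hp
      _ = 2 ^ p * ∑ m ∈ M with dyadicScale (μ m) = i, (2 : ℝ) ^ (m * p) * 2 ^ (i : ℝ) := by
          rw [← Finset.sum_mul]; ring
      _ ≤ _ := by
          gcongr with m hm
          rw [Finset.mem_filter] at hm
          rw [← hm.2]
          exact two_rpow_dyadicScale_le (hμ m hm.1)
  have hs : 0 ≤ ∑ m ∈ M, 2 ^ (m * p) * μ m :=
    Finset.sum_nonneg fun m hm => mul_nonneg (by positivity) (hμ m hm).le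
  calc _ ≤ (2 ^ p * ∑ m ∈ M, 2 ^ (m * p) * μ m) ^ (1 / p) := by
        refine Real.rpow_le_rpow (Finset.sum_nonneg fun i _ => ?_) h1 (by positivity)
        exact Real.rpow_nonneg (mul_nonneg (by positivity) (heightAt_nonneg _ _ _)) _
    _ = _ := by
        rw [Real.mul_rpow (by positivity) hs, ← Real.rpow_mul (by norm_num),
          mul_one_div_cancel hp.ne', Real.rpow_one]

theorem sum_sum_fiberwise (M N I J : Finset ℤ) (μ ν : ℤ → ℝ)
    (hI : ∀ m ∈ M, dyadicScale (μ m) ∈ I) (hJ : ∀ n ∈ N, dyadicScale (ν n) ∈ J)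
    (h : ℤ → ℤ → ℝ) :
    ∑ m ∈ M, ∑ n ∈ N, (2 : ℝ) ^ (m : ℝ) * (2 ^ (n : ℝ) * h (dyadicScale (μ m)) (dyadicScale (ν n)))
      = ∑ i ∈ I, ∑ j ∈ J, heightAt M μ i * (heightAt N ν j * h i j) := by
  have inner : ∀ i, ∑ n ∈ N, (2 : ℝ) ^ (n : ℝ) * h i (dyadicScale (ν n))
      = ∑ j ∈ J, heightAt N ν j * h i j := by
    intro i
    rw [← Finset.sum_fiberwise_of_maps_to hJ]
    refine Finset.sum_congr rfl fun j _ => ?_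
    rw [heightAt, Finset.sum_mul]
    refine Finset.sum_congr rfl fun n hn => ?_
    rw [(Finset.mem_filter.1 hn).2]
  rw [← Finset.sum_fiberwise_of_maps_to hI]
  refine Finset.sum_congr rfl fun i _ => ?_
  rw [← Finset.mul_sum, ← inner, heightAt, Finset.sum_mul]
  refine Finset.sum_congr rfl fun m hm => ?_
  rw [(Finset.mem_filter.1 hm).2, Finset.mul_sum]

theorem rpow_mul_rpow_le_dyadicScale {A x y u v s t : ℝ} (hA : 0 ≤ A) (hx : 0 < x) (hy : 0 < y)
    (hu : u ∈ Set.Icc (0 : ℝ) 1) (hv : v ∈ Set.Icc (0 : ℝ) 1) :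
    A * x ^ u * y ^ v ≤ 4 * (2 ^ (dyadicScale x * s) * 2 ^ (dyadicScale y * t)) *
      (A * 2 ^ (dyadicScale x * (u - s)) * 2 ^ (dyadicScale y * (v - t))) := by
  have e1 : (2 : ℝ) ^ (dyadicScale x * u)
      = 2 ^ (dyadicScale x * s) * 2 ^ (dyadicScale x * (u - s)) := by
    rw [← Real.rpow_add (by norm_num)]; ring_nf
  have e2 : (2 : ℝ) ^ (dyadicScale y * v)
      = 2 ^ (dyadicScale y * t) * 2 ^ (dyadicScale y * (v - t)) := by
    rw [← Real.rpow_add (by norm_num)]; ring_nf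
  calc A * x ^ u * y ^ v ≤ A * (2 * 2 ^ (dyadicScale x * u)) * (2 * 2 ^ (dyadicScale y * v)) :=
        mul_le_mul (mul_le_mul_of_nonneg_left (rpow_le_two_mul_dyadicScale hx hu) hA)
          (rpow_le_two_mul_dyadicScale hy hv) (Real.rpow_nonneg hy.le _) (by positivity)
    _ = _ := by rw [e1, e2]; ring

/-- The discrete core of real interpolation. If the interaction of the pieces at heights `2 ^ m`
and `2 ^ n`, with measures `μ m` and `ν n`, is controlled by two restricted type bounds, then the
total is controlled by the strong type bound at an intermediate point. The pieces are regrouped by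
the size of their measures: on these groups the minimum of the two bounds decays off a diagonal,
so that Schur's test applies. -/
theorem exists_sum_sum_min_le {u₀ u₁ v₀ v₁ τ p r : ℝ} (hτ : 0 < τ) (hτ1 : τ < 1)
    (hu₀ : u₀ ∈ Set.Icc (0 : ℝ) 1) (hu₁ : u₁ ∈ Set.Icc (0 : ℝ) 1) (hv₀ : v₀ ∈ Set.Ioc (0 : ℝ) 1)
    (hv₁ : v₁ ∈ Set.Icc (0 : ℝ) 1) (hu₀0 : 0 < u₀) (hp : 1 ≤ p) (hr : 1 ≤ r)
    (hpu : 1 / p = (1 - τ) * u₀ + τ * u₁) (hrv : 1 / r = (1 - τ) * v₀ + τ * v₁)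
    (hpr : 1 ≤ 1 / p + 1 / r) (hv : v₀ ≠ v₁) (hu : p = 1 ∨ u₀ ≠ u₁) :
    ∃ C : ℝ, 0 < C ∧ ∀ (M N : Finset ℤ) (μ ν : ℤ → ℝ) (A B : ℝ), (∀ m, 0 ≤ μ m) →
      (∀ n, 0 ≤ ν n) → 0 ≤ A → 0 ≤ B →
      ∑ m ∈ M, ∑ n ∈ N, (2 : ℝ) ^ (m : ℝ) * 2 ^ (n : ℝ) *
          min (A * μ m ^ u₀ * ν n ^ v₀) (B * μ m ^ u₁ * ν n ^ v₁)
        ≤ C * (A ^ (1 - τ) * B ^ τ) *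
          ((∑ m ∈ M, 2 ^ (m * p) * μ m) ^ (1 / p) * (∑ n ∈ N, 2 ^ (n * r) * ν n) ^ (1 / r)) := by
  have hp0 : 0 < p := by linarith
  have hr0 : 0 < r := by linarith
  obtain ⟨C₁, hC₁, hrow⟩ := exists_row_sum_min_le hτ hτ1 hv
  obtain ⟨C₂, hC₂, hcol⟩ : ∃ C₂ : ℝ, 0 < C₂ ∧ (p = 1 ∨ ∀ (w₀ w₁ x y A B : ℝ) (i : ℤ)
      (S : Finset ℤ),
      x = (1 - τ) * w₀ + τ * w₁ → y = (1 - τ) * u₀ + τ * u₁ → 0 ≤ A → 0 ≤ B →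
      ∑ j ∈ S, min (A * 2 ^ (i * (w₀ - x)) * 2 ^ (j * (u₀ - y)))
        (B * 2 ^ (i * (w₁ - x)) * 2 ^ (j * (u₁ - y))) ≤ C₂ * (A ^ (1 - τ) * B ^ τ)) := by
    rcases hu with hu | hu
    · exact ⟨1, one_pos, Or.inl hu⟩
    · obtain ⟨C, hC, h⟩ := exists_row_sum_min_le hτ hτ1 hu
      exact ⟨C, hC, Or.inr h⟩
  refine ⟨4 * (2 * max C₁ C₂ * (2 * 2)), by positivity, ?_⟩
  intro M N μ ν A B hμ hν hA hB
  set D : ℝ := A ^ (1 - τ) * B ^ τ with hD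
  have hD0 : 0 ≤ D := by positivity
  set M' := M.filter fun m => 0 < μ m with hM'
  set N' := N.filter fun n => 0 < ν n with hN'
  have hMpos : ∀ m ∈ M', 0 < μ m := fun m hm => (Finset.mem_filter.1 hm).2
  have hNpos : ∀ n ∈ N', 0 < ν n := fun n hn => (Finset.mem_filter.1 hn).2
  set I := M'.image (fun m => dyadicScale (μ m)) with hI
  set J := N'.image (fun n => dyadicScale (ν n)) with hJ
  have hMI : ∀ m ∈ M', dyadicScale (μ m) ∈ I := fun m hm => Finset.mem_image_of_mem _ hm
  have hNJ : ∀ n ∈ N', dyadicScale (ν n) ∈ J := fun n hn => Finset.mem_image_of_mem _ hn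
  set F : ℤ → ℝ := fun i => 2 ^ (i * (1 / p)) * heightAt M' μ i with hF
  set G : ℤ → ℝ := fun j => 2 ^ (j * (1 / r)) * heightAt N' ν j with hG
  set w : ℤ → ℤ → ℝ := fun i j => min (A * 2 ^ (i * (u₀ - 1 / p)) * 2 ^ (j * (v₀ - 1 / r)))
    (B * 2 ^ (i * (u₁ - 1 / p)) * 2 ^ (j * (v₁ - 1 / r))) with hw
  have hF0 : ∀ i, 0 ≤ F i := fun i => mul_nonneg (by positivity) (heightAt_nonneg _ _ _)
  have hG0 : ∀ i, 0 ≤ G i := fun i => mul_nonneg (by positivity) (heightAt_nonneg _ _ _)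
  have hschur := sum_mul_le_of_schur I J w F G (C := max C₁ C₂ * D)
    (fun i j => by positivity) hF0 hG0 hp hr hpr
    (fun i _ => (hrow u₀ u₁ (1 / p) (1 / r) A B i J hpu hrv hA hB).trans
      (mul_le_mul_of_nonneg_right (le_max_left _ _) hD0))
    (hcol.imp id fun hcol j _ => by
      refine le_trans (le_of_eq (Finset.sum_congr rfl fun i _ => ?_))
        ((hcol v₀ v₁ (1 / r) (1 / p) A B j I hrv hpu hA hB).trans
          (mul_le_mul_of_nonneg_right (le_max_right _ _) hD0))
      simp only [hw]
      congr 1 <;> ring)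
    (by positivity)
  have hterm : ∀ m ∈ M', ∀ n ∈ N', (2 : ℝ) ^ (m : ℝ) * 2 ^ (n : ℝ) *
      min (A * μ m ^ u₀ * ν n ^ v₀) (B * μ m ^ u₁ * ν n ^ v₁)
      ≤ 2 ^ (m : ℝ) * (2 ^ (n : ℝ) * (4 * (2 ^ (dyadicScale (μ m) * (1 / p)) *
        2 ^ (dyadicScale (ν n) * (1 / r))) * w (dyadicScale (μ m)) (dyadicScale (ν n)))) := by
    intro m hm n hn
    rw [mul_assoc]
    gcongr
    rw [hw, mul_min_of_nonneg _ _ (by positivity)]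
    exact min_le_min
      (rpow_mul_rpow_le_dyadicScale hA (hMpos m hm) (hNpos n hn) hu₀ ⟨hv₀.1.le, hv₀.2⟩)
      (rpow_mul_rpow_le_dyadicScale hB (hMpos m hm) (hNpos n hn) hu₁ hv₁)
  -- pieces of measure zero do not contribute
  have hred : ∑ m ∈ M, ∑ n ∈ N, (2 : ℝ) ^ (m : ℝ) * 2 ^ (n : ℝ) *
        min (A * μ m ^ u₀ * ν n ^ v₀) (B * μ m ^ u₁ * ν n ^ v₁)
      ≤ ∑ m ∈ M', ∑ n ∈ N', (2 : ℝ) ^ (m : ℝ) * 2 ^ (n : ℝ) *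
        min (A * μ m ^ u₀ * ν n ^ v₀) (B * μ m ^ u₁ * ν n ^ v₁) := by
    rw [hM', Finset.sum_filter]
    refine Finset.sum_le_sum fun m _ => ?_
    split_ifs with hm
    · rw [hN', Finset.sum_filter]
      refine Finset.sum_le_sum fun n _ => ?_
      split_ifs with hn
      · exact le_rfl
      · have : ν n = 0 := le_antisymm (not_lt.1 hn) (hν n)
        refine mul_nonpos_of_nonneg_of_nonpos (by positivity) ((min_le_left _ _).trans ?_)
        rw [this, Real.zero_rpow hv₀.1.ne', mul_zero]
    · have : μ m = 0 := le_antisymm (not_lt.1 hm) (hμ m)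
      refine Finset.sum_nonpos fun n _ =>
        mul_nonpos_of_nonneg_of_nonpos (by positivity) ((min_le_left _ _).trans ?_)
      rw [this, Real.zero_rpow hu₀0.ne', mul_zero, zero_mul]
  have hsub : ∀ (N : Finset ℤ) (ν : ℤ → ℝ) (r : ℝ), 1 ≤ r → (∀ n, 0 ≤ ν n) →
      (∑ n ∈ N.filter (fun n => 0 < ν n), 2 ^ (n * r) * ν n) ^ (1 / r)
        ≤ (∑ n ∈ N, 2 ^ (n * r) * ν n) ^ (1 / r) := fun N ν r hr hν =>
    Real.rpow_le_rpow (Finset.sum_nonneg fun i _ => mul_nonneg (by positivity) (hν i))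
      (Finset.sum_le_sum_of_subset_of_nonneg (Finset.filter_subset _ _)
        fun i _ _ => mul_nonneg (by positivity) (hν i)) (by positivity)
  have hnn : ∀ (N : Finset ℤ) (ν : ℤ → ℝ) (r : ℝ), (∀ n, 0 ≤ ν n) →
      0 ≤ (∑ n ∈ N, 2 ^ (n * r) * ν n) ^ (1 / r) := fun N ν r hν =>
    Real.rpow_nonneg (Finset.sum_nonneg fun i _ => mul_nonneg (by positivity) (hν i)) _
  calc _ ≤ _ := hred
    _ ≤ _ := Finset.sum_le_sum fun m hm => Finset.sum_le_sum fun n hn => hterm m hm n hn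
    _ = 4 * ∑ i ∈ I, ∑ j ∈ J, F i * G j * w i j := by
        rw [sum_sum_fiberwise M' N' I J μ ν hMI hNJ
          (fun i j => 4 * (2 ^ (i * (1 / p)) * 2 ^ (j * (1 / r))) * w i j), Finset.mul_sum]
        refine Finset.sum_congr rfl fun i _ => ?_
        rw [Finset.mul_sum]
        refine Finset.sum_congr rfl fun j _ => ?_
        simp only [hF, hG]; ring
    _ ≤ 4 * (2 * (max C₁ C₂ * D) *
          ((∑ i ∈ I, F i ^ p) ^ (1 / p) * (∑ j ∈ J, G j ^ r) ^ (1 / r))) := by gcongr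
    _ ≤ 4 * (2 * (max C₁ C₂ * D) * ((2 * (∑ m ∈ M, 2 ^ (m * p) * μ m) ^ (1 / p)) *
          (2 * (∑ n ∈ N, 2 ^ (n * r) * ν n) ^ (1 / r)))) := by
        refine mul_le_mul_of_nonneg_left (mul_le_mul_of_nonneg_left (mul_le_mul ?_ ?_ ?_ ?_)
          (by positivity)) (by norm_num)
        · exact (sum_heightAt_rpow_le hp0 hMpos I hMI).trans
            (mul_le_mul_of_nonneg_left (hsub M μ p hp hμ) (by norm_num))
        · exact (sum_heightAt_rpow_le hr0 hNpos J hNJ).trans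
            (mul_le_mul_of_nonneg_left (hsub N ν r hr hν) (by norm_num))
        · exact Real.rpow_nonneg (Finset.sum_nonneg fun i _ => Real.rpow_nonneg (hG0 i) _) _
        · exact mul_nonneg (by norm_num) (hnn M μ p hμ)
    _ = _ := by ring

/-! ### Level sets and interpolation of restricted type bounds -/

theorem lt_two_rpow_dyadicScale_add_one {x : ℝ} (hx : 0 < x) :
    x < (2 : ℝ) ^ ((dyadicScale x : ℝ) + 1) := by
  rw [← Real.logb_lt_iff_lt_rpow (by norm_num) hx]; exact Int.lt_floor_add_one _

theorem measurable_dyadicScale : Measurable dyadicScale :=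
  Int.measurable_floor.comp (Real.measurable_log.div_const _)

/-- The set where `2 ^ m ≤ f < 2 ^ (m + 1)`. -/
def levelSet {Ω : Type} (f : Ω → ℝ≥0∞) (m : ℤ) : Set Ω :=
  {x | f x ≠ 0 ∧ f x ≠ ⊤ ∧ dyadicScale (f x).toReal = m}

section LevelSet

variable {Ω : Type} {f : Ω → ℝ≥0∞}

theorem two_rpow_le_of_mem_levelSet {m : ℤ} {x : Ω} (hx : x ∈ levelSet f m) :
    ENNReal.ofReal (2 ^ (m : ℝ)) ≤ f x := by
  rw [← ENNReal.ofReal_toReal hx.2.1, ← hx.2.2]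
  exact ENNReal.ofReal_le_ofReal (two_rpow_dyadicScale_le (ENNReal.toReal_pos hx.1 hx.2.1))

theorem le_two_rpow_of_mem_levelSet {m : ℤ} {x : Ω} (hx : x ∈ levelSet f m) :
    f x ≤ ENNReal.ofReal (2 ^ ((m : ℝ) + 1)) := by
  rw [← ENNReal.ofReal_toReal hx.2.1, ← hx.2.2]
  exact ENNReal.ofReal_le_ofReal
    (lt_two_rpow_dyadicScale_add_one (ENNReal.toReal_pos hx.1 hx.2.1)).le

theorem disjoint_levelSet {m n : ℤ} (h : m ≠ n) : Disjoint (levelSet f m) (levelSet f n) :=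
  Set.disjoint_left.2 fun _ hx hy => h (hx.2.2.symm.trans hy.2.2)

variable [MeasurableSpace Ω]

theorem measurableSet_levelSet (hf : Measurable f) (m : ℤ) : MeasurableSet (levelSet f m) := by
  refine (hf (measurableSet_singleton 0).compl).inter
    ((hf (measurableSet_singleton ⊤).compl).inter ?_)
  exact (measurable_dyadicScale.comp hf.ennreal_toReal) (measurableSet_singleton m)

theorem sum_measure_levelSet_le (μ : Measure Ω) (hf : Measurable f) {p : ℝ} (hp : 0 < p)
    (M : Finset ℤ) :
    ∑ m ∈ M, ENNReal.ofReal (2 ^ (m * p)) * μ (levelSet f m) ≤ ∫⁻ x, f x ^ p ∂μ := by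
  calc _ ≤ ∑ m ∈ M, ∫⁻ x in levelSet f m, f x ^ p ∂μ := by
        refine Finset.sum_le_sum fun m _ => ?_
        rw [← setLIntegral_const]
        refine setLIntegral_mono_ae (hf.pow_const _).aemeasurable (ae_of_all _ fun x hx => ?_)
        rw [Real.rpow_mul (by norm_num), ← ENNReal.ofReal_rpow_of_nonneg (by positivity) hp.le]
        exact ENNReal.rpow_le_rpow (two_rpow_le_of_mem_levelSet hx) hp.le
    _ = ∫⁻ x in ⋃ m ∈ M, levelSet f m, f x ^ p ∂μ :=
        (lintegral_biUnion_finset (fun m _ n _ h => disjoint_levelSet h)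
          (fun m _ => measurableSet_levelSet hf m) _).symm
    _ ≤ _ := setLIntegral_le_lintegral _ _

theorem measure_levelSet_lt_top {μ : Measure Ω} (hf : Measurable f) {p : ℝ} (hp : 0 < p)
    (h : ∫⁻ x, f x ^ p ∂μ ≠ ⊤) (m : ℤ) : μ (levelSet f m) < ⊤ := by
  have h1 := (sum_measure_levelSet_le μ hf hp {m}).trans_lt h.lt_top
  rw [Finset.sum_singleton] at h1
  refine lt_top_iff_ne_top.2 fun h2 => ?_
  rw [h2, ENNReal.mul_top (by rw [Ne, ENNReal.ofReal_eq_zero, not_le]; positivity)] at h1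
  exact lt_irrefl _ h1

theorem sum_measureReal_levelSet_rpow_le {μ : Measure Ω} (hf : Measurable f) {p : ℝ} (hp : 0 < p)
    (h : ∫⁻ x, f x ^ p ∂μ ≠ ⊤) (M : Finset ℤ) :
    ENNReal.ofReal ((∑ m ∈ M, 2 ^ (m * p) * μ.real (levelSet f m)) ^ (1 / p))
      ≤ (∫⁻ x, f x ^ p ∂μ) ^ (1 / p) := by
  rw [← ENNReal.ofReal_rpow_of_nonneg
    (Finset.sum_nonneg fun m _ => mul_nonneg (by positivity) measureReal_nonneg) (by positivity)]
  refine ENNReal.rpow_le_rpow ?_ (by positivity)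
  rw [ENNReal.ofReal_sum_of_nonneg
    (fun m _ => mul_nonneg (by positivity) measureReal_nonneg)]
  refine le_trans (Finset.sum_le_sum fun m _ => ?_) (sum_measure_levelSet_le μ hf hp M)
  rw [ENNReal.ofReal_mul (by positivity), ofReal_measureReal
    (measure_levelSet_lt_top hf hp h m).ne]

end LevelSet

/-- Real interpolation of restricted type bounds, with constants. Here `Φ m n` stands for the
contribution of the pieces of `f` and `g` at heights `2 ^ m` and `2 ^ n`. -/
theorem exists_interpolation {u₀ u₁ v₀ v₁ τ p r : ℝ} (hτ : 0 < τ) (hτ1 : τ < 1)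
    (hu₀ : u₀ ∈ Set.Ioc (0 : ℝ) 1) (hu₁ : u₁ ∈ Set.Icc (0 : ℝ) 1) (hv₀ : v₀ ∈ Set.Ioc (0 : ℝ) 1)
    (hv₁ : v₁ ∈ Set.Icc (0 : ℝ) 1) (hp : 1 ≤ p) (hr : 1 ≤ r)
    (hpu : 1 / p = (1 - τ) * u₀ + τ * u₁) (hrv : 1 / r = (1 - τ) * v₀ + τ * v₁)
    (hpr : 1 ≤ 1 / p + 1 / r) (hv : v₀ ≠ v₁) (hu : p = 1 ∨ u₀ ≠ u₁) :
    ∃ C : ℝ, 0 < C ∧ ∀ (Ω₁ Ω₂ : Type) [MeasurableSpace Ω₁] [MeasurableSpace Ω₂]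
      (μ : Measure Ω₁) (ν : Measure Ω₂) (f : Ω₁ → ℝ≥0∞) (g : Ω₂ → ℝ≥0∞) (A B : ℝ)
      (Φ : ℤ → ℤ → ℝ≥0∞), Measurable f → Measurable g → ∫⁻ x, f x ^ p ∂μ ≠ ⊤ →
      ∫⁻ x, g x ^ r ∂ν ≠ ⊤ → 0 ≤ A → 0 ≤ B →
      (∀ m n, Φ m n ≤ ENNReal.ofReal ((2 : ℝ) ^ (m : ℝ) * 2 ^ (n : ℝ) *
        min (A * μ.real (levelSet f m) ^ u₀ * ν.real (levelSet g n) ^ v₀)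
          (B * μ.real (levelSet f m) ^ u₁ * ν.real (levelSet g n) ^ v₁))) →
      ∑' z : ℤ × ℤ, Φ z.1 z.2 ≤ ENNReal.ofReal (C * (A ^ (1 - τ) * B ^ τ)) *
        ((∫⁻ x, f x ^ p ∂μ) ^ (1 / p) * (∫⁻ x, g x ^ r ∂ν) ^ (1 / r)) := by
  obtain ⟨C, hC, h⟩ := exists_sum_sum_min_le hτ hτ1 ⟨hu₀.1.le, hu₀.2⟩ hu₁ hv₀ hv₁ hu₀.1 hp hr
    hpu hrv hpr hv hu
  refine ⟨C, hC, ?_⟩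
  intro Ω₁ Ω₂ _ _ μ ν f g A B Φ hf hg hfi hgi hA hB hΦ
  rw [ENNReal.tsum_eq_iSup_sum]
  refine iSup_le fun s => ?_
  calc ∑ z ∈ s, Φ z.1 z.2 ≤ ∑ z ∈ s.image Prod.fst ×ˢ s.image Prod.snd, Φ z.1 z.2 :=
        Finset.sum_le_sum_of_subset Finset.subset_product
    _ ≤ ∑ z ∈ s.image Prod.fst ×ˢ s.image Prod.snd, _ := Finset.sum_le_sum fun z _ => hΦ z.1 z.2
    _ = ENNReal.ofReal (∑ m ∈ s.image Prod.fst, ∑ n ∈ s.image Prod.snd,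
          (2 : ℝ) ^ (m : ℝ) * 2 ^ (n : ℝ) *
          min (A * μ.real (levelSet f m) ^ u₀ * ν.real (levelSet g n) ^ v₀)
          (B * μ.real (levelSet f m) ^ u₁ * ν.real (levelSet g n) ^ v₁)) := by
        rw [← Finset.sum_product', ENNReal.ofReal_sum_of_nonneg]
        intro z _
        positivity
    _ ≤ _ := ENNReal.ofReal_le_ofReal (h _ _ _ _ A B (fun _ => measureReal_nonneg)
          (fun _ => measureReal_nonneg) hA hB)
    _ ≤ _ := by
        rw [ENNReal.ofReal_mul (by positivity), ENNReal.ofReal_mul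
          (Real.rpow_nonneg (Finset.sum_nonneg fun m _ =>
            mul_nonneg (by positivity) measureReal_nonneg) _)]
        gcongr
        · exact sum_measureReal_levelSet_rpow_le hf (by linarith) hfi _
        · exact sum_measureReal_levelSet_rpow_le hg (by linarith) hgi _

/-- Two bounds for the terms of a series, geometric progressions in opposite directions, bound the
sum by the geometric mean of their prefactors. -/
theorem exists_tsum_ofReal_min_le {τ Δ : ℝ} (hτ : 0 < τ) (hτ1 : τ < 1) (hΔ : Δ ≠ 0) :
    ∃ C : ℝ, 0 < C ∧ ∀ (Φ : ℤ → ℝ≥0∞) (P Q : ℝ), 0 ≤ P → 0 ≤ Q →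
      (∀ j : ℤ, Φ j ≤ ENNReal.ofReal
        (min (P * 2 ^ (-(τ * Δ) * (j : ℝ))) (Q * 2 ^ ((1 - τ) * Δ * (j : ℝ))))) →
      ∑' j, Φ j ≤ ENNReal.ofReal (C * (P ^ (1 - τ) * Q ^ τ)) := by
  obtain ⟨C, hC, h⟩ := exists_sum_min_le hτ hτ1 hΔ
  refine ⟨C, hC, fun Φ P Q hP hQ hΦ => ?_⟩
  rw [ENNReal.tsum_eq_iSup_sum]
  refine iSup_le fun s => (Finset.sum_le_sum fun j _ => hΦ j).trans ?_
  rw [← ENNReal.ofReal_sum_of_nonneg (fun j _ => by positivity)]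
  exact ENNReal.ofReal_le_ofReal (h s P Q hP hQ)

/-! ### The Hardy–Littlewood–Sobolev inequality on spaces of linear growth -/

/-- Balls of radius `r` have measure at most `2 r + 1`, as in `ℝ` and in `ℤ`. -/
def LinearGrowth (X : Type) [NormedAddCommGroup X] [MeasureSpace X] : Prop :=
  ∀ (x : X) (r : ℝ), 0 ≤ r → volume (Metric.closedBall x r) ≤ ENNReal.ofReal (2 * r + 1)

/-- The points `t` with `2 ^ j ≤ 1 + |t - s| < 2 ^ (j + 1)`. -/
def band {X : Type} [NormedAddCommGroup X] (s : X) (j : ℤ) : Set X :=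
  {t | dyadicScale (1 + ‖t - s‖) = j}

section Band

variable {X : Type} [NormedAddCommGroup X]

theorem iUnion_band (s : X) : ⋃ j, band s j = Set.univ := by
  ext x; simp [band]

theorem mem_band_comm {s t : X} {j : ℤ} : t ∈ band s j ↔ s ∈ band t j := by
  simp only [band, Set.mem_ofPred_eq, norm_sub_rev]

theorem disjoint_band (s : X) {i j : ℤ} (h : i ≠ j) : Disjoint (band s i) (band s j) :=
  Set.disjoint_left.2 fun _ hx hy => h (hx.symm.trans hy)

theorem rpow_neg_le_of_mem_band {s t : X} {j : ℤ} (h : t ∈ band s j) {e : ℝ} (he : 0 ≤ e) :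
    (1 + ‖t - s‖) ^ (-e) ≤ 2 ^ (-e * j) := by
  have hpos : 0 < 1 + ‖t - s‖ := by positivity
  have h1 := two_rpow_dyadicScale_le hpos
  rw [show dyadicScale (1 + ‖t - s‖) = j from h] at h1
  calc (1 + ‖t - s‖) ^ (-e) ≤ ((2 : ℝ) ^ (j : ℝ)) ^ (-e) :=
        Real.rpow_le_rpow_of_nonpos (by positivity) h1 (by linarith)
    _ = _ := by rw [← Real.rpow_mul (by norm_num), mul_comm]

theorem volume_band_le [MeasureSpace X] (hX : LinearGrowth X) (s : X) (j : ℤ) :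
    volume (band s j) ≤ ENNReal.ofReal (4 * 2 ^ (j : ℝ)) := by
  have hlt : ∀ t ∈ band s j, 1 + ‖t - s‖ < (2 : ℝ) ^ ((j : ℝ) + 1) := fun t ht => by
    have := lt_two_rpow_dyadicScale_add_one (show 0 < 1 + ‖t - s‖ by positivity)
    rwa [show dyadicScale (1 + ‖t - s‖) = j from ht] at this
  have h2 : (2 : ℝ) ^ ((j : ℝ) + 1) = 2 * 2 ^ (j : ℝ) := by
    rw [Real.rpow_add (by norm_num), Real.rpow_one, mul_comm]
  rcases Set.eq_empty_or_nonempty (band s j) with h | ⟨t₀, ht₀⟩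
  · rw [h, measure_empty]; exact zero_le
  have hr : 0 ≤ (2 : ℝ) ^ ((j : ℝ) + 1) - 1 := by
    linarith [hlt t₀ ht₀, norm_nonneg (t₀ - s)]
  calc volume (band s j) ≤ volume (Metric.closedBall s ((2 : ℝ) ^ ((j : ℝ) + 1) - 1)) := by
        refine measure_mono fun t ht => ?_
        rw [Metric.mem_closedBall, dist_eq_norm]
        linarith [hlt t ht]
    _ ≤ _ := hX _ _ hr
    _ ≤ _ := ENNReal.ofReal_le_ofReal (by linarith)

end Band

theorem lintegral_le_tsum_of_ae {Ω ι : Type} [Countable ι] [MeasurableSpace Ω] {μ : Measure Ω}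
    {h : Ω → ℝ≥0∞} {s : ι → Set Ω} (hs : ∀ᵐ x ∂μ, h x ≠ 0 → x ∈ ⋃ i, s i) :
    ∫⁻ x, h x ∂μ ≤ ∑' i, ∫⁻ x in s i, h x ∂μ := by
  calc ∫⁻ x, h x ∂μ ≤ ∫⁻ x, (⋃ i, s i).indicator h x ∂μ := by
        refine lintegral_mono_ae (hs.mono fun x hx => ?_)
        by_cases h0 : h x = 0
        · rw [h0]; exact zero_le
        · rw [Set.indicator_of_mem (hx h0)]
    _ ≤ ∫⁻ x in ⋃ i, s i, h x ∂μ := lintegral_indicator_le _ _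
    _ ≤ _ := lintegral_iUnion_le _ _

section HardyLittlewoodSobolev

/-- The points `u ∈ F` at distance about `2 ^ j` from `t` contribute at most the smaller of
`2 ^ (-e j) |F|` and a multiple of `2 ^ ((1 - e) j)`; these are summed over `j`. -/
theorem exists_setLIntegral_rpow_neg_le {e : ℝ} (he : 0 < e) (he1 : e < 1) :
    ∃ C : ℝ, 0 < C ∧ ∀ (X : Type) [NormedAddCommGroup X] [MeasureSpace X], LinearGrowth X →
      ∀ (t : X) (F : Set X), volume F ≠ ⊤ →
      ∫⁻ u in F, ENNReal.ofReal ((1 + ‖u - t‖) ^ (-e))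
        ≤ ENNReal.ofReal (C * (volume : Measure X).real F ^ (1 - e)) := by
  obtain ⟨C, hC, h⟩ := exists_tsum_ofReal_min_le he he1 one_ne_zero
  refine ⟨C * 4 ^ e, by positivity, ?_⟩
  intro X _ _ hX t F hF
  refine (lintegral_le_tsum_of_ae (s := fun j => band t j)
    (ae_of_all _ fun x _ => by rw [iUnion_band]; trivial)).trans ?_
  refine (h _ (volume.real F) 4 measureReal_nonneg (by norm_num) fun j => ?_).trans
    (le_of_eq (by ring_nf))
  have hband : ∫⁻ u in band t j, ENNReal.ofReal ((1 + ‖u - t‖) ^ (-e)) ∂(volume.restrict F)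
      ≤ ENNReal.ofReal (2 ^ (-e * j)) * volume.restrict F (band t j) := by
    rw [← setLIntegral_const]
    exact setLIntegral_mono measurable_const fun u hu =>
      ENNReal.ofReal_le_ofReal (rpow_neg_le_of_mem_band hu he.le)
  refine hband.trans ?_
  rw [ENNReal.ofReal_min]
  refine le_min ?_ ?_
  · calc _ ≤ ENNReal.ofReal (2 ^ (-e * j)) * volume F := by
          refine mul_le_mul_right ?_ _
          exact (measure_mono (Set.subset_univ _)).trans_eq (Measure.restrict_apply_univ F)
      _ = _ := by
          rw [← ofReal_measureReal hF, ← ENNReal.ofReal_mul (by positivity)]; ring_nf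
  · calc _ ≤ ENNReal.ofReal (2 ^ (-e * j)) * ENNReal.ofReal (4 * 2 ^ (j : ℝ)) := by
          gcongr
          exact (Measure.restrict_apply_le _ _).trans (volume_band_le hX t j)
      _ = _ := by
          rw [← ENNReal.ofReal_mul (by positivity), mul_left_comm,
            ← Real.rpow_add (by norm_num)]
          ring_nf

theorem measurable_rpow_norm_sub {X : Type} [NormedAddCommGroup X] [MeasurableSpace X]
    [BorelSpace X] [SecondCountableTopology X] (e : ℝ) :
    Measurable fun z : X × X => ENNReal.ofReal ((1 + ‖z.2 - z.1‖) ^ e) := by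
  have : Measurable fun z : X × X => ‖z.2 - z.1‖ := (by fun_prop : Continuous _).measurable
  fun_prop

/-- The diagonal Hardy–Littlewood–Sobolev inequality for the kernel `(1 + |t - u|) ^ (-(1 - θ))`
on a space of linear growth. On functions of height about `2 ^ m` and `2 ^ n` it holds with two
restricted type bounds, off the diagonal on either side. -/
theorem exists_hardyLittlewoodSobolev {θ : ℝ} (hθ : 0 < θ) (hθ1 : θ ≤ 1) :
    ∃ C : ℝ, 0 < C ∧ ∀ (X : Type) [NormedAddCommGroup X] [MeasureSpace X] [BorelSpace X]
      [SecondCountableTopology X] [SigmaFinite (volume : Measure X)], LinearGrowth X →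
      ∀ f : X → ℝ≥0∞, Measurable f →
      ∫⁻ t, ∫⁻ u, ENNReal.ofReal ((1 + ‖u - t‖) ^ (-(1 - θ))) * (f t * f u)
        ≤ ENNReal.ofReal C * (∫⁻ t, f t ^ (2 / (1 + θ))) ^ (1 + θ) := by
  rcases hθ1.eq_or_lt with rfl | hθ1
  · refine ⟨1, one_pos, fun X _ _ _ _ _ _ f hf => ?_⟩
    norm_num
    simp_rw [lintegral_const_mul _ hf]
    rw [lintegral_mul_const _ hf, sq]
  obtain ⟨C₀, hC₀, h₀⟩ := exists_setLIntegral_rpow_neg_le (e := 1 - θ) (by linarith) (by linarith)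
  set p : ℝ := 2 / (1 + θ) with hp
  have hp1 : 1 ≤ p := by rw [hp, le_div_iff₀ (by linarith)]; linarith
  have hpinv : 1 / p = (1 + θ) / 2 := by rw [hp, one_div_div]
  obtain ⟨C, hC, h⟩ := exists_interpolation (u₀ := 1) (u₁ := θ) (v₀ := θ) (v₁ := 1) (τ := 1 / 2)
    (p := p) (r := p) (by norm_num) (by norm_num) ⟨by norm_num, le_rfl⟩ ⟨hθ.le, hθ1.le⟩
    ⟨hθ, hθ1.le⟩ ⟨by norm_num, le_rfl⟩ hp1 hp1 (by rw [hpinv]; ring) (by rw [hpinv]; ring)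
    (by rw [hpinv]; linarith) hθ1.ne (Or.inr hθ1.ne')
  refine ⟨C * (4 * C₀), by positivity, fun X _ _ _ _ _ hX f hf => ?_⟩
  by_cases hfi : ∫⁻ t, f t ^ p = ⊤
  · rw [hfi, ENNReal.top_rpow_of_pos (by linarith), ENNReal.mul_top
      (by rw [Ne, ENNReal.ofReal_eq_zero, not_le]; positivity)]
    exact le_top
  have hp0 : 0 < p := by linarith
  have hfin : ∀ᵐ t, f t ≠ ⊤ := by
    refine (ae_lt_top (hf.pow_const p) hfi).mono fun t ht h => ?_
    rw [h, ENNReal.top_rpow_of_pos hp0] at ht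
    exact lt_irrefl _ ht
  set w : X × X → ℝ≥0∞ := fun z => ENNReal.ofReal ((1 + ‖z.2 - z.1‖) ^ (-(1 - θ))) with hw
  have hwm : Measurable w := measurable_rpow_norm_sub _
  have hfm : Measurable fun z : X × X => f z.1 * f z.2 :=
    (hf.comp measurable_fst).mul (hf.comp measurable_snd)
  have hprod : ∫⁻ t, ∫⁻ u, ENNReal.ofReal ((1 + ‖u - t‖) ^ (-(1 - θ))) * (f t * f u)
      = ∫⁻ z : X × X, w z * (f z.1 * f z.2) ∂(volume.prod volume) := by
    exact (lintegral_prod (fun z : X × X => w z * (f z.1 * f z.2))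
      (hwm.mul hfm).aemeasurable).symm
  have hE := measurableSet_levelSet hf
  have hEfin := fun m => (measure_levelSet_lt_top hf hp0 hfi m).ne
  have key := h X X volume volume f f (4 * C₀) (4 * C₀)
    (fun m n => ∫⁻ z in levelSet f m ×ˢ levelSet f n, w z * (f z.1 * f z.2) ∂(volume.prod volume))
    hf hf hfi hfi (by positivity) (by positivity) (fun m n => by
      have h1 : ∫⁻ z in levelSet f m ×ˢ levelSet f n, w z * (f z.1 * f z.2) ∂(volume.prod volume)
          ≤ ENNReal.ofReal (2 ^ ((m : ℝ) + 1) * 2 ^ ((n : ℝ) + 1)) *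
            ∫⁻ z in levelSet f m ×ˢ levelSet f n, w z ∂(volume.prod volume) := by
        rw [← lintegral_const_mul _ hwm]
        refine setLIntegral_mono (hwm.const_mul _) fun z hz => ?_
        rw [mul_comm]
        gcongr
        rw [ENNReal.ofReal_mul (by positivity)]
        exact mul_le_mul' (le_two_rpow_of_mem_levelSet hz.1) (le_two_rpow_of_mem_levelSet hz.2)
      have h2 : ∀ m n, ∫⁻ t in levelSet f m, ∫⁻ u in levelSet f n, w (t, u)
          ≤ ENNReal.ofReal (C₀ * volume.real (levelSet f m) * volume.real (levelSet f n) ^ θ) := by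
        intro m n
        calc _ ≤ ∫⁻ t in levelSet f m,
              ENNReal.ofReal (C₀ * volume.real (levelSet f n) ^ θ) := by
              refine lintegral_mono fun t => ?_
              refine (h₀ X hX t (levelSet f n) (hEfin n)).trans_eq ?_
              rw [sub_sub_cancel]
          _ = _ := by
              rw [setLIntegral_const, ← ofReal_measureReal (hEfin m),
                ← ENNReal.ofReal_mul (by positivity)]
              ring_nf
      have h3 : ∫⁻ z in levelSet f m ×ˢ levelSet f n, w z ∂(volume.prod volume)
          = ∫⁻ t in levelSet f m, ∫⁻ u in levelSet f n, w (t, u) := by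
        rw [← Measure.prod_restrict, lintegral_prod _ hwm.aemeasurable]
      have h4 : ∫⁻ t in levelSet f m, ∫⁻ u in levelSet f n, w (t, u)
          = ∫⁻ t in levelSet f n, ∫⁻ u in levelSet f m, w (t, u) := by
        rw [lintegral_lintegral_swap hwm.aemeasurable]
        simp only [hw, norm_sub_rev]
      have h5 : ∫⁻ z in levelSet f m ×ˢ levelSet f n, w z ∂(volume.prod volume)
          ≤ ENNReal.ofReal (C₀ * min (volume.real (levelSet f m) ^ (1 : ℝ) *
              volume.real (levelSet f n) ^ θ) (volume.real (levelSet f m) ^ θ *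
              volume.real (levelSet f n) ^ (1 : ℝ))) := by
        rw [mul_min_of_nonneg _ _ hC₀.le, ENNReal.ofReal_min, h3]
        refine le_min ((h2 m n).trans_eq ?_) ((h4.trans_le (h2 n m)).trans_eq ?_)
        · rw [Real.rpow_one]; ring_nf
        · rw [Real.rpow_one]; ring_nf
      refine h1.trans ((mul_le_mul_right h5 _).trans_eq ?_)
      rw [← ENNReal.ofReal_mul (by positivity), mul_assoc (4 * C₀), mul_assoc (4 * C₀),
        ← mul_min_of_nonneg _ _ (show (0 : ℝ) ≤ 4 * C₀ by positivity),
        Real.rpow_add (by norm_num), Real.rpow_add (by norm_num), Real.rpow_one]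
      ring_nf)
  rw [hprod]
  refine (lintegral_le_tsum_of_ae (s := fun z : ℤ × ℤ => levelSet f z.1 ×ˢ levelSet f z.2)
    ?_).trans (key.trans_eq ?_)
  · have h1 : ∀ᵐ z : X × X ∂(volume.prod volume), f z.1 ≠ ⊤ :=
      Measure.quasiMeasurePreserving_fst.ae hfin
    have h2 : ∀ᵐ z : X × X ∂(volume.prod volume), f z.2 ≠ ⊤ :=
      Measure.quasiMeasurePreserving_snd.ae hfin
    filter_upwards [h1, h2] with z hz1 hz2 hz
    have hz' := right_ne_zero_of_mul hz
    refine Set.mem_iUnion.2 ⟨(dyadicScale (f z.1).toReal, dyadicScale (f z.2).toReal), ?_⟩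
    exact ⟨⟨left_ne_zero_of_mul hz', hz1, rfl⟩, ⟨right_ne_zero_of_mul hz', hz2, rfl⟩⟩
  · rw [← ENNReal.rpow_add_of_nonneg _ _ (by positivity) (by positivity), hpinv,
      ← Real.rpow_add (by positivity)]
    norm_num

end HardyLittlewoodSobolev

/-! ### Pairs of operators on a fibre -/

section Fibre

variable {Y : Type} [MeasureSpace Y]

/-- `A^* B g` for the operators `A`, `B` on functions on `Y` with kernels `a`, `b`. -/
noncomputable def compAdj (a b : Y → Y → ℂ) (g : Y → ℂ) (y : Y) : ℂ :=
  ∫ x, ∫ z, conj (a x y) * b x z * g z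

/-- The bounds `L² → L²` and `L¹ → L^∞` for `A^* B`, tested on the functions in `D`. -/
structure PairBounds (D : Set (Y → ℂ)) (c₂ c₃ : ℝ≥0∞) (a b : Y → Y → ℂ) : Prop where
  converges : ∀ g ∈ D, ∀ᵐ y : Y, Integrable fun w : Y × Y => conj (a w.1 y) * b w.1 w.2 * g w.2
  l2_bound : ∀ g ∈ D, eLpNorm (compAdj a b g) 2 volume ≤ c₂ * eLpNorm g 2 volume
  decay_bound : ∀ g ∈ D, eLpNorm (compAdj a b g) ⊤ volume ≤ c₃ * eLpNorm g 1 volume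

/-- The test functions in `D` approximate, boundedly and almost everywhere, every measurable
function bounded by `1` and supported in one of the sets `B R`, which exhaust the space. -/
structure Approximating (D : Set (Y → ℂ)) (B : ℕ → Set Y) : Prop where
  measurable : ∀ g ∈ D, Measurable g
  memLp : ∀ g ∈ D, ∀ p : ℝ≥0∞, MemLp g p volume
  measurableSet : ∀ R, MeasurableSet (B R)
  mono : Monotone B
  iUnion : ⋃ R, B R = Set.univ
  finite : ∀ R, volume (B R) < ⊤
  approx : ∀ R (g : Y → ℂ), Measurable g → (∀ y, ‖g y‖ ≤ 1) → (∀ y ∉ B R, g y = 0) →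
    ∃ (u : ℕ → Y → ℂ) (h : Y → ℂ), h ∈ D ∧ (∀ n, u n ∈ D) ∧ (∀ n y, ‖u n y‖ ≤ ‖h y‖) ∧
      ∀ᵐ y, Tendsto (fun n => u n y) atTop (𝓝 (g y))

theorem tendsto_eLpNorm_of_dominated {Ω : Type} [MeasurableSpace Ω] {μ : Measure Ω} {p : ℝ≥0∞}
    (hp0 : p ≠ 0) (hp : p ≠ ⊤) {u : ℕ → Ω → ℂ} {g h : Ω → ℂ} (hu : ∀ n, Measurable (u n))
    (hh : MemLp h p μ) (hle : ∀ n y, ‖u n y‖ ≤ ‖h y‖)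
    (hlim : ∀ᵐ y ∂μ, Tendsto (fun n => u n y) atTop (𝓝 (g y))) :
    Tendsto (fun n => eLpNorm (u n) p μ) atTop (𝓝 (eLpNorm g p μ)) := by
  simp_rw [eLpNorm_eq_lintegral_rpow_enorm_toReal hp0 hp]
  refine Tendsto.ennrpow_const _ ?_
  refine tendsto_lintegral_of_dominated_convergence (fun y => ‖h y‖ₑ ^ p.toReal)
    (fun n => (hu n).enorm.pow_const _) (fun n => ae_of_all _ fun y => ?_) ?_ ?_
  · exact ENNReal.rpow_le_rpow (enorm_le_iff_norm_le.2 (hle n y)) ENNReal.toReal_nonneg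
  · exact (lintegral_rpow_enorm_lt_top_of_eLpNorm_lt_top hp0 hp hh.2).ne
  · filter_upwards [hlim] with y hy
    exact hy.enorm.ennrpow_const _

variable [SigmaFinite (volume : Measure Y)]

theorem stronglyMeasurable_compAdj {a b : Y → Y → ℂ} (ha : Measurable (Function.uncurry a))
    (hb : Measurable (Function.uncurry b)) {g : Y → ℂ} (hg : Measurable g) :
    StronglyMeasurable (compAdj a b g) := by
  have hm : Measurable fun q : (Y × Y) × Y => conj (a q.1.2 q.1.1) * b q.1.2 q.2 * g q.2 := by
    have h1 : Measurable fun q : (Y × Y) × Y => a q.1.2 q.1.1 :=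
      ha.comp (measurable_fst.snd.prodMk measurable_fst.fst)
    have h2 : Measurable fun q : (Y × Y) × Y => b q.1.2 q.2 :=
      hb.comp (measurable_fst.snd.prodMk measurable_snd)
    exact ((Complex.continuous_conj.measurable.comp h1).mul h2).mul (hg.comp measurable_snd)
  exact (hm.stronglyMeasurable.integral_prod_right' (ν := volume)).integral_prod_right'
    (ν := volume)

variable {D : Set (Y → ℂ)} {B : ℕ → Set Y} {c₂ c₃ : ℝ≥0∞} {a b : Y → Y → ℂ}

theorem PairBounds.tendsto_compAdj (H : PairBounds D c₂ c₃ a b) (hD : Approximating D B)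
    (ha : Measurable (Function.uncurry a)) (hb : Measurable (Function.uncurry b))
    {u : ℕ → Y → ℂ} {g h : Y → ℂ} (hh : h ∈ D) (hu : ∀ n, u n ∈ D)
    (hle : ∀ n y, ‖u n y‖ ≤ ‖h y‖) (hg : Measurable g)
    (hlim : ∀ᵐ y, Tendsto (fun n => u n y) atTop (𝓝 (g y))) :
    ∀ᵐ y, Tendsto (fun n => compAdj a b (u n) y) atTop (𝓝 (compAdj a b g y)) := by
  filter_upwards [H.converges h hh] with y hy
  have hlim2 : ∀ᵐ w : Y × Y ∂(volume.prod volume), Tendsto (fun n => u n w.2) atTop (𝓝 (g w.2)) :=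
    Measure.quasiMeasurePreserving_snd.ae hlim
  have hm : ∀ g : Y → ℂ, Measurable g →
      Measurable fun w : Y × Y => conj (a w.1 y) * b w.1 w.2 * g w.2 := by
    intro g hg
    have h1 : Measurable fun w : Y × Y => a w.1 y :=
      ha.comp (measurable_fst.prodMk measurable_const)
    exact ((Complex.continuous_conj.measurable.comp h1).mul hb).mul (hg.comp measurable_snd)
  have hdom : ∀ {v : Y → ℂ} {w : Y × Y}, ‖v w.2‖ ≤ ‖h w.2‖ →
      ‖conj (a w.1 y) * b w.1 w.2 * v w.2‖ ≤ ‖conj (a w.1 y) * b w.1 w.2 * h w.2‖ := by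
    intro v w hv
    rw [norm_mul, norm_mul _ (h w.2)]
    gcongr
  have hint : ∀ v : Y → ℂ, Measurable v → (∀ᵐ w : Y × Y ∂(volume.prod volume), ‖v w.2‖ ≤ ‖h w.2‖) →
      Integrable fun w : Y × Y => conj (a w.1 y) * b w.1 w.2 * v w.2 := fun v hv hvh =>
    hy.mono (hm v hv).aestronglyMeasurable (hvh.mono fun w hw => hdom hw)
  have hgh : ∀ᵐ w : Y × Y ∂(volume.prod volume), ‖g w.2‖ ≤ ‖h w.2‖ := by
    filter_upwards [hlim2] with w hw
    exact le_of_tendsto hw.norm (Eventually.of_forall fun n => hle n w.2)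
  have e : ∀ v : Y → ℂ, Measurable v →
      (∀ᵐ w : Y × Y ∂(volume.prod volume), ‖v w.2‖ ≤ ‖h w.2‖) →
      compAdj a b v y = ∫ w : Y × Y, conj (a w.1 y) * b w.1 w.2 * v w.2 := by
    intro v hv hvh
    exact (integral_prod _ (hint v hv hvh)).symm
  rw [e g hg hgh]
  simp_rw [fun n => e (u n) (hD.measurable _ (hu n)) (ae_of_all _ fun w => hle n w.2)]
  refine tendsto_integral_of_dominated_convergence
    (fun w : Y × Y => ‖conj (a w.1 y) * b w.1 w.2 * h w.2‖)
    (fun n => (hm _ (hD.measurable _ (hu n))).aestronglyMeasurable) hy.norm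
    (fun n => ae_of_all _ fun w => hdom (hle n w.2)) ?_
  filter_upwards [hlim2] with w hw
  exact hw.const_mul _

/-- The bounds for `A^* B` extend from the test functions to bounded functions. -/
theorem PairBounds.eLpNorm_compAdj_le (H : PairBounds D c₂ c₃ a b) (hD : Approximating D B)
    (hc₂ : c₂ ≠ ⊤) (hc₃ : c₃ ≠ ⊤)
    (ha : Measurable (Function.uncurry a)) (hb : Measurable (Function.uncurry b)) {R : ℕ}
    {g : Y → ℂ} (hg : Measurable g) (hg1 : ∀ y, ‖g y‖ ≤ 1) (hgR : ∀ y ∉ B R, g y = 0) :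
    eLpNorm (compAdj a b g) 2 volume ≤ c₂ * eLpNorm g 2 volume ∧
      eLpNorm (compAdj a b g) ⊤ volume ≤ c₃ * eLpNorm g 1 volume := by
  obtain ⟨u, h, hh, hu, hle, hlim⟩ := hD.approx R g hg hg1 hgR
  have ht := H.tendsto_compAdj hD ha hb hh hu hle hg hlim
  have hmeas : ∀ n, AEStronglyMeasurable (compAdj a b (u n)) volume := fun n =>
    (stronglyMeasurable_compAdj ha hb (hD.measurable _ (hu n))).aestronglyMeasurable
  have key : ∀ (q p : ℝ≥0∞) (c : ℝ≥0∞), p ≠ 0 → p ≠ ⊤ → c ≠ ⊤ →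
      (∀ n, eLpNorm (compAdj a b (u n)) q volume ≤ c * eLpNorm (u n) p volume) →
      eLpNorm (compAdj a b g) q volume ≤ c * eLpNorm g p volume := by
    intro q p c hp0 hp hc hbd
    refine (Lp.eLpNorm_lim_le_liminf_eLpNorm hmeas _ ht).trans ?_
    refine (liminf_le_liminf (Eventually.of_forall hbd)).trans_eq ?_
    exact (ENNReal.Tendsto.const_mul (tendsto_eLpNorm_of_dominated hp0 hp
      (fun n => hD.measurable _ (hu n)) (hD.memLp h hh p) hle hlim) (Or.inr hc)).liminf_eq
  exact ⟨key 2 2 c₂ (by norm_num) (by norm_num) hc₂ fun n => H.l2_bound _ (hu n),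
    key ⊤ 1 c₃ (by norm_num) (by norm_num) hc₃ fun n => H.decay_bound _ (hu n)⟩

theorem eLpNorm_le_measure_rpow {Ω : Type} [MeasurableSpace Ω] {μ : Measure Ω} {φ : Ω → ℂ}
    {E : Set Ω} (hE : MeasurableSet E) (h1 : ∀ y, ‖φ y‖ ≤ 1) (h0 : ∀ y ∉ E, φ y = 0) {p : ℝ≥0∞}
    (hp0 : p ≠ 0) (hp : p ≠ ⊤) : eLpNorm φ p μ ≤ μ E ^ (1 / p.toReal) := by
  calc eLpNorm φ p μ ≤ eLpNorm (E.indicator fun _ => (1 : ℝ)) p μ := by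
        refine eLpNorm_mono fun y => ?_
        by_cases hy : y ∈ E
        · simpa [hy] using h1 y
        · simp [hy, h0 y hy]
    _ = _ := by rw [eLpNorm_indicator_const hE hp0 hp]; simp

/-- The pairing of `φ` with `A^* B ψ`, for functions bounded by indicator functions. -/
theorem PairBounds.lintegral_mul_compAdj_le (H : PairBounds D c₂ c₃ a b)
    (hD : Approximating D B) (hc₂ : c₂ ≠ ⊤) (hc₃ : c₃ ≠ ⊤)
    (ha : Measurable (Function.uncurry a)) (hb : Measurable (Function.uncurry b)) {R : ℕ}
    {φ ψ : Y → ℂ} {E F : Set Y} (hE : MeasurableSet E) (hF : MeasurableSet F)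
    (hφ : Measurable φ) (hψ : Measurable ψ) (hφ1 : ∀ y, ‖φ y‖ ≤ 1) (hψ1 : ∀ y, ‖ψ y‖ ≤ 1)
    (hφ0 : ∀ y ∉ E, φ y = 0) (hψ0 : ∀ y ∉ F, ψ y = 0) (hFR : F ⊆ B R) :
    ∫⁻ y, ‖φ y‖ₑ * ‖compAdj a b ψ y‖ₑ
      ≤ min (c₂ * (volume E ^ (1 / 2 : ℝ) * volume F ^ (1 / 2 : ℝ)))
        (c₃ * (volume E * volume F)) := by
  obtain ⟨h2, h3⟩ := H.eLpNorm_compAdj_le hD hc₂ hc₃ ha hb hψ hψ1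
    (fun y hy => hψ0 y fun h => hy (hFR h))
  have hm : AEMeasurable (fun y => ‖compAdj a b ψ y‖ₑ) volume :=
    (stronglyMeasurable_compAdj ha hb hψ).measurable.enorm.aemeasurable
  refine le_min ?_ ?_
  · have hH := ENNReal.lintegral_mul_le_Lp_mul_Lq volume Real.HolderConjugate.two_two
      hφ.enorm.aemeasurable hm
    have e : ∀ v : Y → ℂ, (∫⁻ y, ‖v y‖ₑ ^ (2 : ℝ)) ^ (1 / 2 : ℝ) = eLpNorm v 2 volume := fun v => by
      rw [eLpNorm_eq_lintegral_rpow_enorm_toReal (by norm_num) (by norm_num)]; norm_num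
    rw [e, e] at hH
    refine hH.trans ?_
    calc _ ≤ volume E ^ (1 / 2 : ℝ) * (c₂ * volume F ^ (1 / 2 : ℝ)) := by
          refine mul_le_mul' ?_ (h2.trans (mul_le_mul_right ?_ _))
          · simpa using eLpNorm_le_measure_rpow (p := 2) hE hφ1 hφ0 (by norm_num) (by norm_num)
          · simpa using eLpNorm_le_measure_rpow (p := 2) hF hψ1 hψ0 (by norm_num) (by norm_num)
      _ = _ := by ring
  · calc _ ≤ ∫⁻ y, ‖φ y‖ₑ * eLpNorm (compAdj a b ψ) ⊤ volume := by
          refine lintegral_mono_ae ?_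
          filter_upwards [enorm_ae_le_eLpNormEssSup (compAdj a b ψ) volume] with y hy
          rw [eLpNorm_exponent_top]
          gcongr
      _ = eLpNorm φ 1 volume * eLpNorm (compAdj a b ψ) ⊤ volume := by
          rw [lintegral_mul_const _ hφ.enorm, eLpNorm_one_eq_lintegral_enorm]
      _ ≤ volume E * (c₃ * volume F) := by
          refine mul_le_mul' ?_ (h3.trans (mul_le_mul_right ?_ _))
          · simpa using eLpNorm_le_measure_rpow (p := 1) hE hφ1 hφ0 (by norm_num) (by norm_num)
          · simpa using eLpNorm_le_measure_rpow (p := 1) hF hψ1 hψ0 (by norm_num) (by norm_num)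
      _ = _ := by ring

/-- `⟨A φ, B ψ⟩ = ⟨φ, A^* B ψ⟩`. The hypothesis provides the absolute convergence that Fubini's
theorem needs. -/
theorem integral_conj_mul_eq_integral_compAdj (ha : Measurable (Function.uncurry a))
    (hb : Measurable (Function.uncurry b)) {φ ψ : Y → ℂ} (hφ : Measurable φ) (hψ : Measurable ψ)
    (hfin : ∫⁻ x, (∫⁻ y, ‖a x y * φ y‖ₑ) * (∫⁻ z, ‖b x z * ψ z‖ₑ) ≠ ⊤) :
    ∫ x, conj (∫ y, a x y * φ y) * (∫ z, b x z * ψ z) = ∫ y, conj (φ y) * compAdj a b ψ y := by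
  set Ψ : Y → ℂ := fun x => ∫ z, b x z * ψ z with hΨ
  have hΨm : Measurable Ψ :=
    (StronglyMeasurable.integral_prod_right' (ν := volume) (f := fun q : Y × Y => b q.1 q.2 * ψ q.2)
      (hb.mul (hψ.comp measurable_snd)).stronglyMeasurable).measurable
  have hconj : Measurable fun q : Y × Y => conj (a q.1 q.2 * φ q.2) :=
    Complex.continuous_conj.measurable.comp (ha.mul (hφ.comp measurable_snd))
  have hint : Integrable (Function.uncurry fun x y => conj (a x y * φ y) * Ψ x)
      (volume.prod volume) := by
    have hm : Measurable (Function.uncurry fun x y => conj (a x y * φ y) * Ψ x) :=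
      hconj.mul (hΨm.comp measurable_fst)
    refine ⟨hm.aestronglyMeasurable, ?_⟩
    rw [HasFiniteIntegral, lintegral_prod _ hm.enorm.aemeasurable]
    refine lt_of_le_of_lt (lintegral_mono fun x => ?_) hfin.lt_top
    simp only [Function.uncurry, enorm_mul, RCLike.enorm_conj]
    rw [lintegral_mul_const _ (by
      have h1 : Measurable fun y => a x y := ha.comp (measurable_const.prodMk measurable_id)
      exact h1.enorm.mul hφ.enorm)]
    gcongr
    exact (enorm_integral_le_lintegral_enorm _).trans_eq (by simp only [enorm_mul])
  calc _ = ∫ x, ∫ y, conj (a x y * φ y) * Ψ x := by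
        refine integral_congr_ae (ae_of_all _ fun x => ?_)
        simp only
        rw [← integral_conj, integral_mul_const]
    _ = ∫ y, ∫ x, conj (a x y * φ y) * Ψ x := integral_integral_swap hint
    _ = _ := by
        refine integral_congr_ae (ae_of_all _ fun y => ?_)
        simp only [compAdj]
        rw [← integral_const_mul]
        refine integral_congr_ae (ae_of_all _ fun x => ?_)
        simp only [hΨ]
        rw [← integral_const_mul, ← integral_const_mul]
        refine integral_congr_ae (ae_of_all _ fun z => ?_)
        simp only [map_mul]
        ring

end Fibre

/-! ### Expansion of the energy on a fibre -/

section Slice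

variable {Y X : Type} [MeasureSpace Y] [MeasureSpace X]

/-- The fibre of `E ⊆ Y × X` over `t`. -/
def fibre (E : Set (Y × X)) (t : X) : Set Y := (fun y => (y, t)) ⁻¹' E

/-- The bound for `‖∫ A_t φ_t dt‖²` obtained from the bounds for `⟨A_t φ_t, A_u φ_u⟩`, where `φ`
is bounded by the indicator function of `E`. -/
noncomputable def fibreEnergy (c₂ : ℝ≥0∞) (c₃ : X → X → ℝ≥0∞) (E : Set (Y × X)) : ℝ≥0∞ :=
  ∫⁻ t, ∫⁻ u, min (c₂ * (volume (fibre E t) ^ (1 / 2 : ℝ) * volume (fibre E u) ^ (1 / 2 : ℝ)))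
    (c₃ t u * (volume (fibre E t) * volume (fibre E u)))

theorem fibreEnergy_mono (c₂ : ℝ≥0∞) (c₃ : X → X → ℝ≥0∞) {E F : Set (Y × X)} (h : E ⊆ F) :
    fibreEnergy c₂ c₃ E ≤ fibreEnergy c₂ c₃ F := by
  have hf : ∀ t, volume (fibre E t) ≤ volume (fibre F t) := fun t =>
    measure_mono (Set.preimage_mono h)
  refine lintegral_mono fun t => lintegral_mono fun u => ?_
  refine min_le_min (mul_le_mul_right (mul_le_mul' ?_ ?_) _)
    (mul_le_mul_right (mul_le_mul' (hf t) (hf u)) _)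
  · exact ENNReal.rpow_le_rpow (hf t) (by norm_num)
  · exact ENNReal.rpow_le_rpow (hf u) (by norm_num)

theorem mul_le_sq_add_sq (x y : ℝ≥0∞) : x * y ≤ x ^ 2 + y ^ 2 := by
  rcases le_total x y with h | h
  · calc x * y ≤ y * y := mul_le_mul_left h _
      _ ≤ _ := by rw [← sq]; exact le_add_self
  · calc x * y ≤ x * x := mul_le_mul_right h _
      _ ≤ _ := by rw [← sq]; exact le_self_add

variable [SigmaFinite (volume : Measure Y)] [SigmaFinite (volume : Measure X)]
  {D : Set (Y → ℂ)} {B : ℕ → Set Y} {c₂ : ℝ≥0∞} {c₃ : X → X → ℝ≥0∞}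
  {a : Y → Y × X → ℂ} {φ : Y × X → ℂ} {E : Set (Y × X)} {good : X → Prop}

theorem ae_lintegral_ne_top_of_sq {V : X → Y → ℝ≥0∞} (hV : Measurable fun q : X × Y => V q.1 q.2)
    (hfin : ∫⁻ q : X × X, ∫⁻ x, V q.1 x * V q.2 x ∂volume ∂(volume.prod volume) ≠ ⊤) :
    ∀ᵐ x : Y, ∫⁻ t, V t x ≠ ⊤ := by
  have hsq : ∫⁻ x : Y, (∫⁻ t, V t x) ^ 2 ≠ ⊤ := by
    have e : ∫⁻ x : Y, (∫⁻ t, V t x) ^ 2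
        = ∫⁻ q : X × X, ∫⁻ x, V q.1 x * V q.2 x ∂volume ∂(volume.prod volume) := by
      rw [← lintegral_lintegral_swap (f := fun x (q : X × X) => V q.1 x * V q.2 x)]
      · refine lintegral_congr fun x => ?_
        have hVx : Measurable fun t => V t x := hV.comp (measurable_id.prodMk measurable_const)
        rw [lintegral_prod_mul hVx.aemeasurable hVx.aemeasurable, sq]
      · have h1 : Measurable fun r : Y × (X × X) => V r.2.1 r.1 :=
          hV.comp (measurable_snd.fst.prodMk measurable_fst)
        have h2 : Measurable fun r : Y × (X × X) => V r.2.2 r.1 :=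
          hV.comp (measurable_snd.snd.prodMk measurable_fst)
        exact (h1.mul h2).aemeasurable
    rw [e]; exact hfin
  have hm : Measurable fun x : Y => ∫⁻ t, V t x :=
    Measurable.lintegral_prod_left' (f := fun q : X × Y => V q.1 q.2) hV
  refine (ae_lt_top (hm.pow_const 2) hsq).mono fun x hx h => ?_
  rw [h] at hx
  simp at hx

/-- `‖∫ Φ_t dt‖² = ∫ ∫ ⟨Φ_t, Φ_u⟩ dt du`, for an absolutely convergent double integral. -/
theorem lintegral_enorm_integral_sq_le {V : X → Y → ℝ≥0∞} {Φ : X → Y → ℂ}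
    (hΦ : Measurable fun q : X × Y => Φ q.1 q.2)
    (hΦV : ∀ t x, ‖Φ t x‖ₑ ≤ V t x)
    (hfin : ∫⁻ q : X × X, ∫⁻ x, V q.1 x * V q.2 x ∂volume ∂(volume.prod volume) ≠ ⊤) :
    ∫⁻ x, ‖∫ t, Φ t x‖ₑ ^ 2
      ≤ ∫⁻ q : X × X, ‖∫ x, conj (Φ q.1 x) * Φ q.2 x‖ₑ ∂(volume.prod volume) := by
  set G : Y → X × X → ℂ := fun x q => conj (Φ q.1 x) * Φ q.2 x with hG
  have hGm : Measurable (Function.uncurry G) := by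
    have h1 : Measurable fun r : Y × (X × X) => Φ r.2.1 r.1 :=
      hΦ.comp (measurable_snd.fst.prodMk measurable_fst)
    have h2 : Measurable fun r : Y × (X × X) => Φ r.2.2 r.1 :=
      hΦ.comp (measurable_snd.snd.prodMk measurable_fst)
    exact (Complex.continuous_conj.measurable.comp h1).mul h2
  have hGV : ∀ x q, ‖G x q‖ₑ ≤ V q.1 x * V q.2 x := fun x q => by
    simp only [hG, enorm_mul, RCLike.enorm_conj]
    exact mul_le_mul' (hΦV _ _) (hΦV _ _)
  have hGint : Integrable (Function.uncurry G) (volume.prod (volume.prod volume)) := by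
    refine ⟨hGm.aestronglyMeasurable, ?_⟩
    rw [HasFiniteIntegral, lintegral_prod_symm _ hGm.enorm.aemeasurable]
    exact lt_of_le_of_lt (lintegral_mono fun q => lintegral_mono fun x => hGV x q) hfin.lt_top
  have e1 : ∀ x : Y, ∫ q : X × X, G x q ∂(volume.prod volume)
      = ((‖∫ t, Φ t x‖ ^ 2 : ℝ) : ℂ) := by
    intro x
    simp only [hG]
    rw [integral_prod_mul (fun t => conj (Φ t x)) (fun u => Φ u x), integral_conj,
      mul_comm, Complex.mul_conj, Complex.normSq_eq_norm_sq]
  have hri : Integrable fun x => ‖∫ t, Φ t x‖ ^ 2 := by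
    have hGi : Integrable (fun x => ∫ q : X × X, G x q ∂(volume.prod volume)) :=
      hGint.integral_prod_left
    simp_rw [e1] at hGi
    simpa using hGi.norm
  have hsqeq : ∫⁻ x, ‖∫ t, Φ t x‖ₑ ^ 2 = ‖∫ x, ∫ q : X × X, G x q ∂(volume.prod volume)‖ₑ := by
    simp_rw [e1]
    rw [integral_complex_ofReal, ← ofReal_norm, Complex.norm_real, ofReal_norm,
      Real.enorm_of_nonneg (integral_nonneg fun x => by positivity),
      ofReal_integral_eq_lintegral_ofReal hri (ae_of_all _ fun x => by positivity)]
    refine lintegral_congr fun x => ?_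
    rw [ENNReal.ofReal_pow (norm_nonneg _), ofReal_norm]
  rw [hsqeq, integral_integral_swap hGint]
  exact enorm_integral_le_lintegral_enorm _

/-- The expansion of `‖∫ A_t φ_t dt‖²`, for functions `φ` supported in a set on which all the
integrals involved converge absolutely. -/
theorem lintegral_sq_le_fibreEnergy_of_bounded (hD : Approximating D B) (hc₂ : c₂ ≠ ⊤)
    (hc₃ : ∀ t u, c₃ t u ≠ ⊤) (ha : Measurable (Function.uncurry a))
    (hgood : ∀ᵐ t, good t)
    (H : ∀ t u, good t → good u →
      PairBounds D c₂ (c₃ t u) (fun x y => a x (y, t)) (fun x y => a x (y, u)))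
    (hE : MeasurableSet E) (hφ : Measurable φ) (hφ1 : ∀ z, ‖φ z‖ ≤ 1) (hφ0 : ∀ z ∉ E, φ z = 0)
    {R : ℕ} {T : Set X} {N : ℝ≥0∞} (hN : N ≠ ⊤) (hT : MeasurableSet T) (hTfin : volume T ≠ ⊤)
    (hER : ∀ z ∈ E, z.1 ∈ B R) (hET : ∀ z ∈ E, z.2 ∈ T)
    (hEN : ∀ z ∈ E, ∫⁻ x, ‖a x z‖ₑ * ∫⁻ y in B R, ‖a x (y, z.2)‖ₑ ≤ N) :
    ∫⁻ x, ‖∫ z, a x z * φ z‖ₑ ^ 2 ≤ fibreEnergy c₂ c₃ E := by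
  have hmt : ∀ t, Measurable (Function.uncurry fun x y => a x (y, t)) := fun t =>
    ha.comp (measurable_fst.prodMk (measurable_snd.prodMk measurable_const))
  have hφt : ∀ t, Measurable fun y => φ (y, t) := fun t =>
    hφ.comp (measurable_id.prodMk measurable_const)
  have hφ1' : ∀ z, ‖φ z‖ₑ ≤ 1 := fun z => by
    rw [← enorm_one (G := ℝ)]; exact enorm_le_iff_norm_le.2 (by simpa using hφ1 z)
  -- the absolute version of `A_t φ_t (x)`
  set V : X → Y → ℝ≥0∞ := fun t x => ∫⁻ y, ‖a x (y, t) * φ (y, t)‖ₑ with hV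
  have hVm2 : Measurable fun q : X × Y => V q.1 q.2 := by
    have : Measurable fun r : (X × Y) × Y => ‖a r.1.2 (r.2, r.1.1) * φ (r.2, r.1.1)‖ₑ := by
      have h1 : Measurable fun r : (X × Y) × Y => a r.1.2 (r.2, r.1.1) :=
        ha.comp (measurable_fst.snd.prodMk (measurable_snd.prodMk measurable_fst.fst))
      have h2 : Measurable fun r : (X × Y) × Y => φ (r.2, r.1.1) :=
        hφ.comp (measurable_snd.prodMk measurable_fst.fst)
      exact (h1.mul h2).enorm
    exact this.lintegral_prod_right'
  have hVm : ∀ t, Measurable (V t) := fun t => hVm2.comp (measurable_const.prodMk measurable_id)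
  have hVT : ∀ t ∉ T, ∀ x, V t x = 0 := fun t ht x => by
    have : ∀ y, φ (y, t) = 0 := fun y => hφ0 _ fun h => ht (hET _ h)
    simp [hV, this]
  have hVle : ∀ t x, V t x ≤ ∫⁻ y in B R, ‖a x (y, t)‖ₑ := fun t x => by
    rw [← lintegral_indicator (hD.measurableSet R)]
    refine lintegral_mono fun y => ?_
    by_cases hy : (y, t) ∈ E
    · rw [Set.indicator_of_mem (hER _ hy), enorm_mul]
      exact mul_le_of_le_one_right zero_le (hφ1' _)
    · simp [hφ0 _ hy]
  set Q : ℝ≥0∞ := N * volume (B R) with hQ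
  have hQfin : Q ≠ ⊤ := ENNReal.mul_ne_top hN (hD.finite R).ne
  have hVsq : ∀ t, ∫⁻ x, V t x ^ 2 ≤ Q := by
    intro t
    calc ∫⁻ x, V t x ^ 2 = ∫⁻ x, ∫⁻ y, ‖a x (y, t) * φ (y, t)‖ₑ * V t x := by
          refine lintegral_congr fun x => ?_
          rw [lintegral_mul_const, sq]
          have h1 : Measurable fun y => a x (y, t) :=
            (hmt t).comp (measurable_const.prodMk measurable_id)
          exact (h1.mul (hφt t)).enorm
      _ = ∫⁻ y, ∫⁻ x, ‖a x (y, t) * φ (y, t)‖ₑ * V t x := by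
          refine lintegral_lintegral_swap ?_
          exact (((hmt t).mul ((hφt t).comp measurable_snd)).enorm.mul
            ((hVm t).comp measurable_fst)).aemeasurable
      _ ≤ ∫⁻ y, (B R).indicator (fun _ => N) y := by
          refine lintegral_mono fun y => ?_
          by_cases hy : (y, t) ∈ E
          · rw [Set.indicator_of_mem (hER _ hy)]
            refine le_trans (lintegral_mono fun x => ?_) (hEN _ hy)
            refine mul_le_mul' ?_ (hVle t x)
            rw [enorm_mul]
            exact mul_le_of_le_one_right zero_le (hφ1' _)
          · simp [hφ0 _ hy]
      _ = Q := by rw [lintegral_indicator (hD.measurableSet R), setLIntegral_const]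
  have hVV : ∀ t u, ∫⁻ x, V t x * V u x ≤ 2 * Q := by
    intro t u
    calc _ ≤ ∫⁻ x, (V t x ^ 2 + V u x ^ 2) := lintegral_mono fun x => mul_le_sq_add_sq _ _
      _ = (∫⁻ x, V t x ^ 2) + ∫⁻ x, V u x ^ 2 := lintegral_add_left ((hVm t).pow_const 2) _
      _ ≤ 2 * Q := by rw [two_mul]; exact add_le_add (hVsq t) (hVsq u)
  set Φ : X → Y → ℂ := fun t x => ∫ y, a x (y, t) * φ (y, t) with hΦ
  have hΦV : ∀ t x, ‖Φ t x‖ₑ ≤ V t x := fun t x => enorm_integral_le_lintegral_enorm _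
  have hΦm2 : Measurable fun q : X × Y => Φ q.1 q.2 := by
    have : Measurable fun r : (X × Y) × Y => a r.1.2 (r.2, r.1.1) * φ (r.2, r.1.1) := by
      have h1 : Measurable fun r : (X × Y) × Y => a r.1.2 (r.2, r.1.1) :=
        ha.comp (measurable_fst.snd.prodMk (measurable_snd.prodMk measurable_fst.fst))
      have h2 : Measurable fun r : (X × Y) × Y => φ (r.2, r.1.1) :=
        hφ.comp (measurable_snd.prodMk measurable_fst.fst)
      exact h1.mul h2
    exact (this.stronglyMeasurable.integral_prod_right' (ν := volume)).measurable
  have hVVfin : ∫⁻ q : X × X, ∫⁻ x, V q.1 x * V q.2 x ∂volume ∂(volume.prod volume) ≠ ⊤ := by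
    have hle : ∫⁻ q : X × X, ∫⁻ x, V q.1 x * V q.2 x ∂volume ∂(volume.prod volume)
        ≤ ∫⁻ q : X × X, (T ×ˢ T).indicator (fun _ => 2 * Q) q ∂(volume.prod volume) := by
      refine lintegral_mono fun q => ?_
      by_cases hq : q ∈ T ×ˢ T
      · rw [Set.indicator_of_mem hq]; exact hVV _ _
      · rw [Set.indicator_of_notMem hq]
        have : ∀ x, V q.1 x * V q.2 x = 0 := fun x => by
          rw [Set.mem_prod, not_and_or] at hq
          rcases hq with hq | hq
          · rw [hVT _ hq, zero_mul]
          · rw [hVT _ hq, mul_zero]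
        simp [this]
    refine (hle.trans_lt ?_).ne
    rw [lintegral_indicator (hT.prod hT), setLIntegral_const, Measure.prod_prod]
    exact (ENNReal.mul_ne_top (ENNReal.mul_ne_top (by norm_num) hQfin)
      (ENNReal.mul_ne_top hTfin hTfin)).lt_top
  -- on almost every fibre the integral over `Y × X` is the iterated one
  have hI : ∀ᵐ x : Y, ∫ z, a x z * φ z = ∫ t, Φ t x := by
    filter_upwards [ae_lintegral_ne_top_of_sq hVm2 hVVfin] with x hx
    have hm : Measurable fun z : Y × X => a x z * φ z :=
      (ha.comp (measurable_const.prodMk measurable_id)).mul hφ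
    have hint : Integrable (fun z : Y × X => a x z * φ z) (volume.prod volume) := by
      refine ⟨hm.aestronglyMeasurable, ?_⟩
      rw [HasFiniteIntegral, lintegral_prod_symm _ hm.enorm.aemeasurable]
      exact lt_top_iff_ne_top.2 hx
    exact integral_prod_symm _ hint
  rw [lintegral_congr_ae (hI.mono fun x hx => by rw [hx])]
  refine (lintegral_enorm_integral_sq_le hΦm2 hΦV hVVfin).trans ?_
  have hgood2 : ∀ᵐ q : X × X ∂(volume.prod volume), good q.1 ∧ good q.2 :=
    (Measure.quasiMeasurePreserving_fst.ae hgood).and (Measure.quasiMeasurePreserving_snd.ae hgood)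
  have hfib : ∀ t, MeasurableSet (fibre E t) := fun t =>
    hE.preimage (measurable_id.prodMk measurable_const)
  calc _ ≤ ∫⁻ q : X × X, min (c₂ * (volume (fibre E q.1) ^ (1 / 2 : ℝ) *
          volume (fibre E q.2) ^ (1 / 2 : ℝ)))
          (c₃ q.1 q.2 * (volume (fibre E q.1) * volume (fibre E q.2))) ∂(volume.prod volume) := by
        refine lintegral_mono_ae ?_
        filter_upwards [hgood2] with q hq
        have hfin : ∫⁻ x, (∫⁻ y, ‖a x (y, q.1) * φ (y, q.1)‖ₑ) *
            (∫⁻ y, ‖a x (y, q.2) * φ (y, q.2)‖ₑ) ≠ ⊤ :=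
          ne_top_of_le_ne_top (ENNReal.mul_ne_top (by norm_num) hQfin) (hVV q.1 q.2)
        have e := integral_conj_mul_eq_integral_compAdj (hmt q.1) (hmt q.2) (hφt q.1) (hφt q.2) hfin
        simp only [hΦ]
        rw [e]
        refine (enorm_integral_le_lintegral_enorm _).trans ?_
        simp only [enorm_mul, RCLike.enorm_conj]
        exact (H q.1 q.2 hq.1 hq.2).lintegral_mul_compAdj_le hD hc₂ (hc₃ _ _) (hmt q.1) (hmt q.2)
          (hfib q.1) (hfib q.2) (hφt q.1) (hφt q.2) (fun y => hφ1 _) (fun y => hφ1 _)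
          (fun y hy => hφ0 _ hy) (fun y hy => hφ0 _ hy) (R := R) (fun y hy => hER _ hy)
    _ ≤ fibreEnergy c₂ c₃ E := lintegral_prod_le _

/-- Exhaustion of the support: the bound passes to increasing unions by Fatou's lemma. -/
theorem lintegral_sq_le_of_exhaustion (ha : Measurable (Function.uncurry a)) (hφ : Measurable φ)
    (hint : ∀ x, Integrable fun z => a x z * φ z) {S : ℕ → Set (Y × X)}
    (hS : ∀ n, MeasurableSet (S n)) (hmono : Monotone S)
    (hunion : ∀ᵐ z, φ z ≠ 0 → ∃ n, z ∈ S n) {c : ℝ≥0∞}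
    (hbd : ∀ n, ∫⁻ x, ‖∫ z, a x z * (S n).indicator φ z‖ₑ ^ 2 ≤ c) :
    ∫⁻ x, ‖∫ z, a x z * φ z‖ₑ ^ 2 ≤ c := by
  have hlim : ∀ x, Tendsto (fun n => ∫ z, a x z * (S n).indicator φ z) atTop
      (𝓝 (∫ z, a x z * φ z)) := by
    intro x
    refine tendsto_integral_of_dominated_convergence (fun z => ‖a x z * φ z‖) (fun n => ?_)
      (hint x).norm (fun n => ae_of_all _ fun z => ?_) ?_
    · exact ((ha.comp (measurable_const.prodMk measurable_id)).mul
        (hφ.indicator (hS n))).aestronglyMeasurable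
    · rw [norm_mul, norm_mul]
      gcongr
      exact norm_indicator_le_norm_self _ _
    · filter_upwards [hunion] with z hz
      refine tendsto_const_nhds.congr' ?_
      by_cases h : φ z = 0
      · exact Eventually.of_forall fun n => by simp [Set.indicator, h]
      · obtain ⟨n, hn⟩ := hz h
        filter_upwards [eventually_ge_atTop n] with m hm
        rw [Set.indicator_of_mem (hmono hm hn)]
  have hm : ∀ n, Measurable fun x => ‖∫ z, a x z * (S n).indicator φ z‖ₑ ^ 2 := fun n =>
    ((StronglyMeasurable.integral_prod_right' (ν := volume)
      (f := fun q : Y × (Y × X) => a q.1 q.2 * (S n).indicator φ q.2)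
      (ha.mul ((hφ.indicator (hS n)).comp
        measurable_snd)).stronglyMeasurable).measurable.enorm).pow_const 2
  calc _ = ∫⁻ x, liminf (fun n => ‖∫ z, a x z * (S n).indicator φ z‖ₑ ^ 2) atTop := by
        refine lintegral_congr fun x => ?_
        exact (((ENNReal.continuous_pow 2).tendsto _).comp (hlim x).enorm).liminf_eq.symm
    _ ≤ liminf (fun n => ∫⁻ x, ‖∫ z, a x z * (S n).indicator φ z‖ₑ ^ 2) atTop :=
        lintegral_liminf_le hm
    _ ≤ c := liminf_le_of_le (by isBoundedDefault) fun b hb => by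
        obtain ⟨n, hn⟩ := hb.exists
        exact hn.trans (hbd n)

/-- Absolute convergence of the double integral over all functions supported in `B R` at once: it is
tested on a single test function which dominates the indicator function of `B R`. -/
theorem PairBounds.ae_lintegral_lt_top {c₂ c₃ : ℝ≥0∞} {a b : Y → Y → ℂ}
    (H : PairBounds D c₂ c₃ a b) (hD : Approximating D B)
    (hb : Measurable (Function.uncurry b)) (R : ℕ) :
    ∀ᵐ y, ∫⁻ x, ‖a x y‖ₑ * ∫⁻ z in B R, ‖b x z‖ₑ < ⊤ := by
  obtain ⟨u, h, hh, hu, hle, hlim⟩ := hD.approx R ((B R).indicator fun _ => 1)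
    (measurable_const.indicator (hD.measurableSet R))
    (fun y => (norm_indicator_le_norm_self _ _).trans (by simp))
    (fun y hy => Set.indicator_of_notMem hy _)
  -- the dominating test function is at least `1` on `B R`
  have hone : ∀ᵐ z : Y, z ∈ B R → 1 ≤ ‖h z‖ₑ := by
    filter_upwards [hlim] with z hz hzR
    rw [Set.indicator_of_mem hzR] at hz
    have := le_of_tendsto hz.norm (Eventually.of_forall fun n => hle n z)
    rw [← enorm_one (G := ℂ)]
    exact enorm_le_iff_norm_le.2 this
  filter_upwards [H.converges h hh] with y hy
  have hy2 := hy.2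
  have hm : AEMeasurable (fun w : Y × Y => ‖conj (a w.1 y) * b w.1 w.2 * h w.2‖ₑ)
    (volume.prod volume) := hy.1.enorm
  rw [HasFiniteIntegral] at hy2
  have e : ∫⁻ w : Y × Y, ‖conj (a w.1 y) * b w.1 w.2 * h w.2‖ₑ
      = ∫⁻ x, ∫⁻ z, ‖conj (a x y) * b x z * h z‖ₑ := lintegral_prod _ hm
  rw [e] at hy2
  refine lt_of_le_of_lt (lintegral_mono fun x => ?_) hy2
  have hbx : Measurable fun z => b x z := hb.comp (measurable_const.prodMk measurable_id)
  rw [← lintegral_const_mul _ hbx.enorm, ← lintegral_indicator (hD.measurableSet R)]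
  refine lintegral_mono_ae ?_
  filter_upwards [hone] with z hz
  by_cases hzR : z ∈ B R
  · rw [Set.indicator_of_mem hzR, enorm_mul, enorm_mul, RCLike.enorm_conj]
    exact le_mul_of_one_le_right zero_le (hz hzR)
  · rw [Set.indicator_of_notMem hzR]; exact zero_le

/-- The `T^* T` expansion in the last variable, for bounded functions on sets of finite measure. -/
theorem lintegral_sq_le_fibreEnergy (hD : Approximating D B) (hc₂ : c₂ ≠ ⊤)
    (hc₃ : ∀ t u, c₃ t u ≠ ⊤) (ha : Measurable (Function.uncurry a))
    (hgood : ∀ᵐ t, good t)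
    (H : ∀ t u, good t → good u →
      PairBounds D c₂ (c₃ t u) (fun x y => a x (y, t)) (fun x y => a x (y, u)))
    (hE : MeasurableSet E) (hφ : Measurable φ) (hφ1 : ∀ z, ‖φ z‖ ≤ 1) (hφ0 : ∀ z ∉ E, φ z = 0)
    (hint : ∀ x, Integrable fun z => a x z * φ z) :
    ∫⁻ x, ‖∫ z, a x z * φ z‖ₑ ^ 2 ≤ fibreEnergy c₂ c₃ E := by
  have hind : ∀ {S : Set (Y × X)} {φ : Y × X → ℂ}, (∀ z, ‖φ z‖ ≤ 1) →
      ∀ z, ‖S.indicator φ z‖ ≤ 1 := fun h z => (norm_indicator_le_norm_self _ _).trans (h z)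
  have hindint : ∀ {S : Set (Y × X)} {φ : Y × X → ℂ}, MeasurableSet S →
      (∀ x, Integrable fun z => a x z * φ z) →
      ∀ x, Integrable fun z => a x z * S.indicator φ z := fun {S φ} hS h x => by
    refine ((h x).indicator hS).congr (ae_of_all _ fun z => ?_)
    by_cases hz : z ∈ S <;> simp [hz]
  have hSR : ∀ R, MeasurableSet (B R ×ˢ (Set.univ : Set X)) := fun R =>
    (hD.measurableSet R).prod MeasurableSet.univ
  -- first exhaust `Y` by the sets `B R`, so that absolute convergence can be tested on `B R`
  refine lintegral_sq_le_of_exhaustion ha hφ hint (S := fun R => B R ×ˢ Set.univ) hSR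
    (fun m n h => Set.prod_mono_left (hD.mono h)) (ae_of_all _ fun z _ => ?_) fun R => ?_
  · obtain ⟨n, hn⟩ := Set.mem_iUnion.1 (hD.iUnion.symm ▸ Set.mem_univ z.1)
    exact ⟨n, hn, trivial⟩
  set φR := (B R ×ˢ (Set.univ : Set X)).indicator φ with hφR
  set g : Y × X → ℝ≥0∞ := fun z => ∫⁻ x, ‖a x z‖ₑ * ∫⁻ y in B R, ‖a x (y, z.2)‖ₑ with hg
  have hgm : Measurable g := by
    have h1 : Measurable fun r : (Y × X) × Y => ‖a r.2 r.1‖ₑ :=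
      (ha.comp (measurable_snd.prodMk measurable_fst)).enorm
    have h2 : Measurable fun r : ((Y × X) × Y) × Y => ‖a r.1.2 (r.2, r.1.1.2)‖ₑ :=
      (ha.comp (measurable_fst.snd.prodMk (measurable_snd.prodMk measurable_fst.fst.snd))).enorm
    exact (h1.mul (h2.lintegral_prod_right' (ν := volume.restrict (B R)))).lintegral_prod_right'
  -- then exhaust by the sets on which the absolute integrals are uniformly bounded
  set S : ℕ → Set (Y × X) := fun N =>
    {z | g z ≤ N} ∩ (Set.univ ×ˢ spanningSets (volume : Measure X) N) with hS
  have hSm : ∀ N, MeasurableSet (S N) := fun N => (hgm measurableSet_Iic).inter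
    (MeasurableSet.univ.prod (measurableSet_spanningSets volume N))
  refine lintegral_sq_le_of_exhaustion ha (hφ.indicator (hSR R)) (hindint (hSR R) hint) (S := S) hSm
    (fun m n h => Set.inter_subset_inter (fun z (hz : g z ≤ m) => hz.trans (by exact_mod_cast h))
      (Set.prod_mono_right (monotone_spanningSets volume h))) ?_ fun N => ?_
  · have hfin : ∀ᵐ z : Y × X ∂(volume.prod volume), g z < ⊤ := by
      have hae : ∀ᵐ t : X, ∀ᵐ y : Y, g (y, t) < ⊤ := by
        filter_upwards [hgood] with t ht
        have hmt : Measurable (Function.uncurry fun x y => a x (y, t)) :=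
          ha.comp (measurable_fst.prodMk (measurable_snd.prodMk measurable_const))
        exact (H t t ht ht).ae_lintegral_lt_top hD hmt R
      have h1 : ∀ᵐ q : X × Y ∂(volume.prod volume), g (q.2, q.1) < ⊤ := by
        refine (Measure.ae_prod_iff_ae_ae ?_).2 hae
        exact (hgm.comp measurable_swap) measurableSet_Iio
      have := (Measure.measurePreserving_swap (μ := (volume : Measure Y))
        (ν := (volume : Measure X))).quasiMeasurePreserving.ae h1
      exact this
    have hfin' : ∀ᵐ z : Y × X, g z < ⊤ := hfin
    filter_upwards [hfin'] with z hz _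
    obtain ⟨n, hn⟩ := ENNReal.exists_nat_gt hz.ne
    obtain ⟨m, hm⟩ := Set.mem_iUnion.1
      ((iUnion_spanningSets (volume : Measure X)).symm ▸ Set.mem_univ z.2)
    refine ⟨max n m, hn.le.trans (by exact_mod_cast le_max_left n m), trivial, ?_⟩
    exact monotone_spanningSets volume (le_max_right n m) hm
  · refine (lintegral_sq_le_fibreEnergy_of_bounded (φ := (S N).indicator φR)
      (E := E ∩ (B R ×ˢ Set.univ) ∩ S N)
      hD hc₂ hc₃ ha hgood H ((hE.inter (hSR R)).inter (hSm N))
      ((hφ.indicator (hSR R)).indicator (hSm N))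
      (hind (hind hφ1)) (fun z hz => ?_) (R := R) (T := spanningSets (volume : Measure X) N)
      (N := N) (by simp) (measurableSet_spanningSets volume N)
      (measure_spanningSets_lt_top volume N).ne (fun z hz => hz.1.2.1) (fun z hz => hz.2.2.2)
      (fun z hz => hz.2.1)).trans
      (fibreEnergy_mono _ _ (Set.inter_subset_left.trans Set.inter_subset_left))
    by_cases h2 : z ∈ S N
    · rw [Set.indicator_of_mem h2, hφR]
      by_cases h3 : z ∈ B R ×ˢ (Set.univ : Set X)
      · rw [Set.indicator_of_mem h3]
        exact hφ0 z fun h => hz ⟨⟨h, h3⟩, h2⟩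
      · rw [Set.indicator_of_notMem h3]
    · rw [Set.indicator_of_notMem h2]

end Slice

/-! ### Dyadic pieces of the kernel -/

section Preliminaries

theorem min_le_rpow_mul_rpow {x y : ℝ≥0∞} {θ : ℝ} (hθ : 0 ≤ θ) (hθ1 : θ ≤ 1) :
    min x y ≤ x ^ (1 - θ) * y ^ θ := by
  calc min x y = min x y ^ (1 - θ) * min x y ^ θ := by
        rw [← ENNReal.rpow_add_of_nonneg _ _ (by linarith) hθ]; simp
    _ ≤ _ := mul_le_mul' (ENNReal.rpow_le_rpow (min_le_left _ _) (by linarith))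
        (ENNReal.rpow_le_rpow (min_le_right _ _) hθ)

theorem integrable_of_norm_le_one {Ω : Type} [MeasurableSpace Ω] {μ : Measure Ω} {φ : Ω → ℂ}
    {E : Set Ω} (hE : MeasurableSet E) (hEfin : μ E ≠ ⊤) (hφ : Measurable φ)
    (h1 : ∀ y, ‖φ y‖ ≤ 1) (h0 : ∀ y ∉ E, φ y = 0) : Integrable φ μ := by
  rw [← memLp_one_iff_integrable]
  refine ⟨hφ.aestronglyMeasurable, ?_⟩
  refine (eLpNorm_le_measure_rpow hE h1 h0 (by norm_num) (by norm_num)).trans_lt ?_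
  simpa using hEfin.lt_top

variable {Y X : Type} [MeasureSpace Y] [MeasureSpace X] [SigmaFinite (volume : Measure Y)]

theorem measurable_volume_fibre {E : Set (Y × X)} (hE : MeasurableSet E) :
    Measurable fun t => volume (fibre E t) :=
  measurable_measure_prodMk_right hE

theorem lintegral_volume_fibre [SigmaFinite (volume : Measure X)] {E : Set (Y × X)}
    (hE : MeasurableSet E) :
    ∫⁻ t, volume (fibre E t) = volume E :=
  (Measure.prod_apply_symm hE).symm

end Preliminaries

section Kernel

variable {Y X : Type} [MeasureSpace Y] [NormedAddCommGroup X] [MeasureSpace X]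

/-- The hypotheses on the kernel in the form used below: `K` is measurable, it decays in the last
variable, and the bounds on the fibres hold for almost all values of the last variables. The
relation `good` excludes the fibres on which `K`, as a measurable version of the original kernel,
differs from it on a set of positive measure. -/
structure FibredKernel (D : Set (Y → ℂ)) (k C₂ C₃ C₄ : ℝ) (K : Y × X → Y × X → ℂ) : Prop where
  measurable : Measurable (Function.uncurry K)
  decay : ∀ x y, ‖K x y‖ ≤ C₄ * (1 + ‖y.2 - x.2‖) ^ (-k)
  pairBounds : ∃ good : X → X → Prop, (∀ᵐ s, ∀ᵐ t, good s t) ∧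
    ∀ s t u, good s t → good s u → PairBounds D (ENNReal.ofReal (C₂ ^ 2))
      (ENNReal.ofReal (C₃ ^ 2 * (1 + ‖t - u‖) ^ (-k)))
      (fun x y => K (x, s) (y, t)) (fun x y => K (x, s) (y, u))

variable {D : Set (Y → ℂ)} {B : ℕ → Set Y} {k C₂ C₃ C₄ : ℝ} {K : Y × X → Y × X → ℂ}

theorem FibredKernel.norm_le (H : FibredKernel D k C₂ C₃ C₄ K) (hk : 0 < k) (hC₄ : 0 < C₄)
    (x y : Y × X) : ‖K x y‖ ≤ C₄ := by
  refine (H.decay x y).trans (mul_le_of_le_one_right hC₄.le ?_)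
  exact Real.rpow_le_one_of_one_le_of_nonpos (by linarith [norm_nonneg (y.2 - x.2)])
    (by linarith)

theorem FibredKernel.integrable_mul (H : FibredKernel D k C₂ C₃ C₄ K) (hk : 0 < k) (hC₄ : 0 < C₄)
    (x : Y × X) {f : Y × X → ℂ} (hf : Integrable f) : Integrable fun y => K x y * f y :=
  hf.bdd_mul (c := C₄) (H.measurable.comp (measurable_const.prodMk
    measurable_id)).aestronglyMeasurable (ae_of_all _ fun y => H.norm_le hk hC₄ x y)

variable [BorelSpace X] [SecondCountableTopology X]

theorem measurableSet_mem_band {Ω : Type} [MeasurableSpace Ω] {f g : Ω → X} (hf : Measurable f)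
    (hg : Measurable g) (j : ℤ) : MeasurableSet {x | g x ∈ band (f x) j} := by
  have h1 : Measurable fun z : X × X => 1 + ‖z.2 - z.1‖ := (by fun_prop : Continuous _).measurable
  exact (measurable_dyadicScale.comp (h1.comp (hf.prodMk hg))) (measurableSet_singleton j)

variable [SigmaFinite (volume : Measure Y)] [SigmaFinite (volume : Measure X)]

theorem lintegral_volume_inter_band_le (hX : LinearGrowth X) {E : Set (Y × X)} (j : ℤ) :
    ∫⁻ s : X, volume (E ∩ {z | z.2 ∈ band s j}) ≤ ENNReal.ofReal (4 * 2 ^ (j : ℝ)) * volume E := by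
  have hset : MeasurableSet {q : X × (Y × X) | q.2.2 ∈ band q.1 j} :=
    measurableSet_mem_band measurable_fst measurable_snd.snd j
  have hS : ∀ s, MeasurableSet {z : Y × X | z.2 ∈ band s j} := fun s =>
    measurableSet_mem_band measurable_const measurable_snd j
  calc ∫⁻ s : X, volume (E ∩ {z | z.2 ∈ band s j})
      = ∫⁻ s : X, ∫⁻ z in E, {q : X × (Y × X) | q.2.2 ∈ band q.1 j}.indicator 1 (s, z) := by
        refine lintegral_congr fun s => ?_
        rw [Set.inter_comm, ← Measure.restrict_apply (hS s), ← lintegral_indicator_one (hS s)]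
        rfl
    _ = ∫⁻ z in E, ∫⁻ s : X, {q : X × (Y × X) | q.2.2 ∈ band q.1 j}.indicator 1 (s, z) := by
        refine lintegral_lintegral_swap ?_
        exact (measurable_one.indicator hset).aemeasurable
    _ ≤ ∫⁻ z in E, ENNReal.ofReal (4 * 2 ^ (j : ℝ)) := by
        refine lintegral_mono fun z => ?_
        refine le_trans (le_of_eq ?_) (volume_band_le hX z.2 j)
        have hb : MeasurableSet (band z.2 j) :=
          measurableSet_mem_band measurable_const measurable_id j
        rw [← lintegral_indicator_one hb]
        refine lintegral_congr fun s => ?_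
        by_cases hs : s ∈ band z.2 j
        · have : (s, z) ∈ {q : X × (Y × X) | q.2.2 ∈ band q.1 j} := mem_band_comm.1 hs
          rw [Set.indicator_of_mem hs, Set.indicator_of_mem this]; rfl
        · have : (s, z) ∉ {q : X × (Y × X) | q.2.2 ∈ band q.1 j} := fun h =>
            hs (mem_band_comm.1 h)
          rw [Set.indicator_of_notMem hs, Set.indicator_of_notMem this]
    _ = _ := setLIntegral_const _ _

/-- The Stein–Tomas argument for functions bounded by the indicator function of `E`: the two bounds
on the fibres are combined with the weights `1 - θ` and `θ`, and the integration in the last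
variables is the Hardy–Littlewood–Sobolev inequality. -/
theorem exists_fibreEnergy_le {k θ : ℝ} (hk : 0 < k) (hθ : 1 / (k + 1) ≤ θ) (hθ1 : θ ≤ 1) :
    ∃ C : ℝ, 0 < C ∧ ∀ (Y X : Type) [MeasureSpace Y] [SigmaFinite (volume : Measure Y)]
      [NormedAddCommGroup X] [MeasureSpace X] [BorelSpace X] [SecondCountableTopology X]
      [SigmaFinite (volume : Measure X)], LinearGrowth X → ∀ (C₂ C₃ : ℝ), 0 < C₂ → 0 < C₃ →
      ∀ E : Set (Y × X), MeasurableSet E →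
      fibreEnergy (ENNReal.ofReal (C₂ ^ 2))
        (fun t u => ENNReal.ofReal (C₃ ^ 2 * (1 + ‖t - u‖) ^ (-k))) E
        ≤ ENNReal.ofReal (C * (C₂ ^ (1 - θ) * C₃ ^ θ) ^ 2) * volume E ^ (1 + θ) := by
  have hθ0 : 0 < θ := lt_of_lt_of_le (by positivity) hθ
  have hkθ : 1 - θ ≤ k * θ := by
    rw [div_le_iff₀ (by linarith)] at hθ; linarith
  obtain ⟨C, hC, h⟩ := exists_hardyLittlewoodSobolev hθ0 hθ1
  refine ⟨C, hC, fun Y X _ _ _ _ _ _ _ hX C₂ C₃ hC₂ hC₃ E hE => ?_⟩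
  set m : X → ℝ≥0∞ := fun t => volume (fibre E t) with hm
  have hmm : Measurable m := measurable_volume_fibre hE
  set f : X → ℝ≥0∞ := fun t => m t ^ ((1 + θ) / 2) with hf
  set W : ℝ := (C₂ ^ (1 - θ) * C₃ ^ θ) ^ 2 with hW
  have hcst : ENNReal.ofReal (C₂ ^ 2) ^ (1 - θ) * ENNReal.ofReal (C₃ ^ 2) ^ θ
      = ENNReal.ofReal W := by
    rw [ENNReal.ofReal_rpow_of_nonneg (by positivity) (by linarith),
      ENNReal.ofReal_rpow_of_nonneg (by positivity) hθ0.le, ← ENNReal.ofReal_mul (by positivity),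
      hW, mul_pow, ← Real.rpow_natCast, ← Real.rpow_natCast, ← Real.rpow_natCast,
      ← Real.rpow_natCast, ← Real.rpow_mul hC₂.le, ← Real.rpow_mul hC₃.le, ← Real.rpow_mul hC₂.le,
      ← Real.rpow_mul hC₃.le]
    ring_nf
  have hpt : ∀ t u, min (ENNReal.ofReal (C₂ ^ 2) * (m t ^ (1 / 2 : ℝ) * m u ^ (1 / 2 : ℝ)))
      (ENNReal.ofReal (C₃ ^ 2 * (1 + ‖t - u‖) ^ (-k)) * (m t * m u))
      ≤ ENNReal.ofReal W * (ENNReal.ofReal ((1 + ‖u - t‖) ^ (-(1 - θ))) * (f t * f u)) := by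
    intro t u
    refine (min_le_rpow_mul_rpow hθ0.le hθ1).trans ?_
    have hn : 1 ≤ 1 + ‖t - u‖ := by linarith [norm_nonneg (t - u)]
    have e : ∀ x : ℝ≥0∞, (x ^ (1 / 2 : ℝ)) ^ (1 - θ) * x ^ θ = x ^ ((1 + θ) / 2) := fun x => by
      rw [← ENNReal.rpow_mul, ← ENNReal.rpow_add_of_nonneg _ _ (by nlinarith) hθ0.le]
      ring_nf
    have hdec : ENNReal.ofReal ((1 + ‖t - u‖) ^ (-k)) ^ θ
        ≤ ENNReal.ofReal ((1 + ‖u - t‖) ^ (-(1 - θ))) := by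
      rw [ENNReal.ofReal_rpow_of_nonneg (by positivity) hθ0.le, ← Real.rpow_mul (by positivity),
        norm_sub_rev u t]
      exact ENNReal.ofReal_le_ofReal (Real.rpow_le_rpow_of_exponent_le hn (by linarith))
    rw [ENNReal.ofReal_mul (by positivity)]
    rw [ENNReal.mul_rpow_of_nonneg _ _ (by linarith), ENNReal.mul_rpow_of_nonneg _ _ (by linarith),
      ENNReal.mul_rpow_of_nonneg _ _ hθ0.le, ENNReal.mul_rpow_of_nonneg _ _ hθ0.le,
      ENNReal.mul_rpow_of_nonneg _ _ hθ0.le]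
    calc _ = (ENNReal.ofReal (C₂ ^ 2) ^ (1 - θ) * ENNReal.ofReal (C₃ ^ 2) ^ θ) *
          (ENNReal.ofReal ((1 + ‖t - u‖) ^ (-k)) ^ θ *
            (((m t ^ (1 / 2 : ℝ)) ^ (1 - θ) * m t ^ θ) *
              ((m u ^ (1 / 2 : ℝ)) ^ (1 - θ) * m u ^ θ))) := by ring
      _ ≤ _ := by
          rw [hcst, e, e]
          gcongr
  have hfm : Measurable f := hmm.pow_const _
  calc _ ≤ ∫⁻ t, ∫⁻ u, ENNReal.ofReal W *
        (ENNReal.ofReal ((1 + ‖u - t‖) ^ (-(1 - θ))) * (f t * f u)) :=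
        lintegral_mono fun t => lintegral_mono fun u => hpt t u
    _ = ENNReal.ofReal W * ∫⁻ t, ∫⁻ u,
        ENNReal.ofReal ((1 + ‖u - t‖) ^ (-(1 - θ))) * (f t * f u) := by
        rw [← lintegral_const_mul' _ _ ENNReal.ofReal_ne_top]
        refine lintegral_congr fun t => ?_
        rw [← lintegral_const_mul' _ _ ENNReal.ofReal_ne_top]
    _ ≤ ENNReal.ofReal W * (ENNReal.ofReal C * (∫⁻ t, f t ^ (2 / (1 + θ))) ^ (1 + θ)) := by
        gcongr
        exact h X hX f hfm
    _ = _ := by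
        have e : ∀ t, f t ^ (2 / (1 + θ)) = m t := fun t => by
          simp only [hf]
          rw [← ENNReal.rpow_mul]
          have : (1 + θ) / 2 * (2 / (1 + θ)) = 1 := by field_simp
          rw [this, ENNReal.rpow_one]
        simp_rw [e]
        rw [hm, lintegral_volume_fibre hE, ← mul_assoc, ← ENNReal.ofReal_mul (by positivity),
          mul_comm W]

/-- The `L²` bound for the part of the operator with `|x_d - y_d|` of size about `2 ^ j`. The
factor `2 ^ (j / 2)` comes from the integration over `x_d`. -/
theorem exists_lintegral_band_sq_le {k θ : ℝ} (hk : 0 < k) (hθ : 1 / (k + 1) ≤ θ) (hθ1 : θ ≤ 1) :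
    ∃ C : ℝ, 0 < C ∧ ∀ (Y X : Type) [MeasureSpace Y] [SigmaFinite (volume : Measure Y)]
      [NormedAddCommGroup X] [MeasureSpace X] [BorelSpace X] [SecondCountableTopology X]
      [SigmaFinite (volume : Measure X)], LinearGrowth X →
      ∀ (D : Set (Y → ℂ)) (B : ℕ → Set Y), Approximating D B →
      ∀ (C₂ C₃ C₄ : ℝ), 0 < C₂ → 0 < C₃ → 0 < C₄ →
      ∀ K : Y × X → Y × X → ℂ, FibredKernel D k C₂ C₃ C₄ K →
      ∀ (j : ℤ) (E : Set (Y × X)) (φ : Y × X → ℂ), MeasurableSet E → volume E ≠ ⊤ →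
      Measurable φ → (∀ z, ‖φ z‖ ≤ 1) → (∀ z ∉ E, φ z = 0) →
      ∫⁻ x : Y × X, ‖∫ y, K x y * {z : Y × X | z.2 ∈ band x.2 j}.indicator φ y‖ₑ ^ 2
        ≤ ENNReal.ofReal (C * (C₂ ^ (1 - θ) * C₃ ^ θ) ^ 2 * 2 ^ (j : ℝ) *
          (volume : Measure (Y × X)).real E ^ (1 + θ)) := by
  have hθ0 : 0 < θ := lt_of_lt_of_le (by positivity) hθ
  obtain ⟨C, hC, h⟩ := exists_fibreEnergy_le hk hθ hθ1
  refine ⟨4 * C, by positivity, ?_⟩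
  intro Y X _ _ _ _ _ _ _ hX D B hD C₂ C₃ C₄ hC₂ hC₃ hC₄ K H j E φ hE hEfin hφ hφ1 hφ0
  set W : ℝ := C * (C₂ ^ (1 - θ) * C₃ ^ θ) ^ 2 with hW
  set S : X → Set (Y × X) := fun s => {z | z.2 ∈ band s j} with hS
  have hSm : ∀ s, MeasurableSet (S s) := fun s =>
    measurableSet_mem_band measurable_const measurable_snd j
  have hφi : Integrable φ := integrable_of_norm_le_one hE hEfin hφ hφ1 hφ0
  obtain ⟨good, hgood, hpair⟩ := H.pairBounds
  have hSjm : MeasurableSet {q : (Y × X) × (Y × X) | q.2 ∈ S q.1.2} :=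
    measurableSet_mem_band measurable_fst.snd measurable_snd.snd j
  have hmeas : Measurable fun x : Y × X => ‖∫ y, K x y * (S x.2).indicator φ y‖ₑ ^ 2 := by
    have h1 : Measurable fun q : (Y × X) × (Y × X) => K q.1 q.2 * (S q.1.2).indicator φ q.2 := by
      refine H.measurable.mul ?_
      exact (hφ.comp measurable_snd).indicator hSjm
    exact (h1.stronglyMeasurable.integral_prod_right' (ν := volume)).measurable.enorm.pow_const 2
  have hslice : ∀ᵐ s : X, ∫⁻ x' : Y, ‖∫ y, K (x', s) y * (S s).indicator φ y‖ₑ ^ 2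
      ≤ ENNReal.ofReal W * (volume E ^ θ * volume (E ∩ S s)) := by
    filter_upwards [hgood] with s hs
    have ha : Measurable (Function.uncurry fun x' y => K (x', s) y) :=
      H.measurable.comp ((measurable_fst.prodMk measurable_const).prodMk measurable_snd)
    have h1 := lintegral_sq_le_fibreEnergy (a := fun x' y => K (x', s) y) (E := E ∩ S s)
      (φ := (S s).indicator φ) hD
      ENNReal.ofReal_ne_top (fun t u => ENNReal.ofReal_ne_top) ha hs
      (fun t u ht hu => hpair s t u ht hu) (hE.inter (hSm s)) (hφ.indicator (hSm s))
      (fun z => (norm_indicator_le_norm_self _ _).trans (hφ1 z))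
      (fun z hz => by
        by_cases hzS : z ∈ S s
        · rw [Set.indicator_of_mem hzS]; exact hφ0 z fun hzE => hz ⟨hzE, hzS⟩
        · exact Set.indicator_of_notMem hzS _)
      (fun x => H.integrable_mul hk hC₄ _ (hφi.indicator (hSm s)))
    refine h1.trans ((h Y X hX C₂ C₃ hC₂ hC₃ _ (hE.inter (hSm s))).trans ?_)
    gcongr
    rw [add_comm, ENNReal.rpow_add_of_nonneg _ _ hθ0.le (by norm_num), ENNReal.rpow_one]
    gcongr
    exact Set.inter_subset_left
  calc _ = ∫⁻ s : X, ∫⁻ x' : Y, ‖∫ y, K (x', s) y * (S s).indicator φ y‖ₑ ^ 2 :=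
        lintegral_prod_symm _ hmeas.aemeasurable
    _ ≤ ∫⁻ s : X, ENNReal.ofReal W * (volume E ^ θ * volume (E ∩ S s)) := lintegral_mono_ae hslice
    _ = ENNReal.ofReal W * (volume E ^ θ * ∫⁻ s : X, volume (E ∩ S s)) := by
        rw [lintegral_const_mul' _ _ ENNReal.ofReal_ne_top,
          lintegral_const_mul' _ _ (ENNReal.rpow_ne_top_of_nonneg hθ0.le hEfin)]
    _ ≤ ENNReal.ofReal W * (volume E ^ θ * (ENNReal.ofReal (4 * 2 ^ (j : ℝ)) * volume E)) := by
        gcongr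
        exact lintegral_volume_inter_band_le hX j
    _ = _ := by
        rw [← ofReal_measureReal hEfin, ENNReal.ofReal_rpow_of_nonneg measureReal_nonneg hθ0.le,
          ← ENNReal.ofReal_mul (by positivity), ← ENNReal.ofReal_mul (by positivity),
          ← ENNReal.ofReal_mul (by positivity), Real.rpow_add_of_nonneg measureReal_nonneg
          (by norm_num) hθ0.le, Real.rpow_one]
        congr 1
        rw [hW]; ring

end Kernel

/-! ### Restricted and strong type bounds for the bilinear form -/

section Forms

theorem enorm_integral_le_tsum {Ω ι : Type} [Countable ι] [MeasurableSpace Ω] {μ : Measure Ω}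
    {h : Ω → ℂ} (hh : Integrable h μ) {s : ι → Set Ω} (hs : ∀ i, MeasurableSet (s i))
    (hd : Pairwise (Function.onFun Disjoint s)) (h0 : ∀ x, h x ≠ 0 → x ∈ ⋃ i, s i) :
    ‖∫ x, h x ∂μ‖ₑ ≤ ∑' i, ‖∫ x in s i, h x ∂μ‖ₑ := by
  have e : ∫ x, h x ∂μ = ∑' i, ∫ x in s i, h x ∂μ := by
    rw [(hasSum_integral_iUnion hs hd hh.integrableOn).tsum_eq,
      setIntegral_eq_integral_of_forall_compl_eq_zero]
    intro x hx
    by_contra hne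
    exact hx (h0 x hne)
  rw [e]
  exact enorm_tsum_le_tsum_enorm

/-- On its level set, `f` is `2 ^ (m + 1)` times a function bounded by `1`. -/
theorem norm_inv_mul_indicator_levelSet_le {Ω : Type} (f : Ω → ℂ) (m : ℤ) (x : Ω) :
    ‖(((2 : ℝ) ^ ((m : ℝ) + 1) : ℝ) : ℂ)⁻¹ * (levelSet (fun x => ‖f x‖ₑ) m).indicator f x‖ ≤ 1 := by
  by_cases hx : x ∈ levelSet (fun x => ‖f x‖ₑ) m
  · have h1 := le_two_rpow_of_mem_levelSet hx
    simp only [← ofReal_norm] at h1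
    rw [ENNReal.ofReal_le_ofReal_iff (by positivity)] at h1
    rw [Set.indicator_of_mem hx, norm_mul, norm_inv, Complex.norm_real,
      Real.norm_of_nonneg (by positivity), inv_mul_le_iff₀ (by positivity), mul_one]
    exact h1
  · simp [hx]

variable {P : Type} [MeasureSpace P]

/-- The bilinear form `∫ ψ (K φ)`. -/
noncomputable def form (K : P → P → ℂ) (φ ψ : P → ℂ) : ℂ :=
  ∫ z : P × P, ψ z.1 * (K z.1 z.2 * φ z.2) ∂(volume.prod volume)

/-- The restricted type bound `|∫ ψ (K φ)| ≤ M |E| ^ u |F| ^ v`, for all `φ` and `ψ` bounded by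
the indicator functions of `E` and `F`. -/
def RestrictedBound (K : P → P → ℂ) (M u v : ℝ) : Prop :=
  ∀ (φ ψ : P → ℂ) (E F : Set P), MeasurableSet E → MeasurableSet F → volume E ≠ ⊤ →
    volume F ≠ ⊤ → Measurable φ → Measurable ψ → (∀ z, ‖φ z‖ ≤ 1) → (∀ z, ‖ψ z‖ ≤ 1) →
    (∀ z ∉ E, φ z = 0) → (∀ z ∉ F, ψ z = 0) →
    ‖form K φ ψ‖ₑ ≤ ENNReal.ofReal
      (M * (volume : Measure P).real E ^ u * (volume : Measure P).real F ^ v)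

/-- The strong type bound `|∫ g (K f)| ≤ M ‖f‖_p ‖g‖_r`, on integrable functions. -/
def StrongBound (K : P → P → ℂ) (M p r : ℝ) : Prop :=
  ∀ f g : P → ℂ, Measurable f → Measurable g → Integrable f → Integrable g →
    ∫⁻ x, ‖f x‖ₑ ^ p ≠ ⊤ → ∫⁻ x, ‖g x‖ₑ ^ r ≠ ⊤ →
    ‖form K f g‖ₑ ≤ ENNReal.ofReal M *
      ((∫⁻ x, ‖f x‖ₑ ^ p) ^ (1 / p) * (∫⁻ x, ‖g x‖ₑ ^ r) ^ (1 / r))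

theorem form_const_mul (K : P → P → ℂ) (φ ψ : P → ℂ) (c d : ℂ) :
    form K (fun x => c * φ x) (fun x => d * ψ x) = c * d * form K φ ψ := by
  rw [form, form, ← integral_const_mul]
  refine integral_congr_ae (ae_of_all _ fun z => ?_)
  simp only
  ring

theorem integrable_form_integrand {K : P → P → ℂ} {c : ℝ}
    (hK : Measurable (Function.uncurry K)) (hc : ∀ x y, ‖K x y‖ ≤ c) [SFinite (volume : Measure P)]
    {f g : P → ℂ} (hf : Integrable f) (hg : Integrable g) :
    Integrable (fun z : P × P => g z.1 * (K z.1 z.2 * f z.2)) (volume.prod volume) := by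
  have h1 : Integrable (fun z : P × P => g z.1 * f z.2) (volume.prod volume) := hg.mul_prod hf
  refine (h1.bdd_mul (c := c) hK.aestronglyMeasurable
    (ae_of_all _ fun z => hc z.1 z.2)).congr (ae_of_all _ fun z => ?_)
  simp only [Function.uncurry]
  ring

theorem lintegral_enorm_le_measure {φ : P → ℂ} {E : Set P} (hE : MeasurableSet E)
    (h1 : ∀ y, ‖φ y‖ ≤ 1) (h0 : ∀ y ∉ E, φ y = 0) : ∫⁻ y, ‖φ y‖ₑ ≤ volume E := by
  rw [← eLpNorm_one_eq_lintegral_enorm]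
  simpa using eLpNorm_le_measure_rpow (μ := volume) (p := 1) hE h1 h0 (by norm_num) (by norm_num)

variable [SigmaFinite (volume : Measure P)]

theorem restrictedBound_of_norm_le {K : P → P → ℂ} {c : ℝ} (hc0 : 0 ≤ c)
    (hc : ∀ x y, ‖K x y‖ ≤ c) : RestrictedBound K c 1 1 := by
  intro φ ψ E F hE hF hEfin hFfin hφ hψ hφ1 hψ1 hφ0 hψ0
  calc ‖form K φ ψ‖ₑ
      ≤ ∫⁻ z : P × P, ENNReal.ofReal c * (‖ψ z.1‖ₑ * ‖φ z.2‖ₑ) ∂(volume.prod volume) := by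
        refine (enorm_integral_le_lintegral_enorm _).trans (lintegral_mono fun z => ?_)
        rw [enorm_mul, enorm_mul, mul_left_comm]
        gcongr
        rw [← ofReal_norm]
        exact ENNReal.ofReal_le_ofReal (hc _ _)
    _ = ENNReal.ofReal c * ((∫⁻ x, ‖ψ x‖ₑ) * ∫⁻ x, ‖φ x‖ₑ) := by
        rw [lintegral_const_mul' _ _ ENNReal.ofReal_ne_top,
          lintegral_prod_mul hψ.enorm.aemeasurable hφ.enorm.aemeasurable]
    _ ≤ ENNReal.ofReal c * (volume F * volume E) := by
        gcongr
        · exact lintegral_enorm_le_measure hF hψ1 hψ0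
        · exact lintegral_enorm_le_measure hE hφ1 hφ0
    _ = _ := by
        rw [← ofReal_measureReal hEfin, ← ofReal_measureReal hFfin,
          ← ENNReal.ofReal_mul (by positivity), ← ENNReal.ofReal_mul (by positivity),
          Real.rpow_one, Real.rpow_one]
        ring_nf

theorem strongBound_of_norm_le {K : P → P → ℂ} {c : ℝ} (hc : ∀ x y, ‖K x y‖ ≤ c) :
    StrongBound K c 1 1 := by
  intro f g hf hg _ _ _ _
  calc ‖form K f g‖ₑ
      ≤ ∫⁻ z : P × P, ENNReal.ofReal c * (‖g z.1‖ₑ * ‖f z.2‖ₑ) ∂(volume.prod volume) := by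
        refine (enorm_integral_le_lintegral_enorm _).trans (lintegral_mono fun z => ?_)
        rw [enorm_mul, enorm_mul, mul_left_comm]
        gcongr
        rw [← ofReal_norm]
        exact ENNReal.ofReal_le_ofReal (hc _ _)
    _ = ENNReal.ofReal c * ((∫⁻ x, ‖g x‖ₑ) * ∫⁻ x, ‖f x‖ₑ) := by
        rw [lintegral_const_mul' _ _ ENNReal.ofReal_ne_top,
          lintegral_prod_mul hg.enorm.aemeasurable hf.enorm.aemeasurable]
    _ = _ := by
        simp only [ENNReal.rpow_one, div_one]
        rw [mul_comm (∫⁻ x, ‖g x‖ₑ)]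

omit [SigmaFinite (volume : Measure P)] in
/-- The geometric mean of two restricted type bounds is a restricted type bound. -/
theorem RestrictedBound.rpow_mul_rpow {K : P → P → ℂ} {A B u₀ v₀ u₁ v₁ s : ℝ} (hA : 0 ≤ A)
    (hB : 0 ≤ B) (hs : 0 ≤ s) (hs1 : s ≤ 1) (hu₀ : 0 ≤ u₀) (hu₁ : 0 ≤ u₁) (hv₀ : 0 ≤ v₀)
    (hv₁ : 0 ≤ v₁) (h₀ : RestrictedBound K A u₀ v₀) (h₁ : RestrictedBound K B u₁ v₁) :
    RestrictedBound K (A ^ (1 - s) * B ^ s) ((1 - s) * u₀ + s * u₁) ((1 - s) * v₀ + s * v₁) := by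
  intro φ ψ E F hE hF hEfin hFfin hφ hψ hφ1 hψ1 hφ0 hψ0
  have hs' : 0 ≤ 1 - s := by linarith
  refine (le_min (h₀ φ ψ E F hE hF hEfin hFfin hφ hψ hφ1 hψ1 hφ0 hψ0)
    (h₁ φ ψ E F hE hF hEfin hFfin hφ hψ hφ1 hψ1 hφ0 hψ0)).trans
    ((min_le_rpow_mul_rpow hs hs1).trans_eq ?_)
  rw [ENNReal.ofReal_rpow_of_nonneg (by positivity) hs',
    ENNReal.ofReal_rpow_of_nonneg (by positivity) hs, ← ENNReal.ofReal_mul (by positivity),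
    Real.mul_rpow (by positivity) (by positivity), Real.mul_rpow hA (by positivity),
    Real.mul_rpow (by positivity) (by positivity), Real.mul_rpow hB (by positivity),
    ← Real.rpow_mul measureReal_nonneg, ← Real.rpow_mul measureReal_nonneg,
    ← Real.rpow_mul measureReal_nonneg, ← Real.rpow_mul measureReal_nonneg,
    Real.rpow_add_of_nonneg measureReal_nonneg (by positivity) (by positivity),
    Real.rpow_add_of_nonneg measureReal_nonneg (by positivity) (by positivity),
    mul_comm u₀, mul_comm u₁, mul_comm v₀, mul_comm v₁]
  congr 1
  ring

/-- Two restricted type bounds imply the strong type bound at an intermediate point. -/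
theorem exists_strongBound {u₀ u₁ v₀ v₁ τ p r : ℝ} (hτ : 0 < τ) (hτ1 : τ < 1)
    (hu₀ : u₀ ∈ Set.Ioc (0 : ℝ) 1) (hu₁ : u₁ ∈ Set.Icc (0 : ℝ) 1) (hv₀ : v₀ ∈ Set.Ioc (0 : ℝ) 1)
    (hv₁ : v₁ ∈ Set.Icc (0 : ℝ) 1) (hp : 1 ≤ p) (hr : 1 ≤ r)
    (hpu : 1 / p = (1 - τ) * u₀ + τ * u₁) (hrv : 1 / r = (1 - τ) * v₀ + τ * v₁)
    (hpr : 1 ≤ 1 / p + 1 / r) (hv : v₀ ≠ v₁) (hu : p = 1 ∨ u₀ ≠ u₁) :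
    ∃ C : ℝ, 0 < C ∧ ∀ (P : Type) [MeasureSpace P] [SigmaFinite (volume : Measure P)]
      (K : P → P → ℂ) (c A B : ℝ), Measurable (Function.uncurry K) → (∀ x y, ‖K x y‖ ≤ c) →
      0 ≤ A → 0 ≤ B → RestrictedBound K A u₀ v₀ → RestrictedBound K B u₁ v₁ →
      StrongBound K (C * (A ^ (1 - τ) * B ^ τ)) p r := by
  obtain ⟨C, hC, h⟩ := exists_interpolation hτ hτ1 hu₀ hu₁ hv₀ hv₁ hp hr hpu hrv hpr hv hu
  refine ⟨C * 4, by positivity, ?_⟩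
  intro P _ _ K c A B hK hc hA hB hKA hKB f g hf hg hfi hgi hfp hgr
  have hp0 : 0 < p := by linarith
  have hr0 : 0 < r := by linarith
  set E : ℤ → Set P := levelSet fun x => ‖f x‖ₑ with hE
  set F : ℤ → Set P := levelSet fun x => ‖g x‖ₑ with hF
  have hEm : ∀ m, MeasurableSet (E m) := measurableSet_levelSet hf.enorm
  have hFm : ∀ m, MeasurableSet (F m) := measurableSet_levelSet hg.enorm
  have hEfin : ∀ m, volume (E m) ≠ ⊤ := fun m => (measure_levelSet_lt_top hf.enorm hp0 hfp m).ne
  have hFfin : ∀ m, volume (F m) ≠ ⊤ := fun m => (measure_levelSet_lt_top hg.enorm hr0 hgr m).ne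
  set Θ : P × P → ℂ := fun z => g z.1 * (K z.1 z.2 * f z.2) with hΘ
  have hΘi : Integrable Θ (volume.prod volume) := integrable_form_integrand hK hc hfi hgi
  have hpiece : ∀ m n, ‖∫ z in F n ×ˢ E m, Θ z ∂(volume.prod volume)‖ₑ
      ≤ ENNReal.ofReal ((2 : ℝ) ^ (m : ℝ) * 2 ^ (n : ℝ) *
        min (4 * A * volume.real (E m) ^ u₀ * volume.real (F n) ^ v₀)
          (4 * B * volume.real (E m) ^ u₁ * volume.real (F n) ^ v₁)) := by
    intro m n
    set a : ℝ := (2 : ℝ) ^ ((m : ℝ) + 1) with ha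
    set b : ℝ := (2 : ℝ) ^ ((n : ℝ) + 1) with hb
    have ha0 : 0 < a := by positivity
    have hb0 : 0 < b := by positivity
    set φ : P → ℂ := fun x => (a : ℂ)⁻¹ * (E m).indicator f x with hφ
    set ψ : P → ℂ := fun x => (b : ℂ)⁻¹ * (F n).indicator g x with hψ
    have e : ∫ z in F n ×ˢ E m, Θ z ∂(volume.prod volume) = a * b * form K φ ψ := by
      rw [← form_const_mul, form, ← integral_indicator ((hFm n).prod (hEm m))]
      refine integral_congr_ae (ae_of_all _ fun z => ?_)
      have ha' : (a : ℂ) ≠ 0 := by exact_mod_cast ha0.ne'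
      have hb' : (b : ℂ) ≠ 0 := by exact_mod_cast hb0.ne'
      simp only [hφ, hψ, mul_inv_cancel_left₀ ha', mul_inv_cancel_left₀ hb']
      by_cases h1 : z.1 ∈ F n
      · by_cases h2 : z.2 ∈ E m
        · rw [Set.indicator_of_mem (show z ∈ F n ×ˢ E m from ⟨h1, h2⟩), Set.indicator_of_mem h1,
            Set.indicator_of_mem h2]
        · rw [Set.indicator_of_notMem (fun h : z ∈ F n ×ˢ E m => h2 h.2),
            Set.indicator_of_notMem h2]
          simp
      · rw [Set.indicator_of_notMem (fun h : z ∈ F n ×ˢ E m => h1 h.1),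
          Set.indicator_of_notMem h1]
        simp
    have hφm : Measurable φ := (hf.indicator (hEm m)).const_mul _
    have hψm : Measurable ψ := (hg.indicator (hFm n)).const_mul _
    have hφ0 : ∀ z ∉ E m, φ z = 0 := fun z hz => by simp [hφ, hz]
    have hψ0 : ∀ z ∉ F n, ψ z = 0 := fun z hz => by simp [hψ, hz]
    have hmin := le_min
      (hKA φ ψ _ _ (hEm m) (hFm n) (hEfin m) (hFfin n) hφm hψm
        (norm_inv_mul_indicator_levelSet_le f m) (norm_inv_mul_indicator_levelSet_le g n) hφ0 hψ0)
      (hKB φ ψ _ _ (hEm m) (hFm n) (hEfin m) (hFfin n) hφm hψm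
        (norm_inv_mul_indicator_levelSet_le f m) (norm_inv_mul_indicator_levelSet_le g n) hφ0 hψ0)
    rw [← ENNReal.ofReal_min] at hmin
    have hab : ‖(a : ℂ) * b‖ₑ = ENNReal.ofReal (a * b) := by
      rw [← ofReal_norm, norm_mul, Complex.norm_real, Complex.norm_real,
        Real.norm_of_nonneg ha0.le, Real.norm_of_nonneg hb0.le]
    rw [e, enorm_mul, hab]
    refine (mul_le_mul_right hmin _).trans_eq ?_
    rw [← ENNReal.ofReal_mul (by positivity)]
    congr 1
    rw [ha, hb, Real.rpow_add (by norm_num), Real.rpow_add (by norm_num), Real.rpow_one,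
      mul_assoc (4 * A), mul_assoc (4 * B), mul_assoc 4 A, mul_assoc 4 B, mul_assoc A,
      mul_assoc B, ← mul_min_of_nonneg _ _ (show (0 : ℝ) ≤ 4 by norm_num)]
    ring
  have key := h P P volume volume _ _ (4 * A) (4 * B)
    (fun m n => ‖∫ z in F n ×ˢ E m, Θ z ∂(volume.prod volume)‖ₑ) hf.enorm hg.enorm hfp hgr
    (by positivity) (by positivity) hpiece
  have hsum : ‖form K f g‖ₑ
      ≤ ∑' q : ℤ × ℤ, ‖∫ z in F q.2 ×ˢ E q.1, Θ z ∂(volume.prod volume)‖ₑ := by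
    refine enorm_integral_le_tsum hΘi (fun q => (hFm q.2).prod (hEm q.1)) ?_ ?_
    · intro q q' hq
      rw [Function.onFun, Set.disjoint_prod]
      by_cases h2 : q.2 = q'.2
      · refine Or.inr (disjoint_levelSet fun h1 => hq (Prod.ext h1 h2))
      · exact Or.inl (disjoint_levelSet h2)
    · intro z hz
      refine Set.mem_iUnion.2 ⟨(dyadicScale (‖f z.2‖ₑ).toReal, dyadicScale (‖g z.1‖ₑ).toReal), ?_⟩
      have h1 : g z.1 ≠ 0 := left_ne_zero_of_mul hz
      have h2 : f z.2 ≠ 0 := right_ne_zero_of_mul (right_ne_zero_of_mul hz)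
      exact ⟨⟨by simpa using h1, by simp, rfl⟩, ⟨by simpa using h2, by simp, rfl⟩⟩
  refine hsum.trans (key.trans_eq ?_)
  congr 2
  rw [Real.mul_rpow (by norm_num) hA, Real.mul_rpow (by norm_num) hB, mul_mul_mul_comm,
    ← Real.rpow_add (by norm_num)]
  norm_num
  ring

end Forms

section Endpoint

/-- The restricted type bound at the endpoint: the sum over `j` of the minimum of the trivial bound
`2 ^ (-k j)` and of the `L²` bound `2 ^ (j / 2)`. -/
theorem exists_restrictedBound {k θ : ℝ} (hk : 0 < k) (hθ : 1 / (k + 1) ≤ θ) (hθ1 : θ ≤ 1) :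
    ∃ C : ℝ, 0 < C ∧ ∀ (Y X : Type) [MeasureSpace Y] [SigmaFinite (volume : Measure Y)]
      [NormedAddCommGroup X] [MeasureSpace X] [BorelSpace X] [SecondCountableTopology X]
      [SigmaFinite (volume : Measure X)], LinearGrowth X →
      ∀ (D : Set (Y → ℂ)) (B : ℕ → Set Y), Approximating D B →
      ∀ (C₂ C₃ C₄ : ℝ), 0 < C₂ → 0 < C₃ → 0 < C₄ →
      ∀ K : Y × X → Y × X → ℂ, FibredKernel D k C₂ C₃ C₄ K →
      RestrictedBound K
        (C * (C₄ ^ (1 - 2 * k / (2 * k + 1)) * (C₂ ^ (1 - θ) * C₃ ^ θ) ^ (2 * k / (2 * k + 1))))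
        (1 - k * (1 - θ) / (2 * k + 1)) (1 - k / (2 * k + 1)) := by
  have hθ0 : 0 < θ := lt_of_lt_of_le (by positivity) hθ
  obtain ⟨C, hC, h⟩ := exists_lintegral_band_sq_le hk hθ hθ1
  -- `2 ^ (-k j)` and `2 ^ (j / 2)` are `2 ^ (-τ Δ j)` and `2 ^ ((1 - τ) Δ j)` with `Δ = k + 1 / 2`
  set τ : ℝ := 2 * k / (2 * k + 1) with hτ
  have hτ0 : 0 < τ := by positivity
  have hτ1 : τ < 1 := by rw [hτ, div_lt_one (by positivity)]; linarith
  obtain ⟨C', hC', hsum⟩ := exists_tsum_ofReal_min_le hτ0 hτ1 (Δ := k + 1 / 2) (by positivity)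
  refine ⟨C' * Real.sqrt C ^ τ, by positivity, ?_⟩
  intro Y X _ _ _ _ _ _ _ hX D B hD C₂ C₃ C₄ hC₂ hC₃ hC₄ K H φ ψ E F hE hF hEfin hFfin hφ hψ hφ1
    hψ1 hφ0 hψ0
  set W : ℝ := C₂ ^ (1 - θ) * C₃ ^ θ with hW
  have hW0 : 0 < W := by positivity
  set μ : ℝ := (volume : Measure (Y × X)).real E with hμ
  set ν : ℝ := (volume : Measure (Y × X)).real F with hν
  have hμ0 : 0 ≤ μ := measureReal_nonneg
  have hν0 : 0 ≤ ν := measureReal_nonneg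
  have hφi : Integrable φ := integrable_of_norm_le_one hE hEfin hφ hφ1 hφ0
  have hψi : Integrable ψ := integrable_of_norm_le_one hF hFfin hψ hψ1 hψ0
  set Θ : (Y × X) × (Y × X) → ℂ := fun z => ψ z.1 * (K z.1 z.2 * φ z.2) with hΘ
  have hΘi : Integrable Θ (volume.prod volume) :=
    integrable_form_integrand H.measurable (H.norm_le hk hC₄) hφi hψi
  set S : ℤ → Set ((Y × X) × (Y × X)) := fun j => {z | z.2.2 ∈ band z.1.2 j} with hS
  have hSm : ∀ j, MeasurableSet (S j) := fun j =>
    measurableSet_mem_band measurable_fst.snd measurable_snd.snd j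
  have hle : ‖form K φ ψ‖ₑ ≤ ∑' j, ‖∫ z in S j, Θ z ∂(volume.prod volume)‖ₑ := by
    refine enorm_integral_le_tsum hΘi hSm (fun i j hij => ?_) fun z _ => ?_
    · exact Set.disjoint_left.2 fun z hi hj => Set.disjoint_left.1 (disjoint_band z.1.2 hij) hi hj
    · exact Set.mem_iUnion.2 ⟨_, rfl⟩
  refine hle.trans ((hsum _ (C₄ * (μ * ν)) (Real.sqrt C * W * (μ ^ ((1 + θ) / 2) *
    ν ^ (1 / 2 : ℝ))) (by positivity) (by positivity) fun j => ?_).trans_eq ?_)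
  · rw [ENNReal.ofReal_min]
    have ek : τ * (k + 1 / 2) = k := by rw [hτ]; field_simp
    have ek' : (1 - τ) * (k + 1 / 2) = 1 / 2 := by rw [hτ]; field_simp; ring
    rw [ek, ek']
    refine le_min ?_ ?_
    · calc _ ≤ ∫⁻ z in S j, ‖Θ z‖ₑ ∂(volume.prod volume) := enorm_integral_le_lintegral_enorm _
        _ ≤ ∫⁻ z in S j, ENNReal.ofReal (C₄ * 2 ^ (-k * j)) *
            (‖ψ z.1‖ₑ * ‖φ z.2‖ₑ) ∂(volume.prod volume) := by
            refine setLIntegral_mono_ae' (hSm j) (ae_of_all _ fun z hz => ?_)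
            simp only [hΘ]
            rw [enorm_mul, enorm_mul, mul_left_comm]
            gcongr
            rw [← ofReal_norm]
            refine ENNReal.ofReal_le_ofReal ((H.decay _ _).trans ?_)
            gcongr
            exact rpow_neg_le_of_mem_band hz hk.le
        _ ≤ ∫⁻ z, ENNReal.ofReal (C₄ * 2 ^ (-k * j)) *
            (‖ψ z.1‖ₑ * ‖φ z.2‖ₑ) ∂(volume.prod volume) := setLIntegral_le_lintegral _ _
        _ = ENNReal.ofReal (C₄ * 2 ^ (-k * j)) * ((∫⁻ x, ‖ψ x‖ₑ) * ∫⁻ x, ‖φ x‖ₑ) := by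
            rw [lintegral_const_mul' _ _ ENNReal.ofReal_ne_top,
              lintegral_prod_mul hψ.enorm.aemeasurable hφ.enorm.aemeasurable]
        _ ≤ ENNReal.ofReal (C₄ * 2 ^ (-k * j)) * (volume F * volume E) := by
            gcongr
            · exact lintegral_enorm_le_measure hF hψ1 hψ0
            · exact lintegral_enorm_le_measure hE hφ1 hφ0
        _ = _ := by
            rw [← ofReal_measureReal hEfin, ← ofReal_measureReal hFfin,
              ← ENNReal.ofReal_mul (by positivity), ← ENNReal.ofReal_mul (by positivity)]
            congr 1
            ring
    · set I : Y × X → ℂ := fun x =>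
        ∫ y, K x y * {z : Y × X | z.2 ∈ band x.2 j}.indicator φ y with hI
      have hIm : Measurable I := by
        have h1 : Measurable fun q : (Y × X) × (Y × X) =>
            K q.1 q.2 * {z : Y × X | z.2 ∈ band q.1.2 j}.indicator φ q.2 :=
          H.measurable.mul ((hφ.comp measurable_snd).indicator (hSm j))
        exact (h1.stronglyMeasurable.integral_prod_right' (ν := volume)).measurable
      have hI2 : ∫⁻ x, ‖I x‖ₑ ^ 2 ≤ ENNReal.ofReal (C * W ^ 2 * 2 ^ (j : ℝ) * μ ^ (1 + θ)) :=
        h Y X hX D B hD C₂ C₃ C₄ hC₂ hC₃ hC₄ K H j E φ hE hEfin hφ hφ1 hφ0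
      have e : ∫ z in S j, Θ z ∂(volume.prod volume) = ∫ x, ψ x * I x := by
        rw [← integral_indicator (hSm j), integral_prod _ (hΘi.indicator (hSm j))]
        refine integral_congr_ae (ae_of_all _ fun x => ?_)
        simp only [hI]
        rw [← integral_const_mul]
        refine integral_congr_ae (ae_of_all _ fun y => ?_)
        by_cases hy : y.2 ∈ band x.2 j
        · simp only
          rw [Set.indicator_of_mem (show (x, y) ∈ S j from hy),
            Set.indicator_of_mem (show y ∈ {z : Y × X | z.2 ∈ band x.2 j} from hy)]
        · simp only
          rw [Set.indicator_of_notMem (show (x, y) ∉ S j from hy),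
            Set.indicator_of_notMem (show y ∉ {z : Y × X | z.2 ∈ band x.2 j} from hy)]
          simp
      rw [e]
      calc _ ≤ ∫⁻ x, ‖ψ x‖ₑ * ‖I x‖ₑ := by
            refine (enorm_integral_le_lintegral_enorm _).trans_eq ?_
            simp only [enorm_mul]
        _ ≤ (∫⁻ x, ‖ψ x‖ₑ ^ (2 : ℝ)) ^ (1 / 2 : ℝ) * (∫⁻ x, ‖I x‖ₑ ^ (2 : ℝ)) ^ (1 / 2 : ℝ) :=
            ENNReal.lintegral_mul_le_Lp_mul_Lq volume Real.HolderConjugate.two_two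
              hψ.enorm.aemeasurable hIm.enorm.aemeasurable
        _ ≤ ENNReal.ofReal ν ^ (1 / 2 : ℝ) *
            ENNReal.ofReal (C * W ^ 2 * 2 ^ (j : ℝ) * μ ^ (1 + θ)) ^ (1 / 2 : ℝ) := by
            refine mul_le_mul' ?_ (ENNReal.rpow_le_rpow ?_ (by norm_num))
            · have := eLpNorm_le_measure_rpow (μ := volume) (p := 2) hF hψ1 hψ0 (by norm_num)
                (by norm_num)
              rw [eLpNorm_eq_lintegral_rpow_enorm_toReal (by norm_num) (by norm_num)] at this
              simpa [hν, ofReal_measureReal hFfin] using this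
            · simpa using hI2
        _ = _ := by
            have hWsq : (W ^ 2) ^ (1 / 2 : ℝ) = W := by
              rw [← Real.sqrt_eq_rpow, Real.sqrt_sq hW0.le]
            rw [ENNReal.ofReal_rpow_of_nonneg hν0 (by norm_num),
              ENNReal.ofReal_rpow_of_nonneg (by positivity) (by norm_num),
              ← ENNReal.ofReal_mul (by positivity)]
            congr 1
            rw [Real.mul_rpow (by positivity) (by positivity),
              Real.mul_rpow (by positivity) (by positivity),
              Real.mul_rpow (by positivity) (by positivity), hWsq, Real.sqrt_eq_rpow C,
              ← Real.rpow_mul (by norm_num), ← Real.rpow_mul hμ0]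
            ring_nf
  · congr 1
    have hμe : μ ^ (1 - k * (1 - θ) / (2 * k + 1)) = μ ^ (1 - τ) * μ ^ ((1 + θ) / 2 * τ) := by
      rw [← Real.rpow_add_of_nonneg hμ0 (by linarith) (by positivity)]
      congr 1
      rw [hτ]; field_simp; ring
    have hνe : ν ^ (1 - k / (2 * k + 1)) = ν ^ (1 - τ) * ν ^ ((1 / 2 : ℝ) * τ) := by
      rw [← Real.rpow_add_of_nonneg hν0 (by linarith) (by positivity)]
      congr 1
      rw [hτ]; field_simp; ring
    have e1 : (C₄ * (μ * ν)) ^ (1 - τ) = C₄ ^ (1 - τ) * (μ ^ (1 - τ) * ν ^ (1 - τ)) := by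
      rw [Real.mul_rpow hC₄.le (by positivity), Real.mul_rpow hμ0 hν0]
    have e2 : (Real.sqrt C * W * (μ ^ ((1 + θ) / 2) * ν ^ (1 / 2 : ℝ))) ^ τ
        = Real.sqrt C ^ τ * W ^ τ * (μ ^ ((1 + θ) / 2 * τ) * ν ^ ((1 / 2 : ℝ) * τ)) := by
      rw [Real.mul_rpow (by positivity) (by positivity), Real.mul_rpow (by positivity) hW0.le,
        Real.mul_rpow (x := μ ^ ((1 + θ) / 2)) (by positivity) (by positivity),
        ← Real.rpow_mul hμ0, ← Real.rpow_mul hν0]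
    rw [hμe, hνe, e1, e2]
    ring

end Endpoint

/-! ### Strong type bounds in the three ranges -/

section Adjoint

variable {P : Type} [MeasureSpace P] [SigmaFinite (volume : Measure P)]

theorem form_adjoint (K : P → P → ℂ) (φ ψ : P → ℂ) :
    form (fun x y => conj (K y x)) (fun x => conj (ψ x)) (fun x => conj (φ x))
      = conj (form K φ ψ) := by
  rw [form, form, ← integral_conj, ← integral_prod_swap]
  refine integral_congr_ae (ae_of_all _ fun z => ?_)
  simp only [Prod.fst_swap, Prod.snd_swap, map_mul]
  ring

theorem enorm_form_adjoint (K : P → P → ℂ) (φ ψ : P → ℂ) :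
    ‖form (fun x y => conj (K y x)) (fun x => conj (ψ x)) (fun x => conj (φ x))‖ₑ
      = ‖form K φ ψ‖ₑ := by
  rw [form_adjoint, RCLike.enorm_conj]

/-- Passing to the adjoint kernel swaps the two exponents. -/
theorem RestrictedBound.of_adjoint {K : P → P → ℂ} {M u v : ℝ}
    (h : RestrictedBound (fun x y => conj (K y x)) M u v) : RestrictedBound K M v u := by
  intro φ ψ E F hE hF hEfin hFfin hφ hψ hφ1 hψ1 hφ0 hψ0
  rw [← enorm_form_adjoint]
  refine (h _ _ F E hF hE hFfin hEfin (Complex.continuous_conj.measurable.comp hψ)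
    (Complex.continuous_conj.measurable.comp hφ) (fun z => ?_) (fun z => ?_) (fun z hz => ?_)
    (fun z hz => ?_)).trans_eq ?_
  · simpa using hψ1 z
  · simpa using hφ1 z
  · simp [hψ0 z hz]
  · simp [hφ0 z hz]
  · rw [mul_right_comm]

/-- Passing to the adjoint kernel swaps the two exponents. -/
theorem StrongBound.of_adjoint {K : P → P → ℂ} {M p r : ℝ}
    (h : StrongBound (fun x y => conj (K y x)) M p r) : StrongBound K M r p := by
  intro f g hf hg hfi hgi hfp hgr
  rw [← enorm_form_adjoint]
  have hc : ∀ {f : P → ℂ}, Integrable f → Integrable fun x => conj (f x) := fun {f} hf => by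
    refine (hf.norm.mono' (Complex.continuous_conj.comp_aestronglyMeasurable
      hf.aestronglyMeasurable) (ae_of_all _ fun x => ?_))
    simp
  refine (h _ _ (Complex.continuous_conj.measurable.comp hg)
    (Complex.continuous_conj.measurable.comp hf) (hc hgi) (hc hfi) ?_ ?_).trans_eq ?_
  · simpa [RCLike.enorm_conj] using hgr
  · simpa [RCLike.enorm_conj] using hfp
  · have hen : ∀ z : ℂ, ‖conj z‖ₑ = ‖z‖ₑ := fun z => RCLike.enorm_conj z
    simp only [Function.comp_apply, hen]
    rw [mul_comm ((∫⁻ x, ‖g x‖ₑ ^ p) ^ (1 / p))]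

end Adjoint

theorem rpow_interpolate {C C₂ C₃ C₄ : ℝ} (hC : 0 < C) (hC₂ : 0 < C₂) (hC₃ : 0 < C₃) (hC₄ : 0 < C₄)
    (θ σ τ : ℝ) :
    C₄ ^ (1 - τ) * (C * (C₄ ^ (1 - σ) * (C₂ ^ (1 - θ) * C₃ ^ θ) ^ σ)) ^ τ
      = C ^ τ * (C₂ ^ ((1 - θ) * (σ * τ)) * C₃ ^ (θ * (σ * τ)) * C₄ ^ (1 - σ * τ)) := by
  rw [Real.mul_rpow hC.le (by positivity), Real.mul_rpow (by positivity) (by positivity),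
    ← Real.rpow_mul hC₄.le, ← Real.rpow_mul (by positivity),
    Real.mul_rpow (x := C₂ ^ (1 - θ)) (by positivity) (by positivity), ← Real.rpow_mul hC₂.le,
    ← Real.rpow_mul hC₃.le]
  have h : C₄ ^ (1 - σ * τ) = C₄ ^ (1 - τ) * C₄ ^ ((1 - σ) * τ) := by
    rw [← Real.rpow_add hC₄]; ring_nf
  rw [h]
  ring

/-- Below the ray `(k + 1) / k * a = b`, with `a = 1/p^*` and `b = 1/q`: the bound at a point is
interpolated along the ray through this point, between the trivial bound at the origin and the
restricted type bound on the line `b = k / (2 k + 1)`. -/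
theorem exists_strongBound_below_ray {k a b : ℝ} (hk : 0 < k) (ha : 0 ≤ a)
    (hab : (k + 1) / k * a ≤ b) (hb : 0 < b) (hbk : b < k / (2 * k + 1)) :
    ∃ C : ℝ, 0 < C ∧ ∀ (Y X : Type) [MeasureSpace Y] [SigmaFinite (volume : Measure Y)]
      [NormedAddCommGroup X] [MeasureSpace X] [BorelSpace X] [SecondCountableTopology X]
      [SigmaFinite (volume : Measure X)], LinearGrowth X →
      ∀ (D : Set (Y → ℂ)) (B : ℕ → Set Y), Approximating D B →
      ∀ (C₂ C₃ C₄ : ℝ), 0 < C₂ → 0 < C₃ → 0 < C₄ →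
      ∀ K : Y × X → Y × X → ℂ, FibredKernel D k C₂ C₃ C₄ K →
      StrongBound K (C * (C₂ ^ (2 * a) * C₃ ^ (2 * b - 2 * a) * C₄ ^ (1 - 2 * b)))
        (1 / (1 - a)) (1 / (1 - b)) := by
  have hk1 : 0 < k + 1 := by linarith
  have h2k1 : 0 < 2 * k + 1 := by linarith
  have hab' : (k + 1) * a ≤ k * b := by
    rw [div_mul_eq_mul_div, div_le_iff₀ hk] at hab; linarith
  have hbk' : b * (2 * k + 1) < k := by rwa [lt_div_iff₀ h2k1] at hbk
  have hab1 : a ≤ b := by nlinarith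
  have hb1 : b < 1 / 2 := by nlinarith
  set θ : ℝ := 1 - a / b with hθ
  have hθb : (1 - θ) * b = a := by rw [hθ]; field_simp; ring
  have hθ1 : θ ≤ 1 := by rw [hθ]; linarith [div_nonneg ha hb.le]
  have hθ0 : 1 / (k + 1) ≤ θ := by
    rw [hθ, div_le_iff₀ hk1, sub_mul, div_mul_eq_mul_div, le_sub_iff_add_le, ← le_sub_iff_add_le',
      div_le_iff₀ hb]
    nlinarith
  have hθpos : 0 < θ := lt_of_lt_of_le (by positivity) hθ0
  set τ : ℝ := b * (2 * k + 1) / k with hτ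
  have hτ0 : 0 < τ := by positivity
  have hτ1 : τ < 1 := by rw [hτ, div_lt_one hk]; exact hbk'
  have hτk : τ * (k / (2 * k + 1)) = b := by rw [hτ]; field_simp
  obtain ⟨C₀, hC₀, h₀⟩ := exists_restrictedBound hk hθ0 hθ1
  have hu₁ : 1 - k * (1 - θ) / (2 * k + 1) ∈ Set.Icc (0 : ℝ) 1 := by
    constructor
    · rw [sub_nonneg, div_le_one h2k1]; nlinarith
    · have : 0 ≤ k * (1 - θ) / (2 * k + 1) := by
        have : 0 ≤ 1 - θ := by linarith
        positivity
      linarith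
  have hv₁ : 1 - k / (2 * k + 1) ∈ Set.Icc (0 : ℝ) 1 := by
    constructor
    · rw [sub_nonneg, div_le_one h2k1]; linarith
    · linarith [div_pos hk h2k1]
  obtain ⟨C₁, hC₁, h₁⟩ := exists_strongBound (u₀ := 1) (u₁ := 1 - k * (1 - θ) / (2 * k + 1))
    (v₀ := 1) (v₁ := 1 - k / (2 * k + 1)) (τ := τ) (p := 1 / (1 - a)) (r := 1 / (1 - b)) hτ0 hτ1
    ⟨by norm_num, le_rfl⟩ hu₁ ⟨by norm_num, le_rfl⟩ hv₁
    (by rw [le_div_iff₀ (by linarith)]; linarith) (by rw [le_div_iff₀ (by linarith)]; linarith)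
    (by
      rw [one_div_one_div, mul_div_right_comm]
      linear_combination (1 - θ) * hτk + hθb)
    (by rw [one_div_one_div]; linear_combination hτk)
    (by rw [one_div_one_div, one_div_one_div]; linarith)
    (by linarith [div_pos hk h2k1])
    (by
      rcases ha.eq_or_lt with rfl | ha
      · left; norm_num
      · right
        have : 0 < a / b := by positivity
        have : 0 < k * (1 - θ) / (2 * k + 1) := by
          have : 0 < 1 - θ := by rw [hθ]; linarith
          positivity
        linarith)
  refine ⟨C₁ * C₀ ^ τ, by positivity, ?_⟩
  intro Y X _ _ _ _ _ _ _ hX D B hD C₂ C₃ C₄ hC₂ hC₃ hC₄ K H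
  have key := h₁ (Y × X) K C₄ C₄ _ H.measurable (H.norm_le hk hC₄) hC₄.le (by positivity)
    (restrictedBound_of_norm_le hC₄.le (H.norm_le hk hC₄))
    (h₀ Y X hX D B hD C₂ C₃ C₄ hC₂ hC₃ hC₄ K H)
  rw [rpow_interpolate hC₀ hC₂ hC₃ hC₄] at key
  have hστ : 2 * k / (2 * k + 1) * τ = 2 * b := by rw [hτ]; field_simp
  rw [hστ] at key
  have e1 : (1 - θ) * (2 * b) = 2 * a := by linear_combination 2 * hθb
  have e2 : θ * (2 * b) = 2 * b - 2 * a := by linear_combination -2 * hθb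
  rw [e1, e2, ← mul_assoc] at key
  exact key

/-- Two restricted type bounds, at a point `(a₁, b₁)` and at its reflection, imply a strong type
bound on the triangle spanned by the origin and the open segment between them. On the segment itself
they are interpolated directly; below it, the bound is interpolated along the ray through the
origin. -/
theorem exists_strongBound_of_reflected {a₁ b₁ a b t τ : ℝ} (ha₁ : 0 < a₁) (hlt : a₁ < b₁)
    (hsum : a₁ + b₁ ≤ 1) (ht0 : 0 < t) (ht1 : t < 1) (hτ0 : 0 < τ) (hτ1 : τ ≤ 1)
    (hta : τ * ((1 - t) * a₁ + t * b₁) = a) (htb : τ * ((1 - t) * b₁ + t * a₁) = b) :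
    ∃ C : ℝ, 0 < C ∧ ∀ (P : Type) [MeasureSpace P] [SigmaFinite (volume : Measure P)]
      (K : P → P → ℂ) (c M : ℝ), Measurable (Function.uncurry K) → (∀ x y, ‖K x y‖ ≤ c) →
      0 ≤ c → 0 < M → RestrictedBound K M (1 - a₁) (1 - b₁) →
      RestrictedBound K M (1 - b₁) (1 - a₁) →
      StrongBound K (C * (c ^ (1 - τ) * M ^ τ)) (1 / (1 - a)) (1 / (1 - b)) := by
  have h1 : 0 < (1 - t) * a₁ := mul_pos (by linarith) ha₁
  have h2 : 0 < t * a₁ := mul_pos ht0 ha₁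
  have h3 : 0 < (1 - t) * b₁ := mul_pos (by linarith) (ha₁.trans hlt)
  have h4 : 0 < t * b₁ := mul_pos ht0 (ha₁.trans hlt)
  have hx1 : (1 - t) * a₁ + t * b₁ < 1 := by
    have : (1 - t) * a₁ < (1 - t) * b₁ := mul_lt_mul_of_pos_left hlt (by linarith)
    linarith
  have hy1 : (1 - t) * b₁ + t * a₁ < 1 := by
    have : t * a₁ < t * b₁ := mul_lt_mul_of_pos_left hlt ht0
    linarith
  have ha0 : 0 < a := by rw [← hta]; exact mul_pos hτ0 (by linarith)
  have hb0 : 0 < b := by rw [← htb]; exact mul_pos hτ0 (by linarith)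
  have hab : a + b ≤ 1 := by
    have e : a + b = τ * (a₁ + b₁) := by rw [← hta, ← htb]; ring
    rw [e]
    exact (mul_le_of_le_one_left (by linarith) hτ1).trans hsum
  have hp : 1 ≤ 1 / (1 - a) := by rw [le_div_iff₀ (by linarith)]; linarith
  have hr : 1 ≤ 1 / (1 - b) := by rw [le_div_iff₀ (by linarith)]; linarith
  have hpr : 1 ≤ 1 / (1 / (1 - a)) + 1 / (1 / (1 - b)) := by
    rw [one_div_one_div, one_div_one_div]; linarith
  rcases hτ1.lt_or_eq with hτ1 | rfl
  · obtain ⟨C, hC, h⟩ := exists_strongBound (u₀ := 1) (v₀ := 1)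
      (u₁ := (1 - t) * (1 - a₁) + t * (1 - b₁)) (v₁ := (1 - t) * (1 - b₁) + t * (1 - a₁))
      hτ0 hτ1 ⟨by norm_num, le_rfl⟩ ⟨by linarith, by linarith⟩ ⟨by norm_num, le_rfl⟩
      ⟨by linarith, by linarith⟩ hp hr
      (by rw [one_div_one_div]; linear_combination hta)
      (by rw [one_div_one_div]; linear_combination htb) hpr (by linarith) (Or.inr (by linarith))
    refine ⟨C, hC, fun P _ _ K c M hK hc hc0 hM hR hR' => ?_⟩
    have hG := hR.rpow_mul_rpow hM.le hM.le ht0.le ht1.le (by linarith) (by linarith)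
      (by linarith) (by linarith) hR'
    rw [← Real.rpow_add hM, sub_add_cancel, Real.rpow_one] at hG
    exact h P K c c M hK hc hc0 hM.le (restrictedBound_of_norm_le hc0 hc) hG
  · rw [one_mul] at hta htb
    obtain ⟨C, hC, h⟩ := exists_strongBound (u₀ := 1 - a₁) (u₁ := 1 - b₁)
      (v₀ := 1 - b₁) (v₁ := 1 - a₁) ht0 ht1
      ⟨by linarith, by linarith⟩ ⟨by linarith, by linarith⟩ ⟨by linarith, by linarith⟩
      ⟨by linarith, by linarith⟩ hp hr
      (by rw [one_div_one_div]; linear_combination hta)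
      (by rw [one_div_one_div]; linear_combination htb) hpr (by linarith) (Or.inr (by linarith))
    refine ⟨C, hC, fun P _ _ K c M hK hc hc0 hM hR hR' => ?_⟩
    have key := h P K c M M hK hc hM.le hM.le hR hR'
    rw [← Real.rpow_add hM, sub_add_cancel, Real.rpow_one] at key
    rwa [sub_self, Real.rpow_zero, one_mul, Real.rpow_one]

/-- Between the two rays, the bound comes from the endpoint `θ = 1 / (k + 1)` of the restricted type
bounds and from its reflection, which is the bound for the adjoint kernel. -/
theorem exists_strongBound_between_rays {k a b : ℝ} (hk : 0 < k)
    (hab : k / (k + 1) * b < a) (hba : a < (k + 1) / k * b) (hs : a + b ≤ k / (k + 1)) :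
    ∃ C : ℝ, 0 < C ∧ ∀ (Y X : Type) [MeasureSpace Y] [SigmaFinite (volume : Measure Y)]
      [NormedAddCommGroup X] [MeasureSpace X] [BorelSpace X] [SecondCountableTopology X]
      [SigmaFinite (volume : Measure X)], LinearGrowth X →
      ∀ (D : Set (Y → ℂ)) (B : ℕ → Set Y), Approximating D B →
      ∀ (C₂ C₃ C₄ : ℝ), 0 < C₂ → 0 < C₃ → 0 < C₄ →
      ∀ K : Y × X → Y × X → ℂ, FibredKernel D k C₂ C₃ C₄ K →
      FibredKernel D k C₂ C₃ C₄ (fun x y => conj (K y x)) →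
      StrongBound K (C * (C₂ ^ (2 * k / (2 * k + 1) * (a + b)) * C₃ ^ (2 / (2 * k + 1) * (a + b)) *
        C₄ ^ (1 - 2 * (k + 1) / (2 * k + 1) * (a + b)))) (1 / (1 - a)) (1 / (1 - b)) := by
  have hk1 : 0 < k + 1 := by linarith
  have h2k1 : 0 < 2 * k + 1 := by linarith
  rw [div_mul_eq_mul_div, div_lt_iff₀ hk1] at hab
  rw [div_mul_eq_mul_div, lt_div_iff₀ hk] at hba
  rw [le_div_iff₀ hk1] at hs
  have hs0 : 0 < a + b := by
    by_contra! h
    nlinarith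
  have hθ1 : 1 / (k + 1) ≤ 1 := by rw [div_le_one hk1]; linarith
  obtain ⟨C₀, hC₀, h₀⟩ := exists_restrictedBound hk (le_refl (1 / (k + 1))) hθ1
  have ea₁ : k * (1 - 1 / (k + 1)) / (2 * k + 1) = k ^ 2 / ((2 * k + 1) * (k + 1)) := by
    field_simp; ring
  -- the weight `t` for which the point dividing the segment lies on the ray through `(a, b)`, and
  -- the position `τ` of `(a, b)` on this ray
  obtain ⟨C₁, hC₁, h₁⟩ := exists_strongBound_of_reflected (a := a) (b := b)
    (a₁ := k * (1 - 1 / (k + 1)) / (2 * k + 1)) (b₁ := k / (2 * k + 1))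
    (t := ((2 * k + 1) * a - k * (a + b)) / (a + b)) (τ := (a + b) * (k + 1) / k)
    (by rw [ea₁]; positivity)
    (by rw [ea₁, div_lt_div_iff₀ (by positivity) h2k1]
        have h : 0 < k * (2 * k + 1) := by positivity
        linarith)
    (by rw [ea₁, div_add_div _ _ (by positivity) (by positivity), div_le_one (by positivity)]
        have h : 0 < (2 * k + 1) * (2 * k + 1) := by positivity
        linarith)
    (div_pos (by linarith) hs0) (by rw [div_lt_one hs0]; linarith) (by positivity)
    (by rw [div_le_one hk]; exact hs)
    (by rw [ea₁]; field_simp; ring) (by rw [ea₁]; field_simp; ring)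
  refine ⟨C₁ * C₀ ^ ((a + b) * (k + 1) / k), by positivity, ?_⟩
  intro Y X _ _ _ _ _ _ _ hX D B hD C₂ C₃ C₄ hC₂ hC₃ hC₄ K H H'
  have key := h₁ (Y × X) K C₄ _ H.measurable (H.norm_le hk hC₄) hC₄.le (by positivity)
    (h₀ Y X hX D B hD C₂ C₃ C₄ hC₂ hC₃ hC₄ K H)
    (h₀ Y X hX D B hD C₂ C₃ C₄ hC₂ hC₃ hC₄ _ H').of_adjoint
  rw [rpow_interpolate hC₀ hC₂ hC₃ hC₄, ← mul_assoc] at key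
  have e : 2 * k / (2 * k + 1) * ((a + b) * (k + 1) / k)
      = 2 * (k + 1) / (2 * k + 1) * (a + b) := by field_simp
  have e1 : (1 - 1 / (k + 1)) * (2 * (k + 1) / (2 * k + 1) * (a + b))
      = 2 * k / (2 * k + 1) * (a + b) := by field_simp; ring
  have e2 : 1 / (k + 1) * (2 * (k + 1) / (2 * k + 1) * (a + b)) = 2 / (2 * k + 1) * (a + b) := by
    field_simp
  rwa [e, e1, e2] at key

/-! ### Duality and extension to the Lebesgue spaces -/

/-- The integral operator with kernel `K`, on a general measure space. -/
noncomputable def integralOp {P : Type} [MeasureSpace P] (K : P → P → ℂ) (f : P → ℂ) (x : P) : ℂ :=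
  ∫ y, K x y * f y

section Duality

variable {P : Type} [MeasureSpace P]

theorem memLp_of_memLp_one_of_memLp_top {f : P → ℂ} (h1 : MemLp f 1) (h2 : MemLp f ⊤) {p : ℝ≥0∞}
    (hp : 1 ≤ p) : MemLp f p := by
  rcases eq_or_ne p ⊤ with rfl | hpt
  · exact h2
  have hp0 : p ≠ 0 := (zero_lt_one.trans_le hp).ne'
  have hp1 : 1 ≤ p.toReal := by
    rw [← ENNReal.toReal_one]; exact ENNReal.toReal_mono hpt hp
  refine ⟨h1.1, ?_⟩
  rw [eLpNorm_lt_top_iff_lintegral_rpow_enorm_lt_top hp0 hpt]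
  set c := eLpNormEssSup f volume with hc
  have hct : c < ⊤ := by simpa [eLpNorm_exponent_top] using h2.2
  calc ∫⁻ x, ‖f x‖ₑ ^ p.toReal ≤ ∫⁻ x, c ^ (p.toReal - 1) * ‖f x‖ₑ := by
        refine lintegral_mono_ae ?_
        filter_upwards [ae_le_eLpNormEssSup (f := f) (μ := volume)] with x hx
        have e : p.toReal = (p.toReal - 1) + 1 := by ring
        conv_lhs => rw [e]
        rw [ENNReal.rpow_add_of_nonneg _ _ (by linarith) zero_le_one, ENNReal.rpow_one]
        gcongr
    _ = c ^ (p.toReal - 1) * ∫⁻ x, ‖f x‖ₑ :=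
        lintegral_const_mul' _ _ (ENNReal.rpow_ne_top_of_nonneg (by linarith) hct.ne)
    _ < ⊤ := by
        refine ENNReal.mul_lt_top (ENNReal.rpow_lt_top_of_nonneg (by linarith) hct.ne) ?_
        simpa [eLpNorm_one_eq_lintegral_enorm] using h1.2

/-- The converse of Hölder's inequality for bounded functions, tested on integrable functions. -/
theorem lintegral_rpow_le_of_forall_integral_mul_le [SigmaFinite (volume : Measure P)] {h : P → ℂ}
    (hh : Measurable h) {c : ℝ} (hc : ∀ x, ‖h x‖ ≤ c) {r : ℝ} (hr : 1 < r) {N : ℝ≥0∞}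
    (H : ∀ g : P → ℂ, Measurable g → Integrable g → ∫⁻ x, ‖g x‖ₑ ^ r ≠ ⊤ →
      ‖∫ x, g x * h x‖ₑ ≤ N * (∫⁻ x, ‖g x‖ₑ ^ r) ^ (1 / r)) :
    (∫⁻ x, ‖h x‖ₑ ^ (r / (r - 1))) ^ (1 - 1 / r) ≤ N := by
  set q : ℝ := r / (r - 1) with hq
  have hr0 : 0 < r := by linarith
  have hr1 : 0 < r - 1 := by linarith
  have hq1 : 1 < q := by rw [hq, one_lt_div hr1]; linarith
  have hqr : (q - 1) * r = q := by rw [hq]; field_simp; ring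
  have hq' : 0 < 1 - 1 / r := by rw [sub_pos, div_lt_one hr0]; exact hr
  -- the bound on sets of finite measure
  have key : ∀ A : Set P, MeasurableSet A → volume A ≠ ⊤ →
      (∫⁻ x in A, ‖h x‖ₑ ^ q) ^ (1 - 1 / r) ≤ N := by
    intro A hA hAfin
    set I := ∫⁻ x in A, ‖h x‖ₑ ^ q with hI
    have hbd : ∀ x, ‖h x‖ₑ ^ q ≤ ENNReal.ofReal c ^ q := fun x => by
      gcongr
      rw [← ofReal_norm]
      exact ENNReal.ofReal_le_ofReal (hc x)
    have hIfin : I ≠ ⊤ := by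
      refine ne_top_of_le_ne_top ?_ (lintegral_mono hbd)
      rw [lintegral_const, Measure.restrict_apply_univ]
      exact ENNReal.mul_ne_top (ENNReal.rpow_ne_top_of_nonneg (by linarith) ENNReal.ofReal_ne_top)
        hAfin
    rcases eq_or_ne I 0 with h0 | h0
    · rw [h0, ENNReal.zero_rpow_of_pos hq']; exact zero_le
    set g : P → ℂ := A.indicator fun x => conj (h x) * ((‖h x‖ ^ (q - 2) : ℝ) : ℂ) with hg
    have hgm : Measurable g := by
      refine Measurable.indicator ?_ hA
      exact (Complex.continuous_conj.measurable.comp hh).mul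
        (Complex.measurable_ofReal.comp (hh.norm.pow_const _))
    have hgn : ∀ x ∈ A, ‖g x‖ = ‖h x‖ ^ (q - 1) := by
      intro x hx
      rw [hg, Set.indicator_of_mem hx, norm_mul, RCLike.norm_conj, Complex.norm_real,
        Real.norm_of_nonneg (by positivity)]
      rcases (norm_nonneg (h x)).eq_or_lt with h1 | h1
      · rw [← h1, zero_mul, Real.zero_rpow (by linarith)]
      · have e : q - 1 = 1 + (q - 2) := by ring
        rw [e, Real.rpow_add h1, Real.rpow_one]
    have hg0 : ∀ x ∉ A, g x = 0 := fun x hx => Set.indicator_of_notMem hx _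
    have hgr : ∫⁻ x, ‖g x‖ₑ ^ r = I := by
      rw [hI, ← lintegral_indicator hA]
      refine lintegral_congr fun x => ?_
      by_cases hx : x ∈ A
      · rw [Set.indicator_of_mem hx, ← ofReal_norm, hgn x hx,
          ENNReal.ofReal_rpow_of_nonneg (by positivity) hr0.le, ← Real.rpow_mul (norm_nonneg _),
          hqr, ← ofReal_norm, ENNReal.ofReal_rpow_of_nonneg (by positivity) (by linarith)]
      · rw [Set.indicator_of_notMem hx, hg0 x hx, enorm_zero, ENNReal.zero_rpow_of_pos hr0]
    have hgi : Integrable g := by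
      have hgA : IntegrableOn g A := by
        refine IntegrableOn.of_bound hAfin.lt_top hgm.aestronglyMeasurable (c ^ (q - 1)) ?_
        refine (ae_restrict_iff' hA).2 (ae_of_all _ fun x hx => ?_)
        rw [hgn x hx]
        exact Real.rpow_le_rpow (norm_nonneg _) (hc x) (by linarith)
      exact hgA.integrable_of_forall_notMem_eq_zero hg0
    have hgh : ∫ x, g x * h x = ((∫ x in A, ‖h x‖ ^ q : ℝ) : ℂ) := by
      rw [← integral_indicator hA, ← integral_complex_ofReal]
      refine integral_congr_ae (ae_of_all _ fun x => ?_)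
      by_cases hx : x ∈ A
      · simp only [hg, Set.indicator_of_mem hx]
        rw [mul_right_comm, Complex.conj_mul', ← Complex.ofReal_pow, ← Complex.ofReal_mul]
        congr 1
        rcases (norm_nonneg (h x)).eq_or_lt with h1 | h1
        · rw [← h1, Real.zero_rpow (x := q) (by linarith)]; simp
        · rw [← Real.rpow_natCast, ← Real.rpow_add h1]; congr 1; push_cast; ring
      · simp [hg0 x hx, Set.indicator_of_notMem hx]
    have hghI : ‖∫ x, g x * h x‖ₑ = I := by
      rw [hgh, ← ofReal_norm, Complex.norm_real,
        Real.norm_of_nonneg (by positivity), integral_eq_lintegral_of_nonneg_ae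
          (ae_of_all _ fun x => by positivity) (hh.norm.pow_const _).aestronglyMeasurable]
      have e : ∀ x, ENNReal.ofReal (‖h x‖ ^ q) = ‖h x‖ₑ ^ q := fun x => by
        rw [← ofReal_norm, ENNReal.ofReal_rpow_of_nonneg (by positivity) (by linarith)]
      simp only [e]
      exact ENNReal.ofReal_toReal hIfin
    have hmain := H g hgm hgi (by rw [hgr]; exact hIfin)
    rw [hghI, hgr] at hmain
    rw [ENNReal.rpow_sub _ _ h0 hIfin, ENNReal.rpow_one]
    exact ENNReal.div_le_of_le_mul hmain
  -- exhaustion by sets of finite measure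
  have hlim : Filter.Tendsto (fun n => (∫⁻ x in spanningSets (volume : Measure P) n, ‖h x‖ₑ ^ q)
      ^ (1 - 1 / r)) Filter.atTop (nhds ((∫⁻ x, ‖h x‖ₑ ^ q) ^ (1 - 1 / r))) := by
    refine (ENNReal.continuous_rpow_const.tendsto _).comp ?_
    have e := setLIntegral_iUnion_of_directed (μ := (volume : Measure P)) (fun x => ‖h x‖ₑ ^ q)
      (monotone_spanningSets (volume : Measure P)).directed_le
    rw [iUnion_spanningSets, Measure.restrict_univ] at e
    rw [e]
    exact tendsto_atTop_iSup fun m n hmn =>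
      lintegral_mono_set (monotone_spanningSets (volume : Measure P) hmn)
  exact le_of_tendsto' hlim fun n => key _ (measurableSet_spanningSets _ n)
    (measure_spanningSets_lt_top _ n).ne

/-- The case `r = 1` of the converse of Hölder's inequality. -/
theorem ae_enorm_le_of_forall_integral_mul_le [SigmaFinite (volume : Measure P)] {h : P → ℂ}
    (hh : Measurable h) {c : ℝ} (hc : ∀ x, ‖h x‖ ≤ c) {N : ℝ≥0∞}
    (H : ∀ g : P → ℂ, Measurable g → Integrable g →
      ‖∫ x, g x * h x‖ₑ ≤ N * ∫⁻ x, ‖g x‖ₑ) : ∀ᵐ x, ‖h x‖ₑ ≤ N := by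
  refine ae_le_of_forall_setLIntegral_le_of_sigmaFinite hh.enorm fun A hA hAfin => ?_
  set g : P → ℂ := A.indicator fun x => conj (h x) * ((‖h x‖⁻¹ : ℝ) : ℂ) with hg
  have hgm : Measurable g := by
    refine Measurable.indicator ?_ hA
    exact (Complex.continuous_conj.measurable.comp hh).mul
      (Complex.measurable_ofReal.comp hh.norm.inv)
  have hg1 : ∀ x, ‖g x‖ ≤ A.indicator 1 x := by
    intro x
    by_cases hx : x ∈ A
    · rw [hg, Set.indicator_of_mem hx, Set.indicator_of_mem hx, norm_mul, RCLike.norm_conj,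
        Complex.norm_real, norm_inv, norm_norm]
      exact mul_inv_le_one
    · rw [hg, Set.indicator_of_notMem hx, Set.indicator_of_notMem hx, norm_zero]
  have hg0 : ∀ x ∉ A, g x = 0 := fun x hx => Set.indicator_of_notMem hx _
  have hgi : Integrable g := integrable_of_norm_le_one hA hAfin.ne hgm (fun x => (hg1 x).trans
    (Set.indicator_le_self' (fun _ _ => zero_le_one) x)) hg0
  have hgN : ∫⁻ x, ‖g x‖ₑ ≤ volume A := by
    rw [← lintegral_indicator_one hA]
    refine lintegral_mono fun x => ?_
    rw [← ofReal_norm]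
    refine (ENNReal.ofReal_le_ofReal (hg1 x)).trans_eq ?_
    by_cases hx : x ∈ A <;> simp [hx]
  have hgh : ∫ x, g x * h x = ((∫ x in A, ‖h x‖ : ℝ) : ℂ) := by
    rw [← integral_indicator hA, ← integral_complex_ofReal]
    refine integral_congr_ae (ae_of_all _ fun x => ?_)
    by_cases hx : x ∈ A
    · simp only [hg, Set.indicator_of_mem hx]
      rw [mul_right_comm, Complex.conj_mul', ← Complex.ofReal_pow, ← Complex.ofReal_mul]
      congr 1
      rcases eq_or_ne ‖h x‖ 0 with h1 | h1
      · rw [h1]; simp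
      · field_simp
    · simp [hg0 x hx, Set.indicator_of_notMem hx]
  have hAi : ∫⁻ x in A, ‖h x‖ₑ ≠ ⊤ := by
    have hle : ∀ x, ‖h x‖ₑ ≤ ENNReal.ofReal c := fun x => by
      rw [← ofReal_norm]; exact ENNReal.ofReal_le_ofReal (hc x)
    refine ne_top_of_le_ne_top ?_ (lintegral_mono hle)
    rw [lintegral_const, Measure.restrict_apply_univ]
    exact ENNReal.mul_ne_top ENNReal.ofReal_ne_top hAfin.ne
  have hghI : ‖∫ x, g x * h x‖ₑ = ∫⁻ x in A, ‖h x‖ₑ := by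
    rw [hgh, ← ofReal_norm, Complex.norm_real, Real.norm_of_nonneg (by positivity),
      integral_norm_eq_lintegral_enorm hh.aestronglyMeasurable]
    exact ENNReal.ofReal_toReal hAi
  rw [setLIntegral_const, ← hghI]
  exact (H g hgm hgi).trans (by gcongr)

theorem integrable_kernel_mul {K : P → P → ℂ} {c : ℝ} (hK : Measurable (Function.uncurry K))
    (hc : ∀ x y, ‖K x y‖ ≤ c) {f : P → ℂ} (hf : Integrable f) (x : P) :
    Integrable fun y => K x y * f y :=
  hf.bdd_mul (c := c) (hK.of_uncurry_left (x := x)).aestronglyMeasurable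
    (ae_of_all _ fun y => hc x y)

theorem enorm_integralOp_le {K : P → P → ℂ} {c : ℝ} (hc : ∀ x y, ‖K x y‖ ≤ c) (f : P → ℂ) (x : P) :
    ‖integralOp K f x‖ₑ ≤ ENNReal.ofReal c * eLpNorm f 1 := by
  rw [eLpNorm_one_eq_lintegral_enorm, ← lintegral_const_mul' _ _ ENNReal.ofReal_ne_top]
  refine (enorm_integral_le_lintegral_enorm _).trans (lintegral_mono fun y => ?_)
  rw [enorm_mul, ← ofReal_norm (K x y)]
  gcongr
  exact hc x y

theorem measurable_integralOp [SFinite (volume : Measure P)] {K : P → P → ℂ}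
    (hK : Measurable (Function.uncurry K)) {f : P → ℂ} (hf : Measurable f) :
    Measurable (integralOp K f) := by
  refine StronglyMeasurable.measurable ?_
  refine StronglyMeasurable.integral_prod_right (f := fun x y => K x y * f y) ?_
  exact (hK.mul (hf.comp measurable_snd)).stronglyMeasurable

theorem form_eq_integral_mul_integralOp [SFinite (volume : Measure P)] {K : P → P → ℂ} {c : ℝ}
    (hK : Measurable (Function.uncurry K)) (hc : ∀ x y, ‖K x y‖ ≤ c) {f g : P → ℂ}
    (hf : Integrable f) (hg : Integrable g) :
    form K f g = ∫ x, g x * integralOp K f x := by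
  rw [form, integral_prod _ (integrable_form_integrand hK hc hf hg)]
  exact integral_congr_ae (ae_of_all _ fun x =>
    integral_const_mul (g x) fun y => K x y * f y)

/-- A strong type bound for the bilinear form is a bound for the operator. -/
theorem StrongBound.lintegral_integralOp_rpow_le [SigmaFinite (volume : Measure P)]
    {K : P → P → ℂ} {c M p r : ℝ} (hK : Measurable (Function.uncurry K))
    (hc : ∀ x y, ‖K x y‖ ≤ c) (hr : 1 < r) (H : StrongBound K M p r)
    {f : P → ℂ} (hf : Measurable f) (hfi : Integrable f) (hfp : ∫⁻ x, ‖f x‖ₑ ^ p ≠ ⊤) :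
    (∫⁻ x, ‖integralOp K f x‖ₑ ^ (r / (r - 1))) ^ (1 - 1 / r)
      ≤ ENNReal.ofReal M * (∫⁻ x, ‖f x‖ₑ ^ p) ^ (1 / p) := by
  have hbd : ENNReal.ofReal c * eLpNorm f 1 ≠ ⊤ :=
    ENNReal.mul_ne_top ENNReal.ofReal_ne_top (memLp_one_iff_integrable.2 hfi).2.ne
  refine lintegral_rpow_le_of_forall_integral_mul_le (measurable_integralOp hK hf)
    (c := (ENNReal.ofReal c * eLpNorm f 1).toReal) (fun x => ?_) hr fun g hg hgi hgr => ?_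
  · rw [← toReal_enorm]
    exact ENNReal.toReal_mono hbd (enorm_integralOp_le hc f x)
  · rw [← form_eq_integral_mul_integralOp hK hc hfi hgi, mul_assoc]
    exact H f g hf hg hfi hgi hfp hgr

theorem StrongBound.eLpNorm_integralOp_top_le [SigmaFinite (volume : Measure P)]
    {K : P → P → ℂ} {c M p : ℝ} (hK : Measurable (Function.uncurry K))
    (hc : ∀ x y, ‖K x y‖ ≤ c) (H : StrongBound K M p 1)
    {f : P → ℂ} (hf : Measurable f) (hfi : Integrable f) (hfp : ∫⁻ x, ‖f x‖ₑ ^ p ≠ ⊤) :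
    eLpNorm (integralOp K f) ⊤ ≤ ENNReal.ofReal M * (∫⁻ x, ‖f x‖ₑ ^ p) ^ (1 / p) := by
  have hbd : ENNReal.ofReal c * eLpNorm f 1 ≠ ⊤ :=
    ENNReal.mul_ne_top ENNReal.ofReal_ne_top (memLp_one_iff_integrable.2 hfi).2.ne
  rw [eLpNorm_exponent_top]
  refine eLpNormEssSup_le_of_ae_enorm_bound (ae_enorm_le_of_forall_integral_mul_le
    (measurable_integralOp hK hf) (c := (ENNReal.ofReal c * eLpNorm f 1).toReal) (fun x => ?_)
    fun g hg hgi => ?_)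
  · rw [← toReal_enorm]
    exact ENNReal.toReal_mono hbd (enorm_integralOp_le hc f x)
  · rw [← form_eq_integral_mul_integralOp hK hc hfi hgi, mul_assoc]
    have h := H f g hf hg hfi hgi hfp (by simpa using hgi.2.ne)
    simpa only [ENNReal.rpow_one, div_one] using h

end Duality

section Extension

variable {P : Type} [MeasureSpace P]

/-- The functions in `L¹ ∩ L^∞`. -/
def integrableBounded (P : Type) [MeasureSpace P] : Submodule ℂ (P → ℂ) where
  carrier := {f | MemLp f 1 volume ∧ MemLp f ⊤ volume}
  zero_mem' := ⟨MemLp.zero, MemLp.zero⟩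
  add_mem' := fun hf hg => ⟨hf.1.add hg.1, hf.2.add hg.2⟩
  smul_mem' := fun c _ hf => ⟨hf.1.const_smul c, hf.2.const_smul c⟩

/-- An integral operator bounded from `L^p` to `L^q` on `L¹ ∩ L^∞` extends to `L^p`, in which this
subspace is dense, as `p` is finite. -/
theorem exists_continuousLinearMap_of_eLpNorm_le [SigmaFinite (volume : Measure P)]
    {K : P → P → ℂ} {c : ℝ} (hK : Measurable (Function.uncurry K)) (hc : ∀ x y, ‖K x y‖ ≤ c)
    {p q : ℝ≥0∞} [hp1 : Fact (1 ≤ p)] [Fact (1 ≤ q)] (hp : p ≠ ⊤) {M : ℝ} (hM : 0 ≤ M)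
    (H : ∀ f : P → ℂ, Measurable f → MemLp f 1 → MemLp f ⊤ →
      eLpNorm (integralOp K f) q ≤ ENNReal.ofReal M * eLpNorm f p) :
    ∃ T : Lp ℂ p (volume : Measure P) →L[ℂ] Lp ℂ q (volume : Measure P), ‖T‖ ≤ M ∧
      ∀ f : P → ℂ, MemLp f 1 → MemLp f ⊤ → ∃ hf : MemLp f p,
        (T (hf.toLp f) : P → ℂ) =ᵐ[volume] integralOp K f := by
  have hmem : ∀ f : integrableBounded P, MemLp (f : P → ℂ) p := fun f =>
    memLp_of_memLp_one_of_memLp_top f.2.1 f.2.2 hp1.out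
  have hmk : ∀ f : integrableBounded P, ∃ f' : P → ℂ, Measurable f' ∧ (f : P → ℂ) =ᵐ[volume] f' :=
    fun f => ⟨f.2.1.1.mk _, f.2.1.1.stronglyMeasurable_mk.measurable, f.2.1.1.ae_eq_mk⟩
  have hop : ∀ f f' : P → ℂ, f =ᵐ[volume] f' → integralOp K f = integralOp K f' := by
    intro f f' h
    funext x
    refine integral_congr_ae ?_
    filter_upwards [h] with y hy
    rw [hy]
  have hle : ∀ f : integrableBounded P,
      eLpNorm (integralOp K f) q ≤ ENNReal.ofReal M * eLpNorm (f : P → ℂ) p := by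
    intro f
    obtain ⟨f', hf', h⟩ := hmk f
    rw [hop _ _ h, eLpNorm_congr_ae h]
    exact H f' hf' (f.2.1.ae_eq h) (f.2.2.ae_eq h)
  have hopm : ∀ f : integrableBounded P, MemLp (integralOp K f) q := by
    intro f
    refine ⟨?_, (hle f).trans_lt (ENNReal.mul_lt_top ENNReal.ofReal_lt_top (hmem f).2)⟩
    obtain ⟨f', hf', h⟩ := hmk f
    rw [hop _ _ h]
    exact (measurable_integralOp hK hf').aestronglyMeasurable
  have hint : ∀ (f : integrableBounded P) (x : P), Integrable fun y => K x y * (f : P → ℂ) y :=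
    fun f x => integrable_kernel_mul hK hc (memLp_one_iff_integrable.1 f.2.1) x
  let e : integrableBounded P →ₗ[ℂ] Lp ℂ p (volume : Measure P) :=
    { toFun := fun f => (hmem f).toLp f
      map_add' := fun _ _ => rfl
      map_smul' := fun _ _ => rfl }
  let F : integrableBounded P →ₗ[ℂ] Lp ℂ q (volume : Measure P) :=
    { toFun := fun f => (hopm f).toLp (integralOp K f)
      map_add' := fun f g => by
        rw [← MemLp.toLp_add]
        congr 1
        funext x
        simp only [integralOp, Submodule.coe_add, Pi.add_apply, mul_add]
        exact integral_add (hint f x) (hint g x)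
      map_smul' := fun a f => by
        rw [RingHom.id_apply, ← MemLp.toLp_const_smul]
        congr 1
        funext x
        simp only [integralOp, Submodule.coe_smul, Pi.smul_apply, smul_eq_mul, mul_left_comm _ a]
        exact integral_const_mul _ _ }
  have he : ∀ f, e f = (hmem f).toLp f := fun _ => rfl
  have hF : ∀ f, F f = (hopm f).toLp (integralOp K f) := fun _ => rfl
  have hdense : DenseRange e := by
    refine (Lp.simpleFunc.dense (E := ℂ) (μ := (volume : Measure P)) hp).mono ?_
    intro φ hφ
    have hp0 : p ≠ 0 := (zero_lt_one.trans_le hp1.out).ne'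
    have hs := Lp.simpleFunc.memLp (⟨φ, hφ⟩ : Lp.simpleFunc ℂ p (volume : Measure P))
    have hs1 := (SimpleFunc.memLp_iff_integrable hp0 hp).1 hs
    refine ⟨⟨Lp.simpleFunc.toSimpleFunc ⟨φ, hφ⟩, memLp_one_iff_integrable.2 hs1,
      SimpleFunc.memLp_top _ _⟩, ?_⟩
    rw [he]
    exact congrArg Subtype.val
      (Lp.simpleFunc.toLp_toSimpleFunc (⟨φ, hφ⟩ : Lp.simpleFunc ℂ p (volume : Measure P)))
  have hnorm : ∀ f, ‖F f‖ ≤ M * ‖e f‖ := by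
    intro f
    rw [he, hF, Lp.norm_toLp, Lp.norm_toLp]
    have := ENNReal.toReal_mono (ENNReal.mul_ne_top ENNReal.ofReal_ne_top (hmem f).2.ne) (hle f)
    rwa [ENNReal.toReal_mul, ENNReal.toReal_ofReal hM] at this
  refine ⟨F.extendOfNorm e, LinearMap.opNorm_extendOfNorm_le hdense hM hnorm, fun f h1 h2 =>
    ⟨memLp_of_memLp_one_of_memLp_top h1 h2 hp1.out, ?_⟩⟩
  have := LinearMap.extendOfNorm_eq hdense ⟨M, hnorm⟩ (⟨f, h1, h2⟩ : integrableBounded P)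
  rw [he, hF] at this
  rw [this]
  exact (hopm ⟨f, h1, h2⟩).coeFn_toLp

end Extension

/-! ### Measurable versions of the kernel and the two spaces -/

/-- A measurable version of the kernel. It is set to zero where it violates the decay bound, so that
this bound holds everywhere. -/
theorem exists_measurable_ae_eq {Y X : Type} [MeasureSpace Y] [NormedAddCommGroup X]
    [MeasureSpace X] [BorelSpace X] [SecondCountableTopology X] {k C₄ : ℝ} (hC₄ : 0 ≤ C₄)
    {K : Y × X → Y × X → ℂ} (hK : AEStronglyMeasurable (Function.uncurry K) volume)
    (hdec : ∀ x y, ‖K x y‖ ≤ C₄ * (1 + ‖y.2 - x.2‖) ^ (-k)) :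
    ∃ K' : Y × X → Y × X → ℂ, Measurable (Function.uncurry K') ∧
      (∀ x y, ‖K' x y‖ ≤ C₄ * (1 + ‖y.2 - x.2‖) ^ (-k)) ∧
      ∀ᵐ z : (Y × X) × (Y × X), K' z.1 z.2 = K z.1 z.2 := by
  classical
  set G := hK.mk (Function.uncurry K) with hG
  have hGm : Measurable G := hK.stronglyMeasurable_mk.measurable
  have hsub : Measurable fun z : X × X => ‖z.2 - z.1‖ :=
    (by fun_prop : Continuous fun z : X × X => ‖z.2 - z.1‖).measurable
  have hw : Measurable fun z : (Y × X) × (Y × X) => C₄ * (1 + ‖z.2.2 - z.1.2‖) ^ (-k) :=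
    (((hsub.comp (measurable_fst.snd.prodMk measurable_snd.snd)).const_add 1).pow_const
      (-k)).const_mul C₄
  set S : Set ((Y × X) × (Y × X)) := {z | ‖G z‖ ≤ C₄ * (1 + ‖z.2.2 - z.1.2‖) ^ (-k)} with hS
  have hSm : MeasurableSet S := measurableSet_le hGm.norm hw
  refine ⟨fun x y => S.indicator G (x, y), hGm.indicator hSm, fun x y => ?_, ?_⟩
  · by_cases hxy : (x, y) ∈ S
    · simp only [Set.indicator_of_mem hxy]
      exact hxy
    · simp only [Set.indicator_of_notMem hxy, norm_zero]
      positivity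
  · filter_upwards [hK.ae_eq_mk] with z hz
    have hz' : G z = K z.1 z.2 := hz.symm
    have : z ∈ S := by
      rw [hS, Set.mem_ofPred_eq, hz']
      exact hdec z.1 z.2
    change S.indicator G z = K z.1 z.2
    rw [Set.indicator_of_mem this, hz']

section Version

variable {Y X : Type} [MeasureSpace Y] [SigmaFinite (volume : Measure Y)]

/-- The bounds for `A^* B` depend on the kernels up to null sets only. -/
theorem PairBounds.congr_ae {D : Set (Y → ℂ)} {c₂ c₃ : ℝ≥0∞} {a b a' b' : Y → Y → ℂ}
    (h : PairBounds D c₂ c₃ a b) (ha : ∀ᵐ w : Y × Y, a' w.1 w.2 = a w.1 w.2)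
    (hb : ∀ᵐ w : Y × Y, b' w.1 w.2 = b w.1 w.2) : PairBounds D c₂ c₃ a' b' := by
  have ha1 : ∀ᵐ y : Y, ∀ᵐ x : Y, a' x y = a x y :=
    Measure.ae_ae_of_ae_prod
      ((Measure.measurePreserving_swap (μ := (volume : Measure Y))
        (ν := (volume : Measure Y))).quasiMeasurePreserving.ae ha)
  have hb1 : ∀ᵐ x : Y, ∀ᵐ z : Y, b' x z = b x z := Measure.ae_ae_of_ae_prod hb
  have hcomp : ∀ g, compAdj a' b' g =ᵐ[volume] compAdj a b g := by
    intro g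
    filter_upwards [ha1] with y hy
    refine integral_congr_ae ?_
    filter_upwards [hy, hb1] with x hx hx'
    refine integral_congr_ae ?_
    filter_upwards [hx'] with z hz
    rw [hx, hz]
  refine ⟨fun g hg => ?_, fun g hg => ?_, fun g hg => ?_⟩
  · filter_upwards [h.converges g hg, ha1] with y hy hya
    refine hy.congr ?_
    have hya' : ∀ᵐ w : Y × Y, a' w.1 y = a w.1 y :=
      Measure.quasiMeasurePreserving_fst.ae hya
    filter_upwards [hya', hb] with w hw hw'
    rw [hw, hw']
  · rw [eLpNorm_congr_ae (hcomp g)]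
    exact h.l2_bound g hg
  · rw [eLpNorm_congr_ae (hcomp g)]
    exact h.decay_bound g hg

variable [MeasureSpace X] [SigmaFinite (volume : Measure X)]

theorem measurePreserving_interchange :
    MeasurePreserving (fun z : (X × X) × (Y × Y) => ((z.2.1, z.1.1), (z.2.2, z.1.2)))
      (volume : Measure ((X × X) × (Y × Y))) (volume : Measure ((Y × X) × (Y × X))) := by
  have h1 := measurePreserving_prodAssoc (volume : Measure X) (volume : Measure X)
    (volume : Measure (Y × Y))
  have h2 := (MeasurePreserving.id (volume : Measure X)).prod
    ((measurePreserving_prodAssoc (volume : Measure X) (volume : Measure Y)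
      (volume : Measure Y)).symm)
  have h3 := (MeasurePreserving.id (volume : Measure X)).prod
    ((Measure.measurePreserving_swap (μ := (volume : Measure X))
      (ν := (volume : Measure Y))).prod (MeasurePreserving.id (volume : Measure Y)))
  have h4 := (MeasurePreserving.id (volume : Measure X)).prod
    (measurePreserving_prodAssoc (volume : Measure Y) (volume : Measure X) (volume : Measure Y))
  have h5 := (measurePreserving_prodAssoc (volume : Measure X) (volume : Measure Y)
    (volume : Measure (X × Y))).symm
  have h6 := (Measure.measurePreserving_swap (μ := (volume : Measure X))
      (ν := (volume : Measure Y))).prod (Measure.measurePreserving_swap (μ := (volume : Measure X))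
      (ν := (volume : Measure Y)))
  exact h6.comp (h5.comp (h4.comp (h3.comp (h2.comp h1))))

theorem ae_ae_ae_of_ae_prod_prod {p : Y × X → Y × X → Prop}
    (h : ∀ᵐ z : (Y × X) × (Y × X), p z.1 z.2) :
    ∀ᵐ s : X, ∀ᵐ t : X, ∀ᵐ w : Y × Y, p (w.1, s) (w.2, t) :=
  Measure.ae_ae_of_ae_prod (Measure.ae_ae_of_ae_prod
    (measurePreserving_interchange.quasiMeasurePreserving.ae h))

variable [NormedAddCommGroup X]

/-- Bounds on all fibres of a kernel `K` carry over to any measurable kernel which agrees with `K`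
almost everywhere, for almost all fibres. -/
theorem FibredKernel.of_ae_eq {D : Set (Y → ℂ)} {k C₂ C₃ C₄ : ℝ} {K K' : Y × X → Y × X → ℂ}
    (hm : Measurable (Function.uncurry K'))
    (hdec : ∀ x y, ‖K' x y‖ ≤ C₄ * (1 + ‖y.2 - x.2‖) ^ (-k))
    (hK : ∀ᵐ z : (Y × X) × (Y × X), K' z.1 z.2 = K z.1 z.2)
    (h : ∀ s t u, PairBounds D (ENNReal.ofReal (C₂ ^ 2))
      (ENNReal.ofReal (C₃ ^ 2 * (1 + ‖t - u‖) ^ (-k)))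
      (fun x y => K (x, s) (y, t)) (fun x y => K (x, s) (y, u))) :
    FibredKernel D k C₂ C₃ C₄ K' where
  measurable := hm
  decay := hdec
  pairBounds := ⟨fun s t => ∀ᵐ w : Y × Y, K' (w.1, s) (w.2, t) = K (w.1, s) (w.2, t),
    ae_ae_ae_of_ae_prod_prod (p := fun x y => K' x y = K x y) hK,
    fun s t u ht hu => (h s t u).congr_ae ht hu⟩

end Version

section Spaces

theorem linearGrowth_real : LinearGrowth ℝ := by
  intro x r hr
  rw [Real.volume_closedBall]
  exact ENNReal.ofReal_le_ofReal (by linarith)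

theorem linearGrowth_int : LinearGrowth ℤ := by
  intro x r hr
  rw [Int.closedBall_eq_Icc]
  have e : (volume : Measure ℤ) (Set.Icc ⌈(x : ℝ) - r⌉ ⌊(x : ℝ) + r⌋)
      = ((Finset.Icc ⌈(x : ℝ) - r⌉ ⌊(x : ℝ) + r⌋).card : ℝ≥0∞) := by
    rw [← Finset.coe_Icc]
    exact Measure.count_apply_finset _
  rw [e, Int.card_Icc, ← ENNReal.ofReal_natCast]
  refine ENNReal.ofReal_le_ofReal ?_
  have h1 : (⌊(x : ℝ) + r⌋ : ℝ) ≤ x + r := Int.floor_le _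
  have h2 : (x : ℝ) - r ≤ ⌈(x : ℝ) - r⌉ := Int.le_ceil _
  have h3 : (((⌊(x : ℝ) + r⌋ + 1 - ⌈(x : ℝ) - r⌉).toNat : ℤ) : ℝ)
      = ((max (⌊(x : ℝ) + r⌋ + 1 - ⌈(x : ℝ) - r⌉) 0 : ℤ) : ℝ) := by rw [Int.toNat_eq_max]
  rw [Int.cast_natCast] at h3
  rw [h3, Int.cast_max]
  push_cast
  exact max_le (by linarith) (by linarith)

theorem memLp_of_mem_smoothTest {E : Type} [NormedAddCommGroup E] [NormedSpace ℝ E] [MeasureSpace E]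
    [BorelSpace E] [IsFiniteMeasureOnCompacts (volume : Measure E)]
    {g : E → ℂ} (hg : g ∈ smoothTest E) (p : ℝ≥0∞) : MemLp g p :=
  hg.1.continuous.memLp_of_hasCompactSupport hg.2

/-- Smooth functions approximate functions with support in a ball by convolution with bump
functions. -/
theorem approximating_smoothTest {E : Type} [NormedAddCommGroup E] [NormedSpace ℝ E]
    [FiniteDimensional ℝ E] [MeasureSpace E] [BorelSpace E]
    [(volume : Measure E).IsAddHaarMeasure] :
    Approximating (smoothTest E) (fun R : ℕ => Metric.closedBall (0 : E) R) where
  measurable g hg := hg.1.continuous.measurable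
  memLp g hg p := memLp_of_mem_smoothTest hg p
  measurableSet R := Metric.isClosed_closedBall.measurableSet
  mono _ _ h := Metric.closedBall_subset_closedBall (by exact_mod_cast h)
  iUnion := Metric.iUnion_closedBall_nat 0
  finite R := (isCompact_closedBall _ _).measure_lt_top
  approx R g hg hg1 hg0 := by
    have hsupp : HasCompactSupport g := by
      refine HasCompactSupport.of_support_subset_isCompact (isCompact_closedBall (0 : E) R) ?_
      intro y hy
      by_contra h
      exact hy (hg0 y h)
    have hgi : Integrable g := integrable_of_norm_le_one Metric.isClosed_closedBall.measurableSet
      (isCompact_closedBall (0 : E) (R : ℝ)).measure_lt_top.ne hg hg1 hg0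
    let φ : ℕ → ContDiffBump (0 : E) := fun n =>
      { rIn := 1 / (2 * ((n : ℝ) + 1))
        rOut := 1 / ((n : ℝ) + 1)
        rIn_pos := by positivity
        rIn_lt_rOut := by
          apply one_div_lt_one_div_of_lt <;> linarith [(Nat.cast_nonneg n : (0 : ℝ) ≤ n)] }
    let χ : ContDiffBump (0 : E) :=
      { rIn := (R : ℝ) + 1
        rOut := (R : ℝ) + 2
        rIn_pos := by positivity
        rIn_lt_rOut := by linarith }
    have hout : ∀ n, (φ n).rOut ≤ 1 := fun n => by
      change 1 / ((n : ℝ) + 1) ≤ 1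
      rw [div_le_one (by positivity)]
      linarith [(Nat.cast_nonneg n : (0 : ℝ) ≤ n)]
    let u : ℕ → E → ℂ := fun n =>
      convolution ((φ n).normed volume) g (ContinuousLinearMap.lsmul ℝ ℝ) volume
    have hu : ∀ n y, u n y = ∫ t, (φ n).normed volume t • g (y - t) := fun n y => rfl
    refine ⟨u, fun y => ((χ y : ℝ) : ℂ), ⟨?_, ?_⟩, fun n => ⟨?_, ?_⟩, fun n y => ?_, ?_⟩
    · exact Complex.ofRealCLM.contDiff.comp χ.contDiff
    · exact χ.hasCompactSupport.comp_left (g := fun r : ℝ => (r : ℂ)) Complex.ofReal_zero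
    · exact (φ n).hasCompactSupport_normed.contDiff_convolution_left _ (φ n).contDiff_normed
        hgi.locallyIntegrable
    · exact (φ n).hasCompactSupport_normed.convolution _ hsupp
    · rw [Complex.norm_real, Real.norm_of_nonneg χ.nonneg, hu]
      by_cases hy : ‖y‖ ≤ R + 1
      · rw [χ.one_of_mem_closedBall (by simpa using hy), ← (φ n).integral_normed (μ := volume)]
        refine norm_integral_le_of_norm_le (φ n).integrable_normed (ae_of_all _ fun t => ?_)
        rw [norm_smul, Real.norm_of_nonneg ((φ n).nonneg_normed t)]
        exact mul_le_of_le_one_right ((φ n).nonneg_normed t) (hg1 _)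
      · have h0 : ∀ t, (φ n).normed volume t • g (y - t) = 0 := by
          intro t
          by_cases ht : t ∈ Metric.ball (0 : E) (φ n).rOut
          · rw [hg0, smul_zero]
            intro hyt
            rw [mem_closedBall_zero_iff] at hyt
            rw [mem_ball_zero_iff] at ht
            have := norm_le_norm_add_norm_sub' y t
            exact hy (by linarith [hout n])
          · rw [← (φ n).support_normed_eq (μ := volume), Function.notMem_support] at ht
            rw [ht, zero_smul]
        simp only [h0, integral_zero, norm_zero]
        exact χ.nonneg
    · refine ContDiffBump.ae_convolution_tendsto_right_of_locallyIntegrable (K := 2) ?_ ?_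
        hgi.locallyIntegrable
      · exact tendsto_one_div_add_atTop_nhds_zero_nat
      · refine Eventually.of_forall fun n => ?_
        change 1 / ((n : ℝ) + 1) ≤ 2 * (1 / (2 * ((n : ℝ) + 1)))
        exact le_of_eq (by field_simp)

theorem memLp_of_mem_finTest {α : Type} [Countable α] [MeasureSpace α]
    [MeasurableSingletonClass α] (hα : ∀ x : α, volume {x} < ⊤) {g : α → ℂ}
    (hg : g ∈ finTest α) (p : ℝ≥0∞) : MemLp g p := by
  have hfin : ∀ s : Set α, s.Finite → volume s < ⊤ := fun s hs => by
    rw [← Set.biUnion_of_singleton s]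
    exact measure_biUnion_lt_top hs fun i _ => hα i
  have htop : MemLp g ⊤ := by
    obtain ⟨C, hC⟩ := (hg.image fun x => ‖g x‖).bddAbove
    refine memLp_top_of_bound (Measurable.of_discrete).aestronglyMeasurable (max C 0)
      (ae_of_all _ fun x => ?_)
    by_cases hx : g x = 0
    · rw [hx, norm_zero]; exact le_max_right _ _
    · exact (hC ⟨x, hx, rfl⟩).trans (le_max_left _ _)
  exact htop.mono_exponent_of_measure_support_ne_top (s := g.support)
    (fun x hx => by simpa using hx) (hfin _ hg).ne le_top

theorem approximating_finTest {α : Type} [Countable α] [MeasureSpace α]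
    [MeasurableSingletonClass α] (hα : ∀ x : α, volume {x} < ⊤) {B : ℕ → Set α}
    (hB : ∀ R, (B R).Finite) (hmono : Monotone B) (hun : ⋃ R, B R = Set.univ) :
    Approximating (finTest α) B where
  measurable g _ := Measurable.of_discrete
  memLp g hg p := memLp_of_mem_finTest hα hg p
  measurableSet R := (hB R).measurableSet
  mono := hmono
  iUnion := hun
  finite R := by
    rw [← Set.biUnion_of_singleton (B R)]
    exact measure_biUnion_lt_top (hB R) fun i _ => hα i
  approx R g _ _ hg0 := by
    have hg : g ∈ finTest α := (hB R).subset fun y hy => by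
      by_contra h
      exact hy (hg0 y h)
    exact ⟨fun _ => g, g, hg, fun _ => hg, fun _ _ => le_rfl, ae_of_all _ fun _ =>
      tendsto_const_nhds⟩

theorem volume_int_singleton (x : ℤ) : (volume : Measure ℤ) {x} = 1 :=
  Measure.count_singleton x

theorem volume_pi_int_singleton {n : ℕ} (x : Fin n → ℤ) :
    (volume : Measure (Fin n → ℤ)) {x} = 1 := by
  rw [volume_pi, Measure.pi_singleton]
  simp [volume_int_singleton]

theorem volume_pt_int_singleton {n : ℕ} (x : Pt ℤ n) : (volume : Measure (Pt ℤ n)) {x} = 1 := by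
  obtain ⟨y, s⟩ := x
  rw [← Set.singleton_prod_singleton, Measure.volume_eq_prod, Measure.prod_prod,
    volume_pi_int_singleton, volume_int_singleton, mul_one]

theorem approximating_finTest_pi_int (n : ℕ) : Approximating (finTest (Fin n → ℤ))
    (fun R : ℕ => Set.Icc (fun _ => -(R : ℤ)) (fun _ => (R : ℤ))) := by
  refine approximating_finTest (fun x => by rw [volume_pi_int_singleton]; exact ENNReal.one_lt_top)
    (fun R => Set.finite_Icc _ _) (fun R R' h => ?_) (Set.eq_univ_of_forall fun x => ?_)
  · exact Set.Icc_subset_Icc (fun _ => by simpa using h) (fun _ => by simpa using h)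
  · rw [Set.mem_iUnion]
    refine ⟨∑ i, (x i).natAbs, fun i => ?_, fun i => ?_⟩
    all_goals
      have := Finset.single_le_sum (f := fun i => (x i).natAbs) (fun _ _ => Nat.zero_le _)
        (Finset.mem_univ i)
      simp only at this ⊢
      omega

end Spaces

/-! ### Conclusion -/

section Exponents

variable {p : ℝ≥0∞}

theorem recip_nonneg (p : ℝ≥0∞) : 0 ≤ recip p := ENNReal.toReal_nonneg

theorem recip_eq_inv_toReal (p : ℝ≥0∞) : recip p = p.toReal⁻¹ := ENNReal.toReal_inv p

theorem recip_le_one (hp : 1 ≤ p) : recip p ≤ 1 :=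
  ENNReal.toReal_mono ENNReal.one_ne_top (ENNReal.inv_le_one.2 hp)

theorem recip_lt_of_ofReal_lt {x : ℝ} (hx : 0 < x) (h : ENNReal.ofReal x < p) :
    recip p < x⁻¹ := by
  refine ENNReal.toReal_lt_of_lt_ofReal ?_
  rw [ENNReal.ofReal_inv_of_pos hx]
  exact ENNReal.inv_lt_inv.2 h

theorem lt_recip_of_lt_ofReal {x : ℝ} (hp : 1 ≤ p) (hx : 0 < x) (h : p < ENNReal.ofReal x) :
    x⁻¹ < recip p := by
  refine (ENNReal.ofReal_lt_iff_lt_toReal (inv_pos.2 hx).le ?_).1 ?_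
  · exact ne_top_of_le_ne_top ENNReal.one_ne_top (ENNReal.inv_le_one.2 hp)
  · rw [ENNReal.ofReal_inv_of_pos hx]
    exact ENNReal.inv_lt_inv.2 h

theorem recip_pos (hp : 1 ≤ p) (hpt : p ≠ ⊤) : 0 < recip p := by
  rw [recip_eq_inv_toReal]
  exact inv_pos.2 (ENNReal.toReal_pos (zero_lt_one.trans_le hp).ne' hpt)

theorem normConst_nonneg (k l : ℝ) (p q : ℝ≥0∞) {C₂ C₃ C₄ : ℝ} (hC₂ : 0 < C₂) (hC₃ : 0 < C₃)
    (hC₄ : 0 < C₄) : 0 ≤ normConst k l p q C₂ C₃ C₄ := by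
  rw [normConst]
  split_ifs <;> positivity

end Exponents

section Ranges

variable {k l : ℝ} {p q : ℝ≥0∞}

/-- In each of the three ranges the exponents are admissible: `p < ∞` and `q > 1`. -/
theorem ne_top_and_recip_lt_one (hk : 0 < k) (hp : 1 ≤ p)
    (hl : recip p - recip q = 1 / l)
    (hpq : Range₁ k p q ∨ Range₂ k l p q ∨ Range₃ k p q) : p ≠ ⊤ ∧ recip q < 1 := by
  have hp1 := recip_le_one hp
  have hk1 : 0 < k + 1 := by linarith
  rcases hpq with ⟨h1, h2, -⟩ | ⟨h1, h2, h3, h4⟩ | ⟨h1, h2, h3⟩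
  · refine ⟨ne_top_of_le_ne_top ENNReal.ofReal_ne_top h1, ?_⟩
    have := recip_lt_of_ofReal_lt (by positivity) h2
    refine this.trans ?_
    rw [inv_div, div_lt_one (by positivity)]
    linarith
  · have h5 : 0 < 1 / l := by positivity
    refine ⟨?_, by linarith⟩
    rintro rfl
    have := recip_nonneg q
    have h6 : recip ⊤ = 0 := by simp [recip]
    linarith
  · refine ⟨ne_top_of_lt h1, ?_⟩
    rw [div_mul_eq_mul_div, div_le_iff₀ hk, recipConj] at h3
    have := recip_nonneg p
    nlinarith

/-- The strong type bounds in the three ranges; the third range follows from the first by passing to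
the adjoint kernel. -/
theorem exists_strongBound_of_range (hk : 0 < k) (hp : 1 ≤ p)
    (hl : recip p - recip q = 1 / l)
    (hpq : Range₁ k p q ∨ Range₂ k l p q ∨ Range₃ k p q) :
    ∃ C : ℝ, 0 < C ∧ ∀ (Y X : Type) [MeasureSpace Y] [SigmaFinite (volume : Measure Y)]
      [NormedAddCommGroup X] [MeasureSpace X] [BorelSpace X] [SecondCountableTopology X]
      [SigmaFinite (volume : Measure X)], LinearGrowth X →
      ∀ (D : Set (Y → ℂ)) (B : ℕ → Set Y), Approximating D B →
      ∀ (C₂ C₃ C₄ : ℝ), 0 < C₂ → 0 < C₃ → 0 < C₄ →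
      ∀ K : Y × X → Y × X → ℂ, FibredKernel D k C₂ C₃ C₄ K →
      FibredKernel D k C₂ C₃ C₄ (fun x y => conj (K y x)) →
      StrongBound K (C * normConst k l p q C₂ C₃ C₄) (1 / (1 - recipConj p))
        (1 / (1 - recip q)) := by
  have hk1 : 0 < k + 1 := by linarith
  have ha : 0 ≤ recipConj p := sub_nonneg.2 (recip_le_one hp)
  have hb : 0 ≤ recip q := recip_nonneg q
  -- the endpoint `(p, q) = (1, ∞)`
  have trivial_bound : recipConj p = 0 → recip q = 0 → ∀ (Y X : Type) [MeasureSpace Y]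
      [SigmaFinite (volume : Measure Y)] [NormedAddCommGroup X] [MeasureSpace X] [BorelSpace X]
      [SecondCountableTopology X] [SigmaFinite (volume : Measure X)] (D : Set (Y → ℂ))
      (C₂ C₃ C₄ : ℝ), 0 < C₄ → ∀ K : Y × X → Y × X → ℂ, FibredKernel D k C₂ C₃ C₄ K →
      StrongBound K C₄ (1 / (1 - recipConj p)) (1 / (1 - recip q)) := by
    intro ha0 hb0 Y X _ _ _ _ _ _ _ D C₂ C₃ C₄ hC₄ K H
    rw [ha0, hb0, sub_zero, div_one]
    exact strongBound_of_norm_le (H.norm_le hk hC₄)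
  by_cases h1 : Range₁ k p q
  · have hN : ∀ C₂ C₃ C₄ : ℝ, normConst k l p q C₂ C₃ C₄ =
        C₂ ^ (2 * recipConj p) * C₃ ^ (2 * recip q - 2 * recipConj p) * C₄ ^ (1 - 2 * recip q) :=
      fun C₂ C₃ C₄ => by rw [normConst, if_pos h1]
    simp only [hN]
    obtain ⟨-, h2, h3⟩ := h1
    have hbk : recip q < k / (2 * k + 1) := by
      have := recip_lt_of_ofReal_lt (by positivity) h2
      rwa [inv_div, add_comm] at this
    rcases hb.eq_or_lt with hb0 | hb0
    · have ha0 : recipConj p = 0 := by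
        rw [← hb0] at h3
        exact le_antisymm (nonpos_of_mul_nonpos_right h3 (by positivity)) ha
      refine ⟨1, one_pos, ?_⟩
      intro Y X _ _ _ _ _ _ _ _ D B _ C₂ C₃ C₄ _ _ hC₄ K H _
      have := trivial_bound ha0 hb0.symm Y X D C₂ C₃ C₄ hC₄ K H
      simpa [ha0, ← hb0] using this
    · obtain ⟨C, hC, h⟩ := exists_strongBound_below_ray hk ha h3 hb0 hbk
      exact ⟨C, hC, fun Y X _ _ _ _ _ _ _ hX D B hD C₂ C₃ C₄ hC₂ hC₃ hC₄ K H _ =>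
        h Y X hX D B hD C₂ C₃ C₄ hC₂ hC₃ hC₄ K H⟩
  by_cases h2 : Range₂ k l p q
  · have hl0 : 0 < l := by linarith [h2.1]
    have hab : recipConj p + recip q = 1 - 1 / l := by rw [recipConj]; linarith
    have hN : ∀ C₂ C₃ C₄ : ℝ, normConst k l p q C₂ C₃ C₄ =
        C₂ ^ (2 * k / (2 * k + 1) * (recipConj p + recip q)) *
          C₃ ^ (2 / (2 * k + 1) * (recipConj p + recip q)) *
          C₄ ^ (1 - 2 * (k + 1) / (2 * k + 1) * (recipConj p + recip q)) := by
      intro C₂ C₃ C₄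
      have e : (2 * (k + 1) - l) / ((2 * k + 1) * l)
          = 1 - 2 * (k + 1) / (2 * k + 1) * (1 - 1 / l) := by
        have : (2 * k + 1) ≠ 0 := by positivity
        field_simp
        ring
      rw [normConst, if_neg h1, if_pos h2, hab, e]
    simp only [hN]
    obtain ⟨-, h3, h4, h5⟩ := h2
    refine exists_strongBound_between_rays hk h4 h5 ?_
    have h6 : 1 / (k + 1) ≤ 1 / l := one_div_le_one_div_of_le hl0 h3
    have h7 : k / (k + 1) = 1 - 1 / (k + 1) := by field_simp; ring
    rw [hab, h7]
    linarith
  · have h3 : Range₃ k p q := by tauto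
    have hN : ∀ C₂ C₃ C₄ : ℝ, normConst k l p q C₂ C₃ C₄ =
        C₂ ^ (2 * recip q) * C₃ ^ (2 * recipConj p - 2 * recip q) * C₄ ^ (1 - 2 * recipConj p) :=
      fun C₂ C₃ C₄ => by rw [normConst, if_neg h1, if_neg h2]
    simp only [hN]
    obtain ⟨h4, -, h5⟩ := h3
    have hak : recipConj p < k / (2 * k + 1) := by
      have := lt_recip_of_lt_ofReal hp (by positivity) h4
      rw [inv_div] at this
      have e : k / (2 * k + 1) = 1 - (1 + k) / (1 + 2 * k) := by field_simp; ring
      rw [recipConj, e]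
      linarith
    rcases ha.eq_or_lt with ha0 | ha0
    · have hb0 : recip q = 0 := by
        rw [← ha0] at h5
        exact le_antisymm (nonpos_of_mul_nonpos_right h5 (by positivity)) hb
      refine ⟨1, one_pos, ?_⟩
      intro Y X _ _ _ _ _ _ _ _ D B _ C₂ C₃ C₄ _ _ hC₄ K H _
      have := trivial_bound ha0.symm hb0 Y X D C₂ C₃ C₄ hC₄ K H
      simpa [← ha0, hb0] using this
    · obtain ⟨C, hC, h⟩ := exists_strongBound_below_ray hk hb h5 ha0 hak
      exact ⟨C, hC, fun Y X _ _ _ _ _ _ _ hX D B hD C₂ C₃ C₄ hC₂ hC₃ hC₄ K _ H =>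
        (h Y X hX D B hD C₂ C₃ C₄ hC₂ hC₃ hC₄ _ H).of_adjoint⟩

/-- A strong type bound for the bilinear form, in terms of the extended exponents. -/
theorem StrongBound.eLpNorm_integralOp_le {P : Type} [MeasureSpace P]
    [SigmaFinite (volume : Measure P)] {K : P → P → ℂ} {c M : ℝ}
    (hK : Measurable (Function.uncurry K)) (hc : ∀ x y, ‖K x y‖ ≤ c) (hp : 1 ≤ p) (hpt : p ≠ ⊤)
    (hq : 1 ≤ q) (hq1 : recip q < 1)
    (H : StrongBound K M (1 / (1 - recipConj p)) (1 / (1 - recip q))) {f : P → ℂ}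
    (hf : Measurable f) (hf1 : MemLp f 1) (hft : MemLp f ⊤) :
    eLpNorm (integralOp K f) q ≤ ENNReal.ofReal M * eLpNorm f p := by
  have hp0 : p ≠ 0 := (zero_lt_one.trans_le hp).ne'
  have ep : 1 / (1 - recipConj p) = p.toReal := by
    rw [recipConj, sub_sub_cancel, recip_eq_inv_toReal, one_div, inv_inv]
  rw [ep] at H
  have hfp : ∫⁻ x, ‖f x‖ₑ ^ p.toReal ≠ ⊤ := (lintegral_rpow_enorm_lt_top_of_eLpNorm_lt_top hp0 hpt
    (memLp_of_memLp_one_of_memLp_top hf1 hft hp).2).ne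
  have hfi := memLp_one_iff_integrable.1 hf1
  rw [eLpNorm_eq_lintegral_rpow_enorm_toReal hp0 hpt]
  rcases eq_or_ne q ⊤ with rfl | hqt
  · have h0 : recip ⊤ = 0 := by simp [recip]
    rw [h0, sub_zero, div_one] at H
    exact H.eLpNorm_integralOp_top_le hK hc hf hfi hfp
  · have hq0 : q ≠ 0 := (zero_lt_one.trans_le hq).ne'
    have hqpos := recip_pos hq hqt
    have h := H.lintegral_integralOp_rpow_le hK hc
      (by rw [one_lt_div (by linarith)]; linarith) hf hfi hfp
    have e1 : 1 / (1 - recip q) / (1 / (1 - recip q) - 1) = q.toReal := by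
      have h1 : 1 - recip q ≠ 0 := by linarith
      have h2 : q.toReal = (recip q)⁻¹ := by rw [recip_eq_inv_toReal, inv_inv]
      have h3 : 1 / (1 - recip q) - 1 = recip q / (1 - recip q) := by field_simp; ring
      rw [h2, h3]
      field_simp
    have e2 : 1 - 1 / (1 / (1 - recip q)) = 1 / q.toReal := by
      rw [one_div_one_div, sub_sub_cancel, recip_eq_inv_toReal, one_div]
    rw [e1, e2] at h
    rwa [eLpNorm_eq_lintegral_rpow_enorm_toReal hq0 hqt]

theorem norm_sub_snd_le_euclDist {X : Type} [NormedAddCommGroup X] {n : ℕ} (x y : Pt X n) :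
    ‖y.2 - x.2‖ ≤ euclDist x y := by
  rw [euclDist, norm_sub_rev]
  refine Real.le_sqrt_of_sq_le ?_
  linarith [Finset.sum_nonneg fun i (_ : i ∈ Finset.univ) => sq_nonneg ‖x.1 i - y.1 i‖]

/-- The theorem for any space of linear growth and any class of test functions which approximates
bounded functions. -/
theorem exists_boundedBy_of_range (hk : 0 < k) [hp : Fact (1 ≤ p)] [hq : Fact (1 ≤ q)]
    (hl : recip p - recip q = 1 / l)
    (hpq : Range₁ k p q ∨ Range₂ k l p q ∨ Range₃ k p q) :
    ∃ L : ℝ, 0 < L ∧ ∀ (X : Type) [NormedAddCommGroup X] [MeasureSpace X] [BorelSpace X]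
      [SecondCountableTopology X] [SigmaFinite (volume : Measure X)], LinearGrowth X →
      ∀ (n : ℕ) (D : Set ((Fin n → X) → ℂ)) (B : ℕ → Set (Fin n → X)), Approximating D B →
      ∀ D' : Set (Pt X n → ℂ), (∀ f ∈ D', ∀ r : ℝ≥0∞, MemLp f r volume) →
      ∀ (K : Pt X n → Pt X n → ℂ) (C₂ C₃ C₄ : ℝ), 0 < C₂ → 0 < C₃ → 0 < C₄ →
      MemLp (Function.uncurry K) ∞ volume →
      FibreBounds D k C₂ C₃ K → FibreBounds D k C₂ C₃ (adjKernel K) →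
      Decay k C₄ K → BoundedBy D' K p q (L * normConst k l p q C₂ C₃ C₄) := by
  obtain ⟨L, hL, h⟩ := exists_strongBound_of_range hk hp.out hl hpq
  obtain ⟨hpt, hq1⟩ := ne_top_and_recip_lt_one hk hp.out hl hpq
  refine ⟨L, hL, ?_⟩
  intro X _ _ _ _ _ hX n D B hD D' hD' K C₂ C₃ C₄ hC₂ hC₃ hC₄ hK hS hS' hdec
  have hdec' : ∀ x y, ‖K x y‖ ≤ C₄ * (1 + ‖y.2 - x.2‖) ^ (-k) := fun x y => by
    refine (hdec x y).trans (mul_le_mul_of_nonneg_left ?_ hC₄.le)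
    exact Real.rpow_le_rpow_of_nonpos (by positivity)
      (by linarith [norm_sub_snd_le_euclDist x y]) (by linarith)
  have hpair : ∀ {K : Pt X n → Pt X n → ℂ}, FibreBounds D k C₂ C₃ K → ∀ s t u,
      PairBounds D (ENNReal.ofReal (C₂ ^ 2)) (ENNReal.ofReal (C₃ ^ 2 * (1 + ‖t - u‖) ^ (-k)))
        (fun x y => K (x, s) (y, t)) (fun x y => K (x, s) (y, u)) := fun hS s t u =>
    ⟨hS.converges s t u, hS.l2_bound s t u, hS.decay_bound s t u⟩
  obtain ⟨K', hm, hKdec, hKK⟩ := exists_measurable_ae_eq hC₄.le hK.1 hdec'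
  have H : FibredKernel D k C₂ C₃ C₄ K' := .of_ae_eq hm hKdec hKK (hpair hS)
  have H' : FibredKernel D k C₂ C₃ C₄ (fun x y => conj (K' y x)) := by
    refine .of_ae_eq (K := adjKernel K)
      (Complex.continuous_conj.measurable.comp (hm.comp measurable_swap)) (fun x y => ?_) ?_
      (hpair hS')
    · rw [RCLike.norm_conj, norm_sub_rev]
      exact hKdec y x
    · have := (Measure.measurePreserving_swap (μ := (volume : Measure (Pt X n)))
        (ν := (volume : Measure (Pt X n)))).quasiMeasurePreserving.ae hKK
      filter_upwards [this] with z hz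
      exact congrArg conj hz
  have hc := H.norm_le hk hC₄
  have hM : 0 ≤ L * normConst k l p q C₂ C₃ C₄ :=
    mul_nonneg hL.le (normConst_nonneg k l p q hC₂ hC₃ hC₄)
  obtain ⟨T, hT, hTf⟩ := exists_continuousLinearMap_of_eLpNorm_le (p := p) (q := q) hm hc hpt hM
    fun f hf hf1 hft => (h (Fin n → X) X hX D B hD C₂ C₃ C₄ hC₂ hC₃ hC₄ K' H
      H').eLpNorm_integralOp_le hm hc hp.out hpt hq.out hq1 hf hf1 hft
  refine ⟨T, hT, fun f hf => ?_⟩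
  obtain ⟨hfp, hTe⟩ := hTf f (hD' f hf 1) (hD' f hf ⊤)
  refine ⟨hfp, hTe.trans ?_⟩
  filter_upwards [Measure.ae_ae_of_ae_prod hKK] with x hx
  refine integral_congr_ae ?_
  filter_upwards [hx] with y hy
  rw [hy]

end Ranges

end OffDuality

theorem proposition2p3 (k : ℝ) (hk : 0 < k) (p q : ℝ≥0∞) [Fact (1 ≤ p)] [Fact (1 ≤ q)]
    (l : ℝ) (hl : OffDuality.recip p - OffDuality.recip q = 1 / l)
    (hpq : OffDuality.Range₁ k p q ∨ OffDuality.Range₂ k l p q ∨ OffDuality.Range₃ k p q) :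
    ∃ L : ℝ, 0 < L ∧
      -- the case `X = ℝ`, `d = n + 1`
      (∀ (n : ℕ), 1 ≤ n → ∀ (K : OffDuality.Pt ℝ n → OffDuality.Pt ℝ n → ℂ) (C₂ C₃ C₄ : ℝ),
        0 < C₂ → 0 < C₃ → 0 < C₄ →
        MemLp (Function.uncurry K) ∞ volume →
        OffDuality.FibreBounds (OffDuality.smoothTest (Fin n → ℝ)) k C₂ C₃ K →
        OffDuality.FibreBounds (OffDuality.smoothTest (Fin n → ℝ)) k C₂ C₃
          (OffDuality.adjKernel K) →
        OffDuality.Decay k C₄ K → OffDuality.Decay k C₄ (OffDuality.adjKernel K) →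
        OffDuality.BoundedBy (OffDuality.smoothTest (OffDuality.Pt ℝ n)) K p q
          (L * OffDuality.normConst k l p q C₂ C₃ C₄)) ∧
      -- the case `X = ℤ`, `d = n + 1`
      (∀ (n : ℕ), 1 ≤ n → ∀ (K : OffDuality.Pt ℤ n → OffDuality.Pt ℤ n → ℂ) (C₂ C₃ C₄ : ℝ),
        0 < C₂ → 0 < C₃ → 0 < C₄ →
        MemLp (Function.uncurry K) ∞ volume →
        OffDuality.FibreBounds (OffDuality.finTest (Fin n → ℤ)) k C₂ C₃ K →
        OffDuality.FibreBounds (OffDuality.finTest (Fin n → ℤ)) k C₂ C₃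
          (OffDuality.adjKernel K) →
        OffDuality.Decay k C₄ K → OffDuality.Decay k C₄ (OffDuality.adjKernel K) →
        OffDuality.BoundedBy (OffDuality.finTest (OffDuality.Pt ℤ n)) K p q
          (L * OffDuality.normConst k l p q C₂ C₃ C₄)) := by
  obtain ⟨L, hL, h⟩ := OffDuality.exists_boundedBy_of_range hk hl hpq
  refine ⟨L, hL, ?_, ?_⟩
  · intro n _ K C₂ C₃ C₄ hC₂ hC₃ hC₄ hK hS hS' hdec _
    exact h ℝ OffDuality.linearGrowth_real n _ _ OffDuality.approximating_smoothTest _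
      (fun f hf r => OffDuality.memLp_of_mem_smoothTest hf r) K C₂ C₃ C₄ hC₂ hC₃ hC₄ hK hS hS' hdec
  · intro n _ K C₂ C₃ C₄ hC₂ hC₃ hC₄ hK hS hS' hdec _
    exact h ℤ OffDuality.linearGrowth_int n _ _ (OffDuality.approximating_finTest_pi_int n) _
      (fun f hf r => OffDuality.memLp_of_mem_finTest (fun x => by
        rw [OffDuality.volume_pt_int_singleton]; exact ENNReal.one_lt_top) hf r)
      K C₂ C₃ C₄ hC₂ hC₃ hC₄ hK hS hS' hdec
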